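/- All logarithms $\log$ are to base 2. Let $\mathbb{M}_n$ be the set of matroids with ground set $[n]=\{1,\ldots,n\}$. A property of matroids holds for asymptotically almost all matroids if the fraction of matroids in $\mathbb{M}_n$ that have the property tends to $1$ as $n\to\infty$. A matroid of rank $r$ is paving if all its circuits have cardinality at least $r$, and sparse paving if both it and its dual are paving; let $s(n)$ be the number of sparse paving matroids in $\mathbb{M}_n$. Put $$\zeta(n):=57\,\frac{\log(n)^2}{n^2}\binom{n}{\lfloor n/2\rfloor},\qquad \Upsilon(n):=5\log(n)\,\zeta(n),\qquad \upsilon(n):=\frac{\Upsilon(n)+2\log(n+1)}{\log s(n)}.$$ For a matroid $M\in\mathbb{M}_n$ of rank $r$, let $d(M)$ and $b(M)$ denote the fractions of dependent sets of $M$ and of bases of $M$, respectively, among the $\binom{n}{r}$ subsets of $[n]$ of cardinality $r$. Theorem. (1) Asymptotically almost all matroids $M$ on $n$ elements satisfy $d(M)\leq \upsilon(n)+\frac{2}{n}$. (2) $\upsilon(n)+\frac{2}{n}=O\!\left(\frac{\log(n)^3}{n}\right)$ as $n\to\infty$. (3) Consequently, there is a constant $C>0$ such that asymptotically almost all matroids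 $M$ on $n$ elements satisfy $1-b(M)\leq C\,\frac{\log(n)^3}{n}$. -/

import Mathlib

namespace MatroidAsymptotics

open Filter Topology

/-- The matroids with (labelled) ground set `[n]`, modelled as `Fin n`. -/
def matroidsOn (n : ℕ) : Set (Matroid (Fin n)) :=
  {M | M.E = Set.univ}

/-- The rank `r(M)`, as a natural number (ground sets here are finite). -/
noncomputable def rk {n : ℕ} (M : Matroid (Fin n)) : ℕ :=
  M.eRank.toNat

/-- A matroid is paving if all its circuits have cardinality at least its rank. -/
def IsPaving {n : ℕ} (M : Matroid (Fin n)) : Prop :=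
  ∀ C : Set (Fin n), M.IsCircuit C → rk M ≤ C.ncard

/-- A matroid is sparse paving if both it and its dual are paving. -/
def IsSparsePaving {n : ℕ} (M : Matroid (Fin n)) : Prop :=
  IsPaving M ∧ IsPaving M✶

/-- `s(n)`, the number of sparse paving matroids with ground set `[n]`. -/
noncomputable def numSparsePaving (n : ℕ) : ℕ :=
  {M ∈ matroidsOn n | IsSparsePaving M}.ncard

/-- `P` holds for asymptotically almost all matroids: the proportion of matroids with
ground set `[n]` that satisfy `P` tends to `1` as `n → ∞`. -/
def AlmostAllMatroids (P : ∀ n : ℕ, Matroid (Fin n) → Prop) : Prop :=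
  Tendsto (fun n : ℕ => ({M ∈ matroidsOn n | P n M}.ncard : ℝ) / ((matroidsOn n).ncard : ℝ))
    atTop (𝓝 1)

/-- `d(M)`, the fraction of dependent sets among the subsets of the ground set of
cardinality `r(M)`. -/
noncomputable def depFraction {n : ℕ} (M : Matroid (Fin n)) : ℝ :=
  ({X : Set (Fin n) | X.ncard = rk M ∧ M.Dep X}.ncard : ℝ) / (n.choose (rk M) : ℝ)

/-- `b(M)`, the fraction of bases among the subsets of the ground set of
cardinality `r(M)`. -/
noncomputable def baseFraction {n : ℕ} (M : Matroid (Fin n)) : ℝ :=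
  ({B : Set (Fin n) | M.IsBase B}.ncard : ℝ) / (n.choose (rk M) : ℝ)

/-- `ζ(n) = 57 · log(n)² / n² · binom(n, ⌊n/2⌋)`, where `log` is the base-2 logarithm. -/
noncomputable def zetaBound (n : ℕ) : ℝ :=
  57 * (Real.logb 2 (n : ℝ) ^ 2 / (n : ℝ) ^ 2) * (n.choose (n / 2) : ℝ)

/-- `Υ(n) = 5 · log(n) · ζ(n)`. -/
noncomputable def bigUpsilon (n : ℕ) : ℝ :=
  5 * Real.logb 2 (n : ℝ) * zetaBound n

/-- `υ(n) = (Υ(n) + 2 · log(n + 1)) / log s(n)`. -/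
noncomputable def upsilon (n : ℕ) : ℝ :=
  (bigUpsilon n + 2 * Real.logb 2 ((n : ℝ) + 1)) / Real.logb 2 (numSparsePaving n : ℝ)

end MatroidAsymptotics

/-! Fix a rank r, and put N = C(n,r), L = log n and w = N/n². The dependent r-sets (nonbases) of a
matroid are vertices of the Johnson graph, in which X and X - x + y are adjacent. Stable sets of
this graph are, for 0 < r < n, exactly the nonbasis families of sparse paving matroids, so there are
at most s(n) of them. The core is `card_large_nonBases_le`: matroids of middle rank with at least b
nonbases are fewer than stable sets by a factor 2^(O(wL²) - (b - 6N/n)/(1792n)). Since log s(n) has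
order C(n,⌊n/2⌋)/n, the number υ(n) has order L³/n. With b = υ(n)N the gain in the exponent has
order wL³ and beats the cost wL² once L exceeds an absolute constant. Ranks outside [n/3, 2n/3]
carry too few r-sets to matter. Summing over ranks leaves at most |M_n|/(n+1) exceptional matroids.
The two bounds on log s(n) also give the order of υ(n), and 1 - b(M) = d(M) turns (1) and (2) into
(3).

Structure. If X is a nonbasis, then X - x + y is one exactly when X - x is dependent (a full row) or
X + y is nonspanning (a full column); see `IsIndepFamily.mem_nonBases_insert_erase`. So a circuit
and a hyperplane, each recorded as a set with a rank bound, witness all nonbases adjacent to X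
(`exists_local_cover`). Covering greedily with such pairs, O(wL) of them yield a family D of
nonbases that misses at most 6N/n nonbases and leaves fewer than θ uncovered in any clique of
nonbases (`exists_goodCover`). Naming the pairs costs O(wL²) bits. Given D, the matroid is recovered
from a stable set U of nonbases outside D (`exists_codes`, `CommonCover.nonBases_subset`).

Gain. Stable sets of the whole Johnson graph may use D as well, and D alone has at least 2^(|D|/n)
stable subsets. Members of U with a neighbour in D obstruct this, but they come from cliques that
are heavy in D and pairwise do not meet inside it. By the Kleitman–Winston method (`indepPoly_le`)
such configurations are rare enough to be traded for stable subsets of D, with a net saving of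
2^(|D|/(1792n)) in `card_admissible_le`. -/

namespace MatroidAsymptotics
open Finset

/-! ### Incidence averaging and the Kleitman–Winston bound -/

/-- Cauchy–Schwarz for incidences: some `a` has large total intersection with the others. -/
theorem exists_large_incidence {α β : Type*} [DecidableEq β] (C : Finset α) (P : Finset β)
    (inc : α → Finset β) (hsub : ∀ a ∈ C, inc a ⊆ P) (h : ℝ) (h0 : 0 ≤ h)
    (hh : ∀ a ∈ C, h ≤ (#(inc a) : ℝ)) (hC : C.Nonempty) :
    ∃ a ∈ C, (#C : ℝ) * h ^ 2 ≤ #P * ∑ b ∈ C, (#(inc a ∩ inc b) : ℝ) := by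
  by_contra! hcon
  have key : ∀ a ∈ C, ∀ b ∈ C, (#(inc a ∩ inc b) : ℝ) =
      ∑ y ∈ P, (if y ∈ inc a then (1 : ℝ) else 0) * (if y ∈ inc b then 1 else 0) := by
    intro a ha b hb
    have h1 : ∀ y ∈ P, (if y ∈ inc a then (1 : ℝ) else 0) * (if y ∈ inc b then 1 else 0) =
        if y ∈ inc a ∩ inc b then 1 else 0 := by
      intro y _
      by_cases h1 : y ∈ inc a <;> by_cases h2 : y ∈ inc b <;> simp [h1, h2]
    rw [Finset.sum_congr rfl h1, Finset.sum_boole]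
    congr 2
    ext y
    rw [mem_filter]
    exact ⟨fun hy => ⟨hsub a ha (mem_inter.1 hy).1, hy⟩, fun hy => hy.2⟩
  have cardeq : ∀ a ∈ C, (#(inc a) : ℝ) = ∑ y ∈ P, (if y ∈ inc a then (1 : ℝ) else 0) := by
    intro a ha
    rw [Finset.sum_boole]
    congr 2
    ext y
    simp only [mem_filter]
    exact ⟨fun hy => ⟨hsub a ha hy, hy⟩, fun hy => hy.2⟩
  set d : β → ℝ := fun y => ∑ a ∈ C, (if y ∈ inc a then (1 : ℝ) else 0) with hd
  have hsum : (#C : ℝ) * h ≤ ∑ y ∈ P, d y := by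
    rw [hd, Finset.sum_comm, ← nsmul_eq_mul]
    apply Finset.card_nsmul_le_sum
    intro a ha
    rw [← cardeq a ha]
    exact hh a ha
  have hsq : ∑ a ∈ C, ∑ b ∈ C, (#(inc a ∩ inc b) : ℝ) = ∑ y ∈ P, d y ^ 2 := by
    rw [Finset.sum_congr rfl (fun a ha => Finset.sum_congr rfl (fun b hb => key a ha b hb))]
    simp_rw [hd, sq, Finset.sum_mul_sum]
    rw [Finset.sum_comm]
    conv_rhs => rw [Finset.sum_comm]
    rw [Finset.sum_comm]
    exact Finset.sum_congr rfl fun a _ => Finset.sum_comm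
  have hcs := sq_sum_le_card_mul_sum_sq (s := P) (f := d)
  have h1 : (#P : ℝ) * ∑ a ∈ C, ∑ b ∈ C, (#(inc a ∩ inc b) : ℝ) < #C * (#C * h ^ 2) := by
    rw [Finset.mul_sum, ← nsmul_eq_mul (#C), ← Finset.sum_const]
    exact Finset.sum_lt_sum_of_nonempty hC hcon
  rw [hsq] at h1
  have h2 : ((#C : ℝ) * h) ^ 2 ≤ (∑ y ∈ P, d y) ^ 2 :=
    pow_le_pow_left₀ (by positivity) hsum 2
  nlinarith

/-- The number of subsets of size at most `q` of an `m`-set. -/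
def chooseSum (m q : ℕ) : ℕ := ∑ i ∈ range (q + 1), m.choose i

theorem one_le_chooseSum (m q : ℕ) : 1 ≤ chooseSum m q := by
  unfold chooseSum
  rw [Finset.sum_range_succ']
  simp

theorem chooseSum_succ_succ (m q : ℕ) :
    chooseSum (m + 1) (q + 1) = chooseSum m (q + 1) + chooseSum m q := by
  unfold chooseSum
  rw [Finset.sum_range_succ', Finset.sum_range_succ' _ (q + 1)]
  simp_rw [Nat.choose_succ_succ]
  rw [Finset.sum_add_distrib]
  simp
  ring

/-- Chernoff's argument: x^q ≤ x^i for i ≤ q, so x^q times the sum is at most (1 + x)^m ≤ exp(xm).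
-/
theorem chooseSum_le (m q : ℕ) {x : ℝ} (hx0 : 0 < x) (hx1 : x ≤ 1) :
    (chooseSum m q : ℝ) ≤ x⁻¹ ^ q * Real.exp (x * m) := by
  have h1 : (chooseSum m q : ℝ) * x ^ q ≤ (1 + x) ^ m := by
    rw [add_comm, add_pow]
    simp only [one_pow, mul_one]
    unfold chooseSum
    push_cast
    rw [Finset.sum_mul]
    calc ∑ i ∈ range (q + 1), (m.choose i : ℝ) * x ^ q
        ≤ ∑ i ∈ range (q + 1), x ^ i * (m.choose i : ℝ) := by
          apply Finset.sum_le_sum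
          intro i hi
          rw [mul_comm]
          apply mul_le_mul_of_nonneg_right _ (by positivity)
          exact pow_le_pow_of_le_one hx0.le hx1 (by simp at hi; omega)
      _ ≤ ∑ i ∈ range (q + 1) ∪ range (m + 1), x ^ i * (m.choose i : ℝ) := by
          apply Finset.sum_le_sum_of_subset_of_nonneg subset_union_left
          intros; positivity
      _ = ∑ i ∈ range (m + 1), x ^ i * (m.choose i : ℝ) := by
          symm
          apply Finset.sum_subset subset_union_right
          intro i _ hi
          rw [Nat.choose_eq_zero_of_lt (by simp at hi; omega)]
          simp
  have h2 : (1 + x) ^ m ≤ Real.exp (x * m) := by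
    rw [mul_comm, Real.exp_nat_mul]
    apply pow_le_pow_left₀ (by positivity)
    linarith [Real.add_one_le_exp x]
  have h3 : x⁻¹ ^ q * x ^ q = 1 := by rw [← mul_pow, inv_mul_cancel₀ hx0.ne', one_pow]
  calc (chooseSum m q : ℝ) = x⁻¹ ^ q * (chooseSum m q * x ^ q) := by
        rw [mul_left_comm, h3, mul_one]
    _ ≤ _ := by
        apply mul_le_mul_of_nonneg_left (h1.trans h2)
        positivity

/-- No two distinct elements of `I` are related by `adj`. -/
def Indep' {α : Type*} (adj : α → α → Prop) (I : Finset α) : Prop :=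
  ∀ a ∈ I, ∀ b ∈ I, a ≠ b → ¬ adj a b

open Classical in
/-- The independent subsets of `C`. -/
noncomputable def indepSets {α : Type*} (adj : α → α → Prop) (C : Finset α) : Finset (Finset α) :=
  C.powerset.filter (Indep' adj)

theorem mem_indepSets {α : Type*} {adj : α → α → Prop} {C I : Finset α} :
    I ∈ indepSets adj C ↔ I ⊆ C ∧ Indep' adj I := by
  simp [indepSets]

/-- The independence polynomial of the graph induced on `C`. -/
noncomputable def indepPoly {α : Type*} (adj : α → α → Prop) (C : Finset α) (t : ℝ) : ℝ :=
  ∑ I ∈ indepSets adj C, t ^ #I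

theorem indepPoly_le_pow {α : Type*} (adj : α → α → Prop) (C : Finset α) {t : ℝ} (ht : 0 ≤ t) :
    indepPoly adj C t ≤ (1 + t) ^ #C := by
  classical
  have h := Finset.sum_pow_mul_eq_add_pow t 1 C
  simp only [one_pow, mul_one] at h
  rw [add_comm, ← h]
  apply Finset.sum_le_sum_of_subset_of_nonneg
  · intro I hI
    simp only [mem_indepSets] at hI
    simpa using hI.1
  · intros; positivity

open Classical in
-- Split independent sets according to whether they contain v. Deleting v from one that does leaves
-- an independent set of non-neighbours; the factor t it loses is at most 1 and is given away.
theorem indepPoly_le_add {α : Type*} {adj : α → α → Prop} {C : Finset α} {t : ℝ}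
    (ht : 0 ≤ t) (ht1 : t ≤ 1) (v : α) :
    indepPoly adj C t ≤ indepPoly adj (C.erase v) t +
      indepPoly adj ((C.erase v).filter fun w => ¬ adj v w) t := by
  unfold indepPoly
  rw [← Finset.sum_filter_add_sum_filter_not (indepSets adj C) (fun I => v ∉ I)]
  apply add_le_add
  · apply Finset.sum_le_sum_of_subset_of_nonneg
    · intro I hI
      simp only [mem_filter, mem_indepSets] at hI ⊢
      exact ⟨fun x hx => mem_erase.2 ⟨fun h => hI.2 (h ▸ hx), hI.1.1 hx⟩, hI.1.2⟩
    · intros; positivity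
  · have himg : ∑ I ∈ (indepSets adj C).filter (fun I => ¬ v ∉ I), t ^ #I =
        ∑ I ∈ ((indepSets adj C).filter (fun I => ¬ v ∉ I)).image (fun I => I.erase v),
          t ^ (#I + 1) := by
      rw [Finset.sum_image]
      · refine Finset.sum_congr rfl fun I hI => ?_
        simp only [mem_filter, not_not] at hI
        rw [card_erase_add_one hI.2]
      · intro I hI J hJ hIJ
        simp only [coe_filter, Set.mem_ofPred_eq, not_not] at hI hJ
        rw [← insert_erase hI.2, ← insert_erase hJ.2]
        simp only at hIJ
        rw [hIJ]
    rw [himg]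
    refine (Finset.sum_le_sum_of_subset_of_nonneg
      (t := indepSets adj ((C.erase v).filter fun w => ¬ adj v w)) ?_ ?_).trans ?_
    · intro I hI
      simp only [mem_image, mem_filter, mem_indepSets, not_not] at hI
      obtain ⟨J, ⟨⟨hJC, hJ⟩, hvJ⟩, rfl⟩ := hI
      rw [mem_indepSets]
      refine ⟨fun x hx => ?_, fun a ha b hb => hJ a (mem_of_mem_erase ha) b (mem_of_mem_erase hb)⟩
      rw [mem_filter]
      refine ⟨erase_subset_erase _ hJC hx, ?_⟩
      exact hJ v hvJ x (mem_of_mem_erase hx) (ne_of_mem_erase hx).symm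
    · intros; positivity
    · apply Finset.sum_le_sum
      intro I _
      rw [pow_succ]
      exact mul_le_of_le_one_right (by positivity) ht1

open Classical in
/-- The Kleitman–Winston bound in terms of the independence polynomial. -/
theorem indepPoly_le {α : Type*} (adj : α → α → Prop) (C₀ : Finset α) {t β B : ℝ}
    (ht : 0 ≤ t) (ht1 : t ≤ 1) (hβ1 : β ≤ 1)
    (hdeg : ∀ C ⊆ C₀, B < #C → ∃ v ∈ C, β * #C ≤ #(C.filter fun w => w ≠ v ∧ adj v w)) :
    ∀ m : ℕ, ∀ q : ℕ, ∀ C ⊆ C₀, #C ≤ m → #C * (1 - β) ^ q ≤ B →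
      indepPoly adj C t ≤ (1 + t) ^ B * chooseSum m q := by
  -- Here q is the number of selections still allowed. Branch on a vertex v of large degree:
  -- discarding v keeps q, while selecting v also removes its neighbours, shrinks C by the factor 1
  -- - β and uses up one selection. The two branches add up by Pascal's rule for `chooseSum`. Once
  -- #C ≤ B the trivial bound (1 + t)^#C takes over.
  intro m
  induction m with
  | zero =>
    intro q C _ hCm hB
    have hC0 : #C = 0 := by omega
    have hB0 : 0 ≤ B := by simpa [hC0] using hB
    apply (indepPoly_le_pow adj C ht).trans
    rw [hC0, pow_zero]
    have h1 : (1 : ℝ) ≤ chooseSum 0 q := by exact_mod_cast one_le_chooseSum 0 q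
    have h2 : (1 : ℝ) ≤ (1 + t) ^ B := Real.one_le_rpow (by linarith) hB0
    nlinarith
  | succ m ih =>
    intro q C hC hCm hB
    by_cases hCB : #C ≤ B
    · apply (indepPoly_le_pow adj C ht).trans
      have h1 : (1 : ℝ) ≤ chooseSum (m + 1) q := by exact_mod_cast one_le_chooseSum (m + 1) q
      have h2 : (1 + t) ^ #C ≤ (1 + t) ^ B := by
        rw [← Real.rpow_natCast]
        exact Real.rpow_le_rpow_of_exponent_le (by linarith) hCB
      have h3 : 0 ≤ (1 + t) ^ #C := by positivity
      nlinarith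
    · push Not at hCB
      obtain ⟨v, hv, hdv⟩ := hdeg C hC hCB
      cases q with
      -- With no selections left the invariant itself says #C ≤ B.
      | zero => simp at hB; linarith
      | succ q =>
        have hcard : #(C.erase v) + 1 = #C := card_erase_add_one hv
        have hB0 : 0 ≤ B := le_trans (mul_nonneg (by positivity)
          (pow_nonneg (by linarith) _)) hB
        have h1 := ih (q + 1) (C.erase v) ((erase_subset _ _).trans hC) (by omega) (by
          refine le_trans (mul_le_mul_of_nonneg_right ?_ (pow_nonneg (by linarith) _)) hB
          exact_mod_cast card_le_card (erase_subset _ _))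
        set C' := (C.erase v).filter fun w => ¬ adj v w with hC'
        have hcard' : (#C' : ℝ) ≤ (1 - β) * #C := by
          have hdisj : #C' + #(C.filter fun w => w ≠ v ∧ adj v w) ≤ #C := by
            rw [← card_union_of_disjoint]
            · apply card_le_card
              intro x hx
              simp only [hC', mem_union, mem_filter, mem_erase] at hx
              tauto
            · rw [disjoint_left]
              intro x hx hx'
              simp only [hC', mem_filter, mem_erase] at hx hx'
              tauto
          have : (#C' : ℝ) + #(C.filter fun w => w ≠ v ∧ adj v w) ≤ #C := by exact_mod_cast hdisj
          linarith
        have h2 := ih q C' ((filter_subset _ _).trans ((erase_subset _ _).trans hC))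
          ((card_le_card (filter_subset _ _)).trans (by omega)) (by
            refine le_trans ?_ hB
            rw [pow_succ]
            have := mul_le_mul_of_nonneg_right hcard' (pow_nonneg (by linarith : 0 ≤ 1 - β) q)
            linarith)
        apply (indepPoly_le_add ht ht1 v).trans
        rw [chooseSum_succ_succ]
        push_cast
        rw [mul_add]
        exact add_le_add h1 h2

end MatroidAsymptotics

/-! ### Johnson graphs: stable sets and degrees -/

namespace MatroidAsymptotics
open Finset

/-- The subsets of `[n]` of cardinality `r`. -/
def layer (n r : ℕ) : Finset (Finset (Fin n)) := powersetCard r univ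

@[simp] theorem mem_layer {n r : ℕ} {X : Finset (Fin n)} : X ∈ layer n r ↔ #X = r := by
  simp [layer, mem_powersetCard]

@[simp] theorem card_layer (n r : ℕ) : #(layer n r) = n.choose r := by
  simp [layer]

/-- Adjacency in Johnson graphs. -/
def JAdj {n : ℕ} (X Y : Finset (Fin n)) : Prop := #X = #Y ∧ #(X \ Y) = 1

theorem JAdj.symm {n : ℕ} {X Y : Finset (Fin n)} (h : JAdj X Y) : JAdj Y X :=
  ⟨h.1.symm, by rw [← card_sdiff_comm h.1, h.2]⟩

theorem JAdj.irrefl {n : ℕ} {X : Finset (Fin n)} : ¬ JAdj X X := by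
  simp [JAdj]

theorem JAdj.ne {n : ℕ} {X Y : Finset (Fin n)} (h : JAdj X Y) : X ≠ Y := by
  rintro rfl
  exact JAdj.irrefl h

theorem JAdj.exists_eq {n : ℕ} {X Y : Finset (Fin n)} (h : JAdj X Y) :
    ∃ x ∈ X, ∃ y ∉ X, Y = insert y (X.erase x) := by
  obtain ⟨x, hx⟩ := card_eq_one.1 h.2
  obtain ⟨y, hy⟩ := card_eq_one.1 h.symm.2
  have hx' : x ∈ X \ Y := by simp [hx]
  have hy' : y ∈ Y \ X := by simp [hy]
  rw [mem_sdiff] at hx' hy'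
  refine ⟨x, hx'.1, y, hy'.2, ?_⟩
  ext z
  have hzx : z ∈ X \ Y ↔ z = x := by simp [hx]
  have hzy : z ∈ Y \ X ↔ z = y := by simp [hy]
  rw [mem_sdiff] at hzx hzy
  rw [mem_insert, mem_erase]
  tauto

theorem jAdj_insert_erase {n : ℕ} {X : Finset (Fin n)} {x y : Fin n} (hx : x ∈ X) (hy : y ∉ X) :
    JAdj X (insert y (X.erase x)) := by
  have hy' : y ∉ X.erase x := fun h => hy (mem_of_mem_erase h)
  refine ⟨by rw [card_insert_of_notMem hy', card_erase_add_one hx], card_eq_one.2 ⟨x, ?_⟩⟩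
  ext z
  simp only [mem_sdiff, mem_insert, mem_erase, mem_singleton]
  constructor
  · tauto
  · rintro rfl
    refine ⟨hx, ?_⟩
    rintro (rfl | h)
    · exact hy hx
    · exact h.1 rfl

/-- A stable set of a Johnson graph. -/
def IsStable {n : ℕ} (S : Finset (Finset (Fin n))) : Prop :=
  ∀ X ∈ S, ∀ Y ∈ S, ¬ JAdj X Y

theorem IsStable.mono {n : ℕ} {S T : Finset (Finset (Fin n))} (h : IsStable T) (hST : S ⊆ T) :
    IsStable S :=
  fun X hX Y hY => h X (hST hX) Y (hST hY)

open Classical in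
/-- The stable subsets of `R`. -/
noncomputable def stableSubsets {n : ℕ} (R : Finset (Finset (Fin n))) :
    Finset (Finset (Finset (Fin n))) :=
  R.powerset.filter IsStable

theorem mem_stableSubsets {n : ℕ} {R S : Finset (Finset (Fin n))} :
    S ∈ stableSubsets R ↔ S ⊆ R ∧ IsStable S := by
  simp [stableSubsets]

/-- The exchange changes the sum by y - x, which is nonzero modulo n for distinct elements of `Fin
n`. Hence the level sets of the sum are stable. -/
theorem sum_insert_erase_ne {n : ℕ} {X : Finset (Fin n)} {x y : Fin n} (hx : x ∈ X) (hy : y ∉ X) :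
    ∑ z ∈ insert y (X.erase x), ((z : ℕ) : ZMod n) ≠ ∑ z ∈ X, ((z : ℕ) : ZMod n) := by
  have hy' : y ∉ X.erase x := fun h => hy (mem_of_mem_erase h)
  rw [sum_insert hy', ← add_sum_erase X _ hx]
  intro h
  have h1 := add_right_cancel h
  rw [ZMod.natCast_eq_natCast_iff'] at h1
  rw [Nat.mod_eq_of_lt y.2, Nat.mod_eq_of_lt x.2] at h1
  exact hy (Fin.ext h1 ▸ hx)

/-- The Graham–Sloane construction inside an arbitrary family. -/
theorem exists_stable_subset {n : ℕ} (hn : 0 < n) (R : Finset (Finset (Fin n))) :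
    ∃ S ⊆ R, IsStable S ∧ #R ≤ n * #S := by
  classical
  have : NeZero n := ⟨hn.ne'⟩
  set f : Finset (Fin n) → ZMod n := fun X => ∑ z ∈ X, ((z : ℕ) : ZMod n) with hf
  by_contra! hcon
  -- Each residue class of the element sum is stable; if all n of them were smaller than #R / n,
  -- they could not exhaust R.
  have h1 : ∀ c ∈ (univ : Finset (ZMod n)), n * #(R.filter fun X => f X = c) < #R := by
    intro c _
    apply hcon _ (filter_subset _ _)
    intro X hX Y hY hadj
    rw [mem_filter] at hX hY
    obtain ⟨x, hx, y, hy, rfl⟩ := hadj.exists_eq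
    exact sum_insert_erase_ne hx hy (hY.2.trans hX.2.symm)
  have h2 := Finset.sum_lt_sum_of_nonempty (univ_nonempty (α := ZMod n)) h1
  rw [← Finset.mul_sum, ← Finset.card_eq_sum_card_fiberwise (fun _ _ => mem_univ _)] at h2
  simp [ZMod.card] at h2

/-- Every subset of one stable set of size at least #R / n is stable. -/
theorem two_rpow_le_card_stableSubsets {n : ℕ} (hn : 0 < n) (R : Finset (Finset (Fin n))) :
    (2 : ℝ) ^ ((#R : ℝ) / n) ≤ #(stableSubsets R) := by
  obtain ⟨S, hSR, hS, hcard⟩ := exists_stable_subset hn R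
  have h1 : (#R : ℝ) / n ≤ #S := by
    rw [div_le_iff₀ (by exact_mod_cast hn)]
    rw [mul_comm]
    exact_mod_cast hcard
  have h2 : S.powerset ⊆ stableSubsets R := by
    intro T hT
    rw [mem_powerset] at hT
    exact mem_stableSubsets.2 ⟨hT.trans hSR, hS.mono hT⟩
  calc (2 : ℝ) ^ ((#R : ℝ) / n) ≤ 2 ^ (#S : ℝ) :=
        Real.rpow_le_rpow_of_exponent_le (by norm_num) h1
    _ = (#S.powerset : ℝ) := by rw [Real.rpow_natCast, card_powerset]; simp
    _ ≤ _ := by exact_mod_cast card_le_card h2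

/-- Distinct (r+1)-sets have a common r-subset only if they are adjacent, and then just one, so
counting common r-subsets counts degrees. -/
theorem card_inter_powersetCard_le {n r : ℕ} {X Y : Finset (Fin n)} (hX : #X = r + 1)
    (hY : #Y = r + 1) [Decidable (JAdj X Y)] :
    #(powersetCard r X ∩ powersetCard r Y) ≤
      (if X = Y then r + 1 else 0) + (if JAdj X Y then 1 else 0) := by
  have h : powersetCard r X ∩ powersetCard r Y = powersetCard r (X ∩ Y) := by
    ext Z
    simp only [mem_inter, mem_powersetCard, subset_inter_iff]
    tauto
  rw [h, card_powersetCard]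
  by_cases hXY : X = Y
  · subst hXY
    simp [hX]
  · have h1 : #(X ∩ Y) + #(X \ Y) = r + 1 := by rw [card_inter_add_card_sdiff, hX]
    have h2 : #(X \ Y) ≠ 0 := by
      intro h0
      rw [card_eq_zero, sdiff_eq_empty_iff_subset] at h0
      exact hXY (eq_of_subset_of_card_le h0 (by omega))
    by_cases hadj : JAdj X Y
    · have h3 : #(X ∩ Y) = r := by have := hadj.2; omega
      simp [hXY, hadj, h3]
    · have h3 : #(X \ Y) ≠ 1 := fun h => hadj ⟨by omega, h⟩
      rw [Nat.choose_eq_zero_of_lt (by omega)]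
      simp

open Classical in
/-- Large sets of vertices of a Johnson graph contain a vertex of large degree. -/
theorem exists_large_degree {n r : ℕ} (A : Finset (Finset (Fin n))) (hA : A ⊆ layer n (r + 1))
    (hne : A.Nonempty) :
    ∃ X ∈ A, (#A : ℝ) * (r + 1) ^ 2 ≤
      n.choose r * ((r + 1) + #(A.filter fun Y => JAdj X Y)) := by
  -- The incidences are between members of A and their r-subsets, r + 1 for each member.
  obtain ⟨X, hX, h⟩ := exists_large_incidence A (layer n r) (fun X => powersetCard r X)
    (fun X _ => powersetCard_mono (subset_univ X)) (r + 1) (by positivity)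
    (fun X hX => by
      have := mem_layer.1 (hA hX)
      simp [card_powersetCard, this]) hne
  refine ⟨X, hX, h.trans ?_⟩
  rw [card_layer]
  apply mul_le_mul_of_nonneg_left _ (by positivity)
  have h1 : ∑ Y ∈ A, #(powersetCard r X ∩ powersetCard r Y) ≤
      (r + 1) + #(A.filter fun Y => JAdj X Y) := by
    calc _ ≤ ∑ Y ∈ A, ((if X = Y then r + 1 else 0) + (if JAdj X Y then 1 else 0)) :=
          Finset.sum_le_sum fun Y hY =>
            card_inter_powersetCard_le (mem_layer.1 (hA hX)) (mem_layer.1 (hA hY))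
      _ = _ := by
          rw [sum_add_distrib, sum_ite_eq, if_pos hX, card_filter]
  exact_mod_cast h1

/-! ### Cliques of the Johnson graph -/

/-- The clique of the Johnson graph on `r`-sets that is indexed by a set of size `r ± 1`. -/
def clique {n : ℕ} (r : ℕ) (Q : Finset (Fin n)) : Finset (Finset (Fin n)) :=
  (layer n r).filter fun Y => Y ⊆ Q ∨ Q ⊆ Y

theorem mem_clique {n r : ℕ} {Q Y : Finset (Fin n)} :
    Y ∈ clique r Q ↔ #Y = r ∧ (Y ⊆ Q ∨ Q ⊆ Y) := by
  simp [clique]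

/-- The index set of the cliques. -/
def cliqueIdx (n r : ℕ) : Finset (Finset (Fin n)) :=
  univ.filter fun Q => #Q + 1 = r ∨ #Q = r + 1

theorem mem_cliqueIdx {n r : ℕ} {Q : Finset (Fin n)} :
    Q ∈ cliqueIdx n r ↔ #Q + 1 = r ∨ #Q = r + 1 := by
  simp [cliqueIdx]

theorem jAdj_of_mem_clique {n r : ℕ} {Q X Y : Finset (Fin n)} (hQ : Q ∈ cliqueIdx n r)
    (hX : X ∈ clique r Q) (hY : Y ∈ clique r Q) (hne : X ≠ Y) : JAdj X Y := by
  rw [mem_cliqueIdx] at hQ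
  rw [mem_clique] at hX hY
  refine ⟨by omega, ?_⟩
  have h2 : #(X \ Y) ≠ 0 := by
    intro h0
    rw [card_eq_zero, sdiff_eq_empty_iff_subset] at h0
    exact hne (eq_of_subset_of_card_le h0 (by omega))
  have h3 := card_inter_add_card_sdiff X Y
  have h4 := card_union_add_card_inter X Y
  rcases hQ with hQ | hQ
  · have hXQ : Q ⊆ X := by
      rcases hX.2 with h | h
      · have := card_le_card h; omega
      · exact h
    have hYQ : Q ⊆ Y := by
      rcases hY.2 with h | h
      · have := card_le_card h; omega
      · exact h
    have := card_le_card (subset_inter hXQ hYQ)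
    omega
  · have hXQ : X ⊆ Q := by
      rcases hX.2 with h | h
      · exact h
      · have := card_le_card h; omega
    have hYQ : Y ⊆ Q := by
      rcases hY.2 with h | h
      · exact h
      · have := card_le_card h; omega
    have := card_le_card (union_subset hXQ hYQ)
    omega

theorem card_clique_le {n r : ℕ} (hn : 0 < n) {Q : Finset (Fin n)} (hQ : Q ∈ cliqueIdx n r) :
    #(clique r Q) ≤ n := by
  classical
  rw [mem_cliqueIdx] at hQ
  have : NeZero n := ⟨hn.ne'⟩
  rcases hQ with hQ | hQ
  · have h : clique r Q ⊆ (univ : Finset (Fin n)).image fun y => insert y Q := by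
      intro Y hY
      rw [mem_clique] at hY
      have hYQ : Q ⊆ Y := by
        rcases hY.2 with h | h
        · have := card_le_card h; omega
        · exact h
      have h1 : #(Y \ Q) = 1 := by rw [card_sdiff_of_subset hYQ]; omega
      obtain ⟨y, hy⟩ := card_eq_one.1 h1
      rw [mem_image]
      refine ⟨y, mem_univ _, ?_⟩
      rw [← singleton_union, ← hy, sdiff_union_of_subset hYQ]
    exact (card_le_card h).trans (card_image_le.trans (by simp))
  · have h : clique r Q ⊆ (univ : Finset (Fin n)).image fun y => Q.erase y := by
      intro Y hY
      rw [mem_clique] at hY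
      have hYQ : Y ⊆ Q := by
        rcases hY.2 with h | h
        · exact h
        · have := card_le_card h; omega
      have h1 : #(Q \ Y) = 1 := by rw [card_sdiff_of_subset hYQ]; omega
      obtain ⟨y, hy⟩ := card_eq_one.1 h1
      rw [mem_image]
      refine ⟨y, mem_univ _, ?_⟩
      rw [← sdiff_singleton_eq_erase, ← hy, Finset.sdiff_sdiff_eq_self hYQ]
    exact (card_le_card h).trans (card_image_le.trans (by simp))

/-- An index of a clique through Y arises from Y by toggling the membership of one element. -/
theorem card_cliqueIdx_through_le {n r : ℕ} {Y : Finset (Fin n)} (hY : #Y = r) :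
    #((cliqueIdx n r).filter fun Q => Y ∈ clique r Q) ≤ n := by
  classical
  have h : ((cliqueIdx n r).filter fun Q => Y ∈ clique r Q) ⊆
      (univ : Finset (Fin n)).image fun y => if y ∈ Y then Y.erase y else insert y Y := by
    intro Q hQ
    rw [mem_filter, mem_cliqueIdx, mem_clique] at hQ
    obtain ⟨hc, -, hs⟩ := hQ
    rw [mem_image]
    rcases hc with hc | hc
    · have hYQ : Q ⊆ Y := by
        rcases hs with h | h
        · have := card_le_card h; omega
        · exact h
      have h1 : #(Y \ Q) = 1 := by rw [card_sdiff_of_subset hYQ]; omega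
      obtain ⟨y, hy⟩ := card_eq_one.1 h1
      have hyY : y ∈ Y := by
        have : y ∈ Y \ Q := by simp [hy]
        exact (mem_sdiff.1 this).1
      refine ⟨y, mem_univ _, ?_⟩
      rw [if_pos hyY, ← sdiff_singleton_eq_erase, ← hy, Finset.sdiff_sdiff_eq_self hYQ]
    · have hYQ : Y ⊆ Q := by
        rcases hs with h | h
        · exact h
        · have := card_le_card h; omega
      have h1 : #(Q \ Y) = 1 := by rw [card_sdiff_of_subset hYQ]; omega
      obtain ⟨y, hy⟩ := card_eq_one.1 h1
      have hyY : y ∉ Y := by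
        have : y ∈ Q \ Y := by simp [hy]
        exact (mem_sdiff.1 this).2
      refine ⟨y, mem_univ _, ?_⟩
      rw [if_neg hyY, ← singleton_union, ← hy, sdiff_union_of_subset hYQ]
  exact (card_le_card h).trans (card_image_le.trans (by simp))

/-- Distinct cliques share at most two vertices. -/
theorem card_clique_inter_le {n r : ℕ} {Q Q' : Finset (Fin n)} (hQ : Q ∈ cliqueIdx n r)
    (hQ' : Q' ∈ cliqueIdx n r) (hne : Q ≠ Q') : #(clique r Q ∩ clique r Q') ≤ 2 := by
  rw [mem_cliqueIdx] at hQ hQ'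
  -- For sizes r - 1 and r + 1, the common members lie between Q and Q', and Q' \ Q has two
  -- elements. For equal sizes the only candidate is Q ∪ Q' or Q ∩ Q'.
  have mixed : ∀ {Q Q' : Finset (Fin n)}, #Q + 1 = r → #Q' = r + 1 →
      #(clique r Q ∩ clique r Q') ≤ 2 := by
    intro Q Q' hQ hQ'
    by_cases hQQ : Q ⊆ Q'
    · have h : clique r Q ∩ clique r Q' ⊆ (Q' \ Q).image fun y => insert y Q := by
        intro Y hY
        rw [mem_inter, mem_clique, mem_clique] at hY
        obtain ⟨⟨hYc, h1⟩, -, h2⟩ := hY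
        have hYQ : Q ⊆ Y := by
          rcases h1 with h | h
          · have := card_le_card h; omega
          · exact h
        have hYQ' : Y ⊆ Q' := by
          rcases h2 with h | h
          · exact h
          · have := card_le_card h; omega
        have h1 : #(Y \ Q) = 1 := by rw [card_sdiff_of_subset hYQ]; omega
        obtain ⟨y, hy⟩ := card_eq_one.1 h1
        have hyY : y ∈ Y \ Q := by simp [hy]
        rw [mem_sdiff] at hyY
        rw [mem_image]
        refine ⟨y, mem_sdiff.2 ⟨hYQ' hyY.1, hyY.2⟩, ?_⟩
        rw [← singleton_union, ← hy, sdiff_union_of_subset hYQ]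
      refine (card_le_card h).trans (card_image_le.trans ?_)
      rw [card_sdiff_of_subset hQQ]
      omega
    · rw [card_eq_zero.2]
      · omega
      · rw [eq_empty_iff_forall_notMem]
        intro Y hY
        rw [mem_inter, mem_clique, mem_clique] at hY
        obtain ⟨⟨hYc, h1⟩, -, h2⟩ := hY
        apply hQQ
        have hYQ : Q ⊆ Y := by
          rcases h1 with h | h
          · have := card_le_card h; omega
          · exact h
        have hYQ' : Y ⊆ Q' := by
          rcases h2 with h | h
          · exact h
          · have := card_le_card h; omega
        exact hYQ.trans hYQ'
  rcases hQ with hQ | hQ <;> rcases hQ' with hQ' | hQ'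
  · have h : clique r Q ∩ clique r Q' ⊆ {Q ∪ Q'} := by
      intro Y hY
      rw [mem_inter, mem_clique, mem_clique] at hY
      obtain ⟨⟨hYc, h1⟩, -, h2⟩ := hY
      have hYQ : Q ⊆ Y := by
        rcases h1 with h | h
        · have := card_le_card h; omega
        · exact h
      have hYQ' : Q' ⊆ Y := by
        rcases h2 with h | h
        · have := card_le_card h; omega
        · exact h
      rw [mem_singleton]
      symm
      apply eq_of_subset_of_card_le (union_subset hYQ hYQ')
      have h3 : #Q < #(Q ∪ Q') := by
        apply card_lt_card
        refine ⟨subset_union_left, fun h => hne ?_⟩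
        exact (eq_of_subset_of_card_le (subset_union_right.trans h) (by omega)).symm
      omega
    exact (card_le_card h).trans (by simp)
  · exact mixed hQ hQ'
  · rw [inter_comm]
    exact mixed hQ' hQ
  · have h : clique r Q ∩ clique r Q' ⊆ {Q ∩ Q'} := by
      intro Y hY
      rw [mem_inter, mem_clique, mem_clique] at hY
      obtain ⟨⟨hYc, h1⟩, -, h2⟩ := hY
      have hYQ : Y ⊆ Q := by
        rcases h1 with h | h
        · exact h
        · have := card_le_card h; omega
      have hYQ' : Y ⊆ Q' := by
        rcases h2 with h | h
        · exact h
        · have := card_le_card h; omega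
      rw [mem_singleton]
      apply eq_of_subset_of_card_le (subset_inter hYQ hYQ')
      have h3 : #(Q ∩ Q') < #Q := by
        apply card_lt_card
        refine ⟨inter_subset_left, fun h => hne ?_⟩
        exact eq_of_subset_of_card_le (h.trans inter_subset_right) (by omega)
      omega
    exact (card_le_card h).trans (by simp)

end MatroidAsymptotics

/-! ### Packings of heavy cliques and the trade with stable subsets of D -/

namespace MatroidAsymptotics
open Finset

variable {n r : ℕ}

/-- Two cliques meet inside `R`. -/
def Meets (r : ℕ) (R : Finset (Finset (Fin n))) (Q Q' : Finset (Fin n)) : Prop :=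
  (clique r Q ∩ clique r Q' ∩ R).Nonempty

/-- The cliques that have at least `n / 4` vertices in `R`. -/
def heavyCliques (r : ℕ) (R : Finset (Finset (Fin n))) : Finset (Finset (Fin n)) :=
  (cliqueIdx n r).filter fun Q => n ≤ 4 * #(clique r Q ∩ R)

theorem mem_heavyCliques {R : Finset (Finset (Fin n))} {Q : Finset (Fin n)} :
    Q ∈ heavyCliques r R ↔ Q ∈ cliqueIdx n r ∧ n ≤ 4 * #(clique r Q ∩ R) := by
  simp [heavyCliques]

/-- Double counting: a heavy clique has at least n/4 vertices in R, and each vertex of R lies in at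
most n cliques. -/
theorem card_heavyCliques_le (hn : 0 < n) {R : Finset (Finset (Fin n))} (hR : R ⊆ layer n r) :
    #(heavyCliques r R) ≤ 4 * #R := by
  have h1 : #(heavyCliques r R) * n ≤ ∑ Q ∈ heavyCliques r R, 4 * #(clique r Q ∩ R) := by
    rw [← smul_eq_mul]
    exact Finset.card_nsmul_le_sum _ _ _ fun Q hQ => (mem_heavyCliques.1 hQ).2
  have h2 : ∑ Q ∈ heavyCliques r R, #(clique r Q ∩ R) ≤ #R * n := by
    have h3 : ∀ Q ∈ heavyCliques r R,
        #(clique r Q ∩ R) = ∑ Y ∈ R, if Y ∈ clique r Q then 1 else 0 := by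
      intro Q _
      rw [← card_filter, inter_comm, filter_mem_eq_inter]
    rw [Finset.sum_congr rfl h3, Finset.sum_comm, ← smul_eq_mul]
    apply Finset.sum_le_card_nsmul
    intro Y hY
    rw [← card_filter]
    refine (card_le_card ?_).trans (card_cliqueIdx_through_le (mem_layer.1 (hR hY)))
    intro Q hQ
    rw [mem_filter] at hQ ⊢
    exact ⟨(mem_heavyCliques.1 hQ.1).1, hQ.2⟩
  rw [← Finset.mul_sum] at h1
  have h4 : #(heavyCliques r R) * n ≤ 4 * #R * n := by nlinarith
  exact Nat.le_of_mul_le_mul_right h4 hn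

open Classical in
-- Cauchy–Schwarz on incidences between cliques and R makes one clique have large total intersection
-- with the others. Distinct cliques share at most two vertices, so this intersection is spread over
-- many cliques.
theorem exists_clique_meeting_many (hn : 0 < n) {R : Finset (Finset (Fin n))}
    (hR : R ⊆ layer n r) (C : Finset (Finset (Fin n))) (hC : C ⊆ heavyCliques r R)
    (hlarge : 32 * (#R : ℝ) / n < #C) :
    ∃ Q ∈ C, (n : ℝ) ^ 2 / (64 * n.choose r) * #C ≤
      #(C.filter fun Q' => Q' ≠ Q ∧ Meets r R Q Q') := by
  have hn' : (0 : ℝ) < n := by exact_mod_cast hn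
  have hCpos : (0 : ℝ) < #C := lt_of_le_of_lt (by positivity) hlarge
  have hCne : C.Nonempty := by
    rw [← card_pos]; exact_mod_cast hCpos
  obtain ⟨Q, hQ, hbig⟩ := exists_large_incidence C R (fun Q => clique r Q ∩ R)
    (fun _ _ => inter_subset_right) ((n : ℝ) / 4) (by positivity) (fun Q hQ => by
      have := (mem_heavyCliques.1 (hC hQ)).2
      have h2 : (n : ℝ) ≤ 4 * #(clique r Q ∩ R) := by exact_mod_cast this
      linarith) hCne
  refine ⟨Q, hQ, ?_⟩
  set deg := #(C.filter fun Q' => Q' ≠ Q ∧ Meets r R Q Q') with hdeg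
  have h1 : ∑ Q' ∈ C, #((clique r Q ∩ R) ∩ (clique r Q' ∩ R)) ≤ n + 2 * deg := by
    calc _ ≤ ∑ Q' ∈ C, ((if Q = Q' then n else 0) +
          (if Q' ≠ Q ∧ Meets r R Q Q' then 2 else 0)) := by
          apply Finset.sum_le_sum
          intro Q' hQ'
          by_cases hQQ : Q = Q'
          · rw [if_pos hQQ]
            refine le_add_right ((card_le_card ?_).trans
              (card_clique_le hn (mem_heavyCliques.1 (hC hQ)).1))
            exact inter_subset_left.trans inter_subset_left
          · have hsub : (clique r Q ∩ R) ∩ (clique r Q' ∩ R) ⊆ clique r Q ∩ clique r Q' :=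
              inter_subset_inter inter_subset_left inter_subset_left
            by_cases hm : Meets r R Q Q'
            · rw [if_neg hQQ, if_pos ⟨fun h => hQQ h.symm, hm⟩]
              exact (card_le_card hsub).trans (by
                rw [zero_add]
                exact card_clique_inter_le (mem_heavyCliques.1 (hC hQ)).1
                  (mem_heavyCliques.1 (hC hQ')).1 hQQ)
            · rw [card_eq_zero.2]
              · exact Nat.zero_le _
              · rw [← not_nonempty_iff_eq_empty]
                rintro ⟨Y, hY⟩
                apply hm
                refine ⟨Y, ?_⟩
                simp only [mem_inter] at hY ⊢
                tauto
      _ = _ := by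
          rw [sum_add_distrib, sum_ite_eq, if_pos hQ, ← Finset.sum_filter, sum_const,
            smul_eq_mul, mul_comm]
  have h1' : ∑ Q' ∈ C, (#((clique r Q ∩ R) ∩ (clique r Q' ∩ R)) : ℝ) ≤ n + 2 * deg := by
    exact_mod_cast h1
  have hRN : (#R : ℝ) ≤ n.choose r := by
    have := card_le_card hR
    rw [card_layer] at this
    exact_mod_cast this
  have h2 : (#C : ℝ) * ((n : ℝ) / 4) ^ 2 ≤ #R * (n + 2 * deg) :=
    hbig.trans (mul_le_mul_of_nonneg_left h1' (by positivity))
  have hl : 32 * (#R : ℝ) < #C * n := by rwa [div_lt_iff₀ hn'] at hlarge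
  have hNpos : (0 : ℝ) < n.choose r := by
    by_contra h
    have h0 : (#R : ℝ) = 0 := le_antisymm (hRN.trans (not_lt.1 h)) (by positivity)
    rw [h0, zero_mul] at h2
    have : 0 < (#C : ℝ) * ((n : ℝ) / 4) ^ 2 := by positivity
    linarith
  rw [div_mul_eq_mul_div, div_le_iff₀ (by positivity)]
  -- The diagonal term #R · n is at most half of the left side #C · n²/16, because #C exceeds
  -- 32#R/n; the other half gives the degree.
  have h3 : (#R : ℝ) * n ≤ #C * n ^ 2 / 32 := by nlinarith
  have h4 : (#R : ℝ) * deg ≤ n.choose r * deg := mul_le_mul_of_nonneg_right hRN (by positivity)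
  nlinarith

/-- Kleitman–Winston on the meeting graph of heavy cliques, with B = 32#R/n. At most 4#R vertices
are present at the start, so shrinking by 8/n reaches B. -/
theorem indepPoly_heavyCliques_le (hn : 0 < n) {R : Finset (Finset (Fin n))}
    (hR : R ⊆ layer n r) {w : ℝ} (hw0 : 0 ≤ w) (hw1 : w ≤ 1) {q : ℕ}
    (hβ : n ^ 2 ≤ 64 * n.choose r)
    (hq : (1 - (n : ℝ) ^ 2 / (64 * n.choose r)) ^ q ≤ 8 / n) :
    indepPoly (Meets r R) (heavyCliques r R) w ≤
      (1 + w) ^ (32 * (#R : ℝ) / n) * chooseSum (4 * n.choose r) q := by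
  have hN : (0 : ℝ) < 64 * n.choose r := by
    have : 0 < n ^ 2 := by positivity
    exact_mod_cast this.trans_le hβ
  refine indepPoly_le (Meets r R) (heavyCliques r R) hw0 hw1 (β := n ^ 2 / (64 * n.choose r)) ?_
    (fun C hC h => by
      obtain ⟨Q, hQ, h'⟩ := exists_clique_meeting_many hn hR C hC h
      exact ⟨Q, hQ, by convert h'⟩) (4 * n.choose r) q _ Subset.rfl ?_ ?_
  · rw [div_le_one hN]
    exact_mod_cast hβ
  · refine (card_heavyCliques_le hn hR).trans ?_
    have := card_le_card hR
    rw [card_layer] at this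
    omega
  · have h1 : (#(heavyCliques r R) : ℝ) ≤ 4 * #R := by exact_mod_cast card_heavyCliques_le hn hR
    calc (#(heavyCliques r R) : ℝ) * (1 - (n : ℝ) ^ 2 / (64 * n.choose r)) ^ q
        ≤ (4 * #R) * (8 / n) := by
          apply mul_le_mul h1 hq _ (by positivity)
          apply pow_nonneg
          rw [sub_nonneg, div_le_one hN]
          exact_mod_cast hβ
      _ = _ := by ring

/-- The vertex sets that, together with `D`, are used to describe a matroid. -/
structure Admissible (r : ℕ) (D : Finset (Finset (Fin n)))
    (sel : Finset (Fin n) → Finset (Fin n)) (U : Finset (Finset (Fin n))) : Prop where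
  subset_layer : U ⊆ layer n r
  notMem : ∀ X ∈ U, X ∉ D
  stable : IsStable U
  unique : ∀ Y ∈ D, ∀ X ∈ U, ∀ X' ∈ U, JAdj X Y → JAdj X' Y → X = X'
  exists_clique : ∀ X ∈ U, (∃ Y ∈ D, JAdj X Y) →
    ∃ Q ∈ heavyCliques r D, X ∈ clique r Q ∧ X = sel Q

open Classical in
/-- The members of `U` with a neighbour in `D`. -/
noncomputable def touching (D U : Finset (Finset (Fin n))) : Finset (Finset (Fin n)) :=
  U.filter fun X => ∃ Y ∈ D, JAdj X Y

/-- `Y` has no neighbour in `W`. -/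
def IsFar (W : Finset (Finset (Fin n))) (Y : Finset (Fin n)) : Prop := ∀ X ∈ W, ¬ JAdj X Y

open Classical in
/-- The members of `D` without a neighbour in `W`. -/
noncomputable def untouched (D W : Finset (Finset (Fin n))) : Finset (Finset (Fin n)) :=
  D.filter (IsFar W)

theorem untouched_subset (D W : Finset (Finset (Fin n))) : untouched D W ⊆ D := by
  classical exact filter_subset _ _

/-- The map (W, T) ↦ W ∪ T is injective, because W lies outside D and T inside. The union is stable,
because T avoids the neighbours of W. -/
theorem sum_stable_untouched_le {D : Finset (Finset (Fin n))} (hD : D ⊆ layer n r)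
    (𝒲 : Finset (Finset (Finset (Fin n)))) (hst : ∀ W ∈ 𝒲, IsStable W)
    (hlay : ∀ W ∈ 𝒲, W ⊆ layer n r) (hdis : ∀ W ∈ 𝒲, ∀ X ∈ W, X ∉ D) :
    ∑ W ∈ 𝒲, #(stableSubsets (untouched D W)) ≤ #(stableSubsets (layer n r)) := by
  classical
  rw [← card_sigma]
  apply card_le_card_of_injOn (fun p => p.1 ∪ p.2)
  · rintro ⟨W, T⟩ hp
    simp only [coe_sigma, Set.mem_sigma_iff, mem_coe, mem_stableSubsets] at hp ⊢
    obtain ⟨hW, hT, hTs⟩ := hp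
    refine ⟨union_subset (hlay W hW) (hT.trans ((untouched_subset D W).trans hD)), ?_⟩
    intro X hX Y hY hadj
    rw [mem_union] at hX hY
    rcases hX with hX | hX <;> rcases hY with hY | hY
    · exact hst W hW X hX Y hY hadj
    · exact (mem_filter.1 (hT hY)).2 X hX hadj
    · exact (mem_filter.1 (hT hX)).2 Y hY hadj.symm
    · exact hTs X hX Y hY hadj
  · rintro ⟨W, T⟩ hp ⟨W', T'⟩ hp' heq
    simp only [coe_sigma, Set.mem_sigma_iff, mem_coe, mem_stableSubsets] at hp hp' heq
    obtain ⟨hW, hT, -⟩ := hp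
    obtain ⟨hW', hT', -⟩ := hp'
    have hTD := hT.trans (untouched_subset D W)
    have hTD' := hT'.trans (untouched_subset D W')
    have key : ∀ X, X ∈ W ∨ X ∈ T ↔ X ∈ W' ∨ X ∈ T' := by
      intro X
      rw [← mem_union, heq, mem_union]
    have hWW : W = W' := by
      ext X
      have := key X
      have h1 := hdis W hW X
      have h2 := hdis W' hW' X
      have h3 := @hTD X
      have h4 := @hTD' X
      tauto
    have hTT : T = T' := by
      ext X
      have := key X
      have h1 := hdis W hW X
      have h2 := hdis W' hW' X
      have h3 := @hTD X
      have h4 := @hTD' X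
      tauto
    subst hWW hTT
    rfl

open Classical in
-- Encode Δ by the heavy cliques that select its members; `sel` decodes it. A vertex of D has at
-- most one neighbour in W ∪ Δ. So the D-part of each of these cliques is untouched by W, which
-- keeps the clique heavy, and no two of the cliques meet there: the code is an independent set.
theorem sum_pow_card_le_indepPoly {D W : Finset (Finset (Fin n))}
    {sel : Finset (Fin n) → Finset (Fin n)} (P : Finset (Finset (Finset (Fin n))))
    (hadm : ∀ Δ ∈ P, Admissible r D sel (W ∪ Δ)) (hdis : ∀ Δ ∈ P, Disjoint W Δ)
    (htouch : ∀ Δ ∈ P, Δ ⊆ touching D (W ∪ Δ)) {w : ℝ} (hw : 0 ≤ w) :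
    ∑ Δ ∈ P, w ^ #Δ ≤
      indepPoly (Meets r (untouched D W)) (heavyCliques r (untouched D W)) w := by
  have hex : ∀ Δ ∈ P, ∃ I ∈ indepSets (Meets r (untouched D W))
      (heavyCliques r (untouched D W)), #I = #Δ ∧ I.image sel = Δ := by
    intro Δ hΔ
    have hA := hadm Δ hΔ
    have h1 : ∀ X ∈ Δ, ∃ Q ∈ heavyCliques r D, X ∈ clique r Q ∧ X = sel Q := fun X hX =>
      hA.exists_clique X (mem_union_right _ hX) (mem_filter.1 (htouch Δ hΔ hX)).2
    choose! Q hQ hXQ hsel using h1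
    have hinj : Set.InjOn Q Δ := by
      intro X hX X' hX' h
      rw [hsel X hX, hsel X' hX', h]
    have hadj : ∀ X ∈ Δ, ∀ Y ∈ D, Y ∈ clique r (Q X) → JAdj X Y := by
      intro X hX Y hY hYQ
      refine jAdj_of_mem_clique (mem_heavyCliques.1 (hQ X hX)).1 (hXQ X hX) hYQ ?_
      rintro rfl
      exact hA.notMem X (mem_union_right _ hX) hY
    refine ⟨Δ.image Q, ?_, card_image_of_injOn hinj, ?_⟩
    · rw [mem_indepSets]
      constructor
      · intro q hq
        obtain ⟨X, hX, rfl⟩ := mem_image.1 hq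
        have h2 := mem_heavyCliques.1 (hQ X hX)
        rw [mem_heavyCliques]
        refine ⟨h2.1, ?_⟩
        have h3 : clique r (Q X) ∩ D ⊆ clique r (Q X) ∩ untouched D W := by
          intro Y hY
          rw [mem_inter] at hY ⊢
          refine ⟨hY.1, mem_filter.2 ⟨hY.2, fun X' hX' hX'Y => ?_⟩⟩
          have h4 := hA.unique Y hY.2 X (mem_union_right _ hX) X' (mem_union_left _ hX')
            (hadj X hX Y hY.2 hY.1) hX'Y
          subst h4
          exact disjoint_left.1 (hdis Δ hΔ) hX' hX
        have := card_le_card h3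
        omega
      · intro q hq q' hq' hne hmeet
        obtain ⟨X, hX, rfl⟩ := mem_image.1 hq
        obtain ⟨X', hX', rfl⟩ := mem_image.1 hq'
        obtain ⟨Y, hY⟩ := hmeet
        simp only [mem_inter] at hY
        have hYD := untouched_subset D W hY.2
        have h4 := hA.unique Y hYD X (mem_union_right _ hX) X' (mem_union_right _ hX')
            (hadj X hX Y hYD hY.1.1) (hadj X' hX' Y hYD hY.1.2)
        exact hne (by rw [h4])
    · rw [image_image]
      ext X
      rw [mem_image]
      constructor
      · rintro ⟨X', hX', rfl⟩
        simpa [← hsel X' hX'] using hX'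
      · intro hX
        exact ⟨X, hX, (hsel X hX).symm⟩
  choose! f hf hcard himg using hex
  calc ∑ Δ ∈ P, w ^ #Δ = ∑ I ∈ P.image f, w ^ #I := by
        rw [Finset.sum_image]
        · exact Finset.sum_congr rfl fun Δ hΔ => by rw [hcard Δ hΔ]
        · intro Δ hΔ Δ' hΔ' h
          rw [← himg Δ hΔ, ← himg Δ' hΔ', h]
    _ ≤ _ := by
        apply Finset.sum_le_sum_of_subset_of_nonneg
        · intro I hI
          obtain ⟨Δ, hΔ, rfl⟩ := mem_image.1 hI
          exact hf Δ hΔ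
        · intros; positivity

open Classical in
-- Group the pairs (U, Δ) by W = U \ Δ. Within a group Δ determines U = W ∪ Δ, so the previous bound
-- applies to each group.
theorem sum_pairs_le (hn : 0 < n) {D : Finset (Finset (Fin n))} (hD : D ⊆ layer n r)
    {sel : Finset (Fin n) → Finset (Fin n)}
    (P : Finset (Finset (Finset (Fin n)) × Finset (Finset (Fin n))))
    (hadm : ∀ p ∈ P, Admissible r D sel p.1) (htouch : ∀ p ∈ P, p.2 ⊆ touching D p.1)
    {w : ℝ} (hw0 : 0 ≤ w) (hw1 : w ≤ 1) {q : ℕ} (hβ : n ^ 2 ≤ 64 * n.choose r)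
    (hq : (1 - (n : ℝ) ^ 2 / (64 * n.choose r)) ^ q ≤ 8 / n) :
    ∑ p ∈ P, w ^ #p.2 ≤ ∑ W ∈ P.image (fun p => p.1 \ p.2),
      (1 + w) ^ (32 * (#(untouched D W) : ℝ) / n) * chooseSum (4 * n.choose r) q := by
  rw [← Finset.sum_fiberwise_of_maps_to (s := P) (t := P.image (fun p => p.1 \ p.2))
    (g := fun p => p.1 \ p.2) (fun p hp => mem_image_of_mem _ hp)]
  apply Finset.sum_le_sum
  intro W _
  refine le_trans ?_ (indepPoly_heavyCliques_le hn ((untouched_subset D W).trans hD)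
    hw0 hw1 hβ hq)
  have hsub : ∀ p ∈ P, p.2 ⊆ p.1 := fun p hp => (htouch p hp).trans (filter_subset _ _)
  have hU : ∀ p ∈ P.filter (fun p => p.1 \ p.2 = W), W ∪ p.2 = p.1 := by
    intro p hp
    rw [mem_filter] at hp
    rw [← hp.2, sdiff_union_of_subset (hsub p hp.1)]
  have h1 : ∑ p ∈ P.filter (fun p => p.1 \ p.2 = W), w ^ #p.2 =
      ∑ Δ ∈ (P.filter (fun p => p.1 \ p.2 = W)).image Prod.snd, w ^ #Δ := by
    rw [Finset.sum_image]
    intro p hp p' hp' h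
    refine Prod.ext ?_ h
    rw [← hU p hp, ← hU p' hp', h]
  rw [h1]
  apply sum_pow_card_le_indepPoly _ (sel := sel) _ _ _ hw0
  · intro Δ hΔ
    obtain ⟨p, hp, rfl⟩ := mem_image.1 hΔ
    rw [hU p hp]
    exact hadm p (mem_filter.1 hp).1
  · intro Δ hΔ
    obtain ⟨p, hp, rfl⟩ := mem_image.1 hΔ
    rw [← (mem_filter.1 hp).2]
    exact sdiff_disjoint
  · intro Δ hΔ
    obtain ⟨p, hp, rfl⟩ := mem_image.1 hΔ
    rw [hU p hp]
    exact htouch p (mem_filter.1 hp).1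

end MatroidAsymptotics

/-! ### Counting admissible sets -/

namespace MatroidAsymptotics
open Finset

variable {n r : ℕ}

/-- Since (1 + 1/64)^32 ≤ 2, the Kleitman–Winston factor at weight 1/64 is paid for by the stable
subsets of the same R. -/
theorem rpow_le_card_stableSubsets (hn : 0 < n) (R : Finset (Finset (Fin n))) :
    (1 + 1 / 64 : ℝ) ^ (32 * (#R : ℝ) / n) ≤ #(stableSubsets R) := by
  refine le_trans ?_ (two_rpow_le_card_stableSubsets hn R)
  rw [mul_div_assoc, Real.rpow_mul (by norm_num)]
  apply Real.rpow_le_rpow (by positivity) _ (by positivity)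
  norm_num

/-- Expand each power as a sum of (1/64)^#Δ over subsets Δ of the touching members, and pay for Δ
with stable subsets of what U \ Δ leaves untouched. This shows that admissible sets with many
touching members are few. -/
theorem sum_rpow_touching_le (hn : 0 < n) {D : Finset (Finset (Fin n))} (hD : D ⊆ layer n r)
    {sel : Finset (Fin n) → Finset (Fin n)} (𝒰 : Finset (Finset (Finset (Fin n))))
    (hadm : ∀ U ∈ 𝒰, Admissible r D sel U)
    {q : ℕ} (hβ : n ^ 2 ≤ 64 * n.choose r)
    (hq : (1 - (n : ℝ) ^ 2 / (64 * n.choose r)) ^ q ≤ 8 / n) :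
    ∑ U ∈ 𝒰, (1 + 1 / 64 : ℝ) ^ #(touching D U) ≤
      chooseSum (4 * n.choose r) q * #(stableSubsets (layer n r)) := by
  classical
  set P : Finset (Finset (Finset (Fin n)) × Finset (Finset (Fin n))) :=
    𝒰.biUnion fun U => (touching D U).powerset.image fun Δ => (U, Δ) with hP
  have hmem : ∀ p ∈ P, p.1 ∈ 𝒰 ∧ p.2 ⊆ touching D p.1 := by
    intro p hp
    simp only [hP, mem_biUnion, mem_image, mem_powerset] at hp
    obtain ⟨U, hU, Δ, hΔ, rfl⟩ := hp
    exact ⟨hU, hΔ⟩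
  have h1 : ∑ U ∈ 𝒰, (1 + 1 / 64 : ℝ) ^ #(touching D U) = ∑ p ∈ P, (1 / 64 : ℝ) ^ #p.2 := by
    rw [hP, Finset.sum_biUnion]
    · apply Finset.sum_congr rfl
      intro U _
      rw [Finset.sum_image (by
        intro Δ _ Δ' _ h
        exact (Prod.mk.inj h).2)]
      have h := Finset.sum_pow_mul_eq_add_pow (1 / 64 : ℝ) 1 (touching D U)
      simp only [one_pow, mul_one] at h
      rw [add_comm, ← h]
    · intro U _ U' _ hne
      rw [Function.onFun, disjoint_left]
      intro p hp hp'
      simp only [mem_image] at hp hp'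
      obtain ⟨Δ, -, rfl⟩ := hp
      obtain ⟨Δ', -, h⟩ := hp'
      exact hne (Prod.mk.inj h).1.symm
  rw [h1]
  refine (sum_pairs_le hn hD P (sel := sel) (fun p hp => hadm _ (hmem p hp).1)
    (fun p hp => (hmem p hp).2) (by norm_num) (by norm_num) hβ hq).trans ?_
  rw [← Finset.sum_mul, mul_comm]
  apply mul_le_mul_of_nonneg_left _ (by positivity)
  have hW : ∀ W ∈ P.image (fun p => p.1 \ p.2), ∃ U ∈ 𝒰, W ⊆ U := by
    intro W hW
    obtain ⟨p, hp, rfl⟩ := mem_image.1 hW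
    exact ⟨p.1, (hmem p hp).1, sdiff_subset⟩
  refine (Finset.sum_le_sum fun W _ => rpow_le_card_stableSubsets hn (untouched D W)).trans ?_
  rw [← Nat.cast_sum, Nat.cast_le]
  apply sum_stable_untouched_le hD
  · intro W hWm
    obtain ⟨U, hU, hWU⟩ := hW W hWm
    exact (hadm U hU).stable.mono hWU
  · intro W hWm
    obtain ⟨U, hU, hWU⟩ := hW W hWm
    exact hWU.trans (hadm U hU).subset_layer
  · intro W hWm X hX
    obtain ⟨U, hU, hWU⟩ := hW W hWm
    exact (hadm U hU).notMem X (hWU hX)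

/-- Remove all touching members, so that the whole of D is untouched. At weight 1/128 the
Kleitman–Winston factor is at most 2^(#D/(2n)), half of the exponent that the stable subsets of D
supply; the other half is the saving. This controls admissible sets with few touching members. -/
theorem sum_pow_touching_le (hn : 0 < n) {D : Finset (Finset (Fin n))} (hD : D ⊆ layer n r)
    {sel : Finset (Fin n) → Finset (Fin n)} (𝒰 : Finset (Finset (Finset (Fin n))))
    (hadm : ∀ U ∈ 𝒰, Admissible r D sel U)
    {q : ℕ} (hβ : n ^ 2 ≤ 64 * n.choose r)
    (hq : (1 - (n : ℝ) ^ 2 / (64 * n.choose r)) ^ q ≤ 8 / n) :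
    ∑ U ∈ 𝒰, (1 / 128 : ℝ) ^ #(touching D U) ≤
      chooseSum (4 * n.choose r) q * #(stableSubsets (layer n r)) *
        (2 : ℝ) ^ (-((#D : ℝ) / (2 * n))) := by
  classical
  set P : Finset (Finset (Finset (Fin n)) × Finset (Finset (Fin n))) :=
    𝒰.image fun U => (U, touching D U) with hP
  have hmem : ∀ p ∈ P, p.1 ∈ 𝒰 ∧ p.2 = touching D p.1 := by
    intro p hp
    simp only [hP, mem_image] at hp
    obtain ⟨U, hU, rfl⟩ := hp
    exact ⟨hU, rfl⟩
  have h1 : ∑ U ∈ 𝒰, (1 / 128 : ℝ) ^ #(touching D U) = ∑ p ∈ P, (1 / 128 : ℝ) ^ #p.2 := by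
    rw [hP, Finset.sum_image]
    intro U _ U' _ h
    exact (Prod.mk.inj h).1
  rw [h1]
  refine (sum_pairs_le hn hD P (sel := sel) (fun p hp => hadm _ (hmem p hp).1)
    (fun p hp => (hmem p hp).2.le) (by norm_num) (by norm_num) hβ hq).trans ?_
  rw [← Finset.sum_mul, mul_comm, mul_assoc]
  apply mul_le_mul_of_nonneg_left _ (by positivity)
  have hW : ∀ W ∈ P.image (fun p => p.1 \ p.2), ∃ U ∈ 𝒰, W ⊆ U := by
    intro W hW
    obtain ⟨p, hp, rfl⟩ := mem_image.1 hW
    exact ⟨p.1, (hmem p hp).1, sdiff_subset⟩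
  have hfree : ∀ W ∈ P.image (fun p => p.1 \ p.2), untouched D W = D := by
    intro W hW
    obtain ⟨p, hp, rfl⟩ := mem_image.1 hW
    rw [(hmem p hp).2]
    apply filter_true_of_mem
    intro Y hY X hX hadj
    rw [mem_sdiff] at hX
    exact hX.2 (mem_filter.2 ⟨hX.1, Y, hY, hadj⟩)
  have key : ∀ W ∈ P.image (fun p => p.1 \ p.2),
      (1 + 1 / 128 : ℝ) ^ (32 * (#(untouched D W) : ℝ) / n) ≤
        #(stableSubsets (untouched D W)) * (2 : ℝ) ^ (-((#D : ℝ) / (2 * n))) := by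
    intro W hWm
    have h2 := two_rpow_le_card_stableSubsets hn (untouched D W)
    refine le_trans ?_ (mul_le_mul_of_nonneg_right h2 (by positivity))
    rw [hfree W hWm, ← Real.rpow_add (by norm_num)]
    have h3 : (#D : ℝ) / n + -((#D : ℝ) / (2 * n)) = (1 / 2) * ((#D : ℝ) / n) := by
      have : (n : ℝ) ≠ 0 := by exact_mod_cast hn.ne'
      field_simp
      ring
    rw [h3, mul_div_assoc, Real.rpow_mul (by norm_num), Real.rpow_mul (by norm_num)]
    apply Real.rpow_le_rpow (by positivity) _ (by positivity)
    rw [← Real.sqrt_eq_rpow]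
    apply Real.le_sqrt_of_sq_le
    norm_num
  refine (Finset.sum_le_sum key).trans ?_
  rw [← Finset.sum_mul]
  apply mul_le_mul_of_nonneg_right _ (by positivity)
  rw [← Nat.cast_sum, Nat.cast_le]
  apply sum_stable_untouched_le hD
  · intro W hWm
    obtain ⟨U, hU, hWU⟩ := hW W hWm
    exact (hadm U hU).stable.mono hWU
  · intro W hWm
    obtain ⟨U, hU, hWU⟩ := hW W hWm
    exact hWU.trans (hadm U hU).subset_layer
  · intro W hWm X hX
    obtain ⟨U, hU, hWU⟩ := hW W hWm
    exact (hadm U hU).notMem X (hWU hX)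

/-- There are few admissible sets if `D` is large. -/
theorem card_admissible_le (hn : 0 < n) {D : Finset (Finset (Fin n))} (hD : D ⊆ layer n r)
    {sel : Finset (Fin n) → Finset (Fin n)} (𝒰 : Finset (Finset (Finset (Fin n))))
    (hadm : ∀ U ∈ 𝒰, Admissible r D sel U)
    {q : ℕ} (hβ : n ^ 2 ≤ 64 * n.choose r)
    (hq : (1 - (n : ℝ) ^ 2 / (64 * n.choose r)) ^ q ≤ 8 / n) :
    (#𝒰 : ℝ) ≤ 2 * (chooseSum (4 * n.choose r) q * #(stableSubsets (layer n r))) *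
        (2 : ℝ) ^ (-((#D : ℝ) / (1792 * n))) := by
  have hn' : (0 : ℝ) < n := by exact_mod_cast hn
  -- Threshold between many and few touching members. In the second case the loss is 128^a =
  -- 2^(#D/(4n)), half of the saving 2^(#D/(2n)).
  set a : ℝ := #D / (28 * n) with ha
  have ha0 : 0 ≤ a := by positivity
  have h1 := sum_rpow_touching_le hn hD 𝒰 hadm hβ hq
  have h2 := sum_pow_touching_le hn hD 𝒰 hadm hβ hq
  set S : ℝ := chooseSum (4 * n.choose r) q * #(stableSubsets (layer n r)) with hS
  have hS0 : 0 ≤ S := by positivity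
  have hpt : ∀ U ∈ 𝒰, (1 : ℝ) ≤
      (1 + 1 / 64 : ℝ) ^ (-a) * (1 + 1 / 64 : ℝ) ^ #(touching D U) +
      (128 : ℝ) ^ a * (1 / 128 : ℝ) ^ #(touching D U) := by
    intro U _
    have e1 : (0 : ℝ) ≤ (1 + 1 / 64 : ℝ) ^ (-a) * (1 + 1 / 64 : ℝ) ^ #(touching D U) := by
      positivity
    have e2 : (0 : ℝ) ≤ (128 : ℝ) ^ a * (1 / 128 : ℝ) ^ #(touching D U) := by positivity
    rcases le_total a #(touching D U) with h | h
    · have : (1 : ℝ) ≤ (1 + 1 / 64 : ℝ) ^ (-a) * (1 + 1 / 64 : ℝ) ^ #(touching D U) := by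
        rw [← Real.rpow_natCast, ← Real.rpow_add (by norm_num)]
        exact Real.one_le_rpow (by norm_num) (by linarith)
      linarith
    · have : (1 : ℝ) ≤ (128 : ℝ) ^ a * (1 / 128 : ℝ) ^ #(touching D U) := by
        rw [one_div, inv_pow, ← Real.rpow_natCast, ← Real.rpow_neg (by norm_num),
          ← Real.rpow_add (by norm_num)]
        exact Real.one_le_rpow (by norm_num) (by linarith)
      linarith
  have h3 := Finset.card_nsmul_le_sum 𝒰 _ 1 hpt
  rw [nsmul_eq_mul, mul_one, Finset.sum_add_distrib, ← Finset.mul_sum, ← Finset.mul_sum] at h3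
  have e1 : (1 + 1 / 64 : ℝ) ^ (-a) ≤ (2 : ℝ) ^ (-((#D : ℝ) / (1792 * n))) := by
    have h5 : -((#D : ℝ) / (1792 * n)) = (1 / 64) * (-a) := by
      rw [ha]; field_simp; ring
    rw [h5, Real.rpow_mul (by norm_num), Real.rpow_neg (by positivity),
      Real.rpow_neg (by positivity)]
    apply inv_anti₀ (by positivity)
    apply Real.rpow_le_rpow (by positivity) _ ha0
    -- Bernoulli. Hence (1 + 1/64)^(-a) ≤ 2^(-a/64), and 64 · 28 = 1792.
    have h6 : (2 : ℝ) ≤ (1 + 1 / 64) ^ (64 : ℕ) := by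
      have := one_add_mul_le_pow (a := (1 / 64 : ℝ)) (by norm_num) 64
      norm_num at this ⊢
    calc (2 : ℝ) ^ (1 / 64 : ℝ) ≤ ((1 + 1 / 64) ^ (64 : ℕ)) ^ (1 / 64 : ℝ) :=
          Real.rpow_le_rpow (by norm_num) h6 (by norm_num)
      _ = 1 + 1 / 64 := by
          rw [← Real.rpow_natCast, ← Real.rpow_mul (by norm_num)]
          norm_num
  have e2 : (128 : ℝ) ^ a * (2 : ℝ) ^ (-((#D : ℝ) / (2 * n))) ≤
      (2 : ℝ) ^ (-((#D : ℝ) / (1792 * n))) := by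
    have h5 : (128 : ℝ) = 2 ^ (7 : ℝ) := by norm_num
    rw [h5, ← Real.rpow_mul (by norm_num), ← Real.rpow_add (by norm_num)]
    apply Real.rpow_le_rpow_of_exponent_le (by norm_num)
    have h6 : 7 * a + -((#D : ℝ) / (2 * n)) = -448 * ((#D : ℝ) / (1792 * n)) := by
      rw [ha]; field_simp; ring
    rw [h6]
    have : 0 ≤ (#D : ℝ) / (1792 * n) := by positivity
    linarith
  calc (#𝒰 : ℝ) ≤ _ := h3
    _ ≤ (2 : ℝ) ^ (-((#D : ℝ) / (1792 * n))) * S +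
        (128 : ℝ) ^ a * (S * (2 : ℝ) ^ (-((#D : ℝ) / (2 * n)))) := by
        apply add_le_add
        · exact mul_le_mul e1 h1 (Finset.sum_nonneg fun _ _ => by positivity) (by positivity)
        · exact mul_le_mul_of_nonneg_left h2 (by positivity)
    _ ≤ _ := by
        have := mul_le_mul_of_nonneg_left e2 hS0
        linarith

end MatroidAsymptotics

/-! ### Full rows and full columns of a nonbasis -/

namespace MatroidAsymptotics
open Finset

variable {n r : ℕ}

/-- The independent sets of a matroid of rank `r` on `[n]`. -/
structure IsIndepFamily (r : ℕ) (I : Finset (Fin n) → Prop) : Prop where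
  subset : ∀ ⦃X Y⦄, I Y → X ⊆ Y → I X
  aug : ∀ ⦃X Y⦄, I X → I Y → #X < #Y → ∃ e ∈ Y, e ∉ X ∧ I (insert e X)
  card_le : ∀ ⦃X⦄, I X → #X ≤ r
  exists_base : ∃ B, #B = r ∧ I B

/-- `V` contains an independent set of size `r`. -/
def Spans (r : ℕ) (I : Finset (Fin n) → Prop) (V : Finset (Fin n)) : Prop :=
  ∃ B ⊆ V, #B = r ∧ I B

open Classical in
/-- The dependent sets of size `r`. -/
noncomputable def nonBases (r : ℕ) (I : Finset (Fin n) → Prop) : Finset (Finset (Fin n)) :=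
  (layer n r).filter fun X => ¬ I X

open Classical in
/-- The elements of `X` whose deletion leaves a dependent set. -/
noncomputable def fullRows (I : Finset (Fin n) → Prop) (X : Finset (Fin n)) : Finset (Fin n) :=
  X.filter fun x => ¬ I (X.erase x)

open Classical in
/-- The elements outside `X` whose addition leaves a nonspanning set. -/
noncomputable def fullCols (r : ℕ) (I : Finset (Fin n) → Prop) (X : Finset (Fin n)) :
    Finset (Fin n) :=
  Xᶜ.filter fun y => ¬ Spans r I (insert y X)

variable {I : Finset (Fin n) → Prop}

theorem mem_nonBases {X : Finset (Fin n)} : X ∈ nonBases r I ↔ #X = r ∧ ¬ I X := by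
  simp [nonBases]

theorem mem_fullRows {X : Finset (Fin n)} {x : Fin n} :
    x ∈ fullRows I X ↔ x ∈ X ∧ ¬ I (X.erase x) := by
  simp [fullRows]

theorem mem_fullCols {X : Finset (Fin n)} {y : Fin n} :
    y ∈ fullCols r I X ↔ y ∉ X ∧ ¬ Spans r I (insert y X) := by
  simp [fullCols]

theorem nonBases_subset : nonBases r I ⊆ layer n r := by
  intro X hX
  exact mem_layer.2 (mem_nonBases.1 hX).1

theorem card_insert_erase {X : Finset (Fin n)} {x y : Fin n} (hx : x ∈ X) (hy : y ∉ X) :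
    #(insert y (X.erase x)) = #X := (jAdj_insert_erase hx hy).1.symm

theorem insert_insert_erase {X : Finset (Fin n)} {x y : Fin n} (hx : x ∈ X) :
    insert x (insert y (X.erase x)) = insert y X := by
  rw [Finset.insert_comm, insert_erase hx]

namespace IsIndepFamily

/-- If X - x is independent and X + y contains a base, augment X - x from that base. The new element
can only be y, since x would make X independent. So the nonbases around X fill whole rows and
columns of the r × (n - r) grid of exchanges. -/
theorem mem_nonBases_insert_erase (hI : IsIndepFamily r I) {X : Finset (Fin n)} {x y : Fin n}
    (hX : X ∈ nonBases r I) (hx : x ∈ X) (hy : y ∉ X) :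
    insert y (X.erase x) ∈ nonBases r I ↔ x ∈ fullRows I X ∨ y ∈ fullCols r I X := by
  rw [mem_nonBases] at hX
  rw [mem_nonBases, mem_fullRows, mem_fullCols, card_insert_erase hx hy]
  constructor
  · rintro ⟨-, hY⟩
    by_contra! hcon
    obtain ⟨B, hB, hBr, hBI⟩ := hcon.2 hy
    have h1 := hcon.1 hx
    have h2 : #(X.erase x) + 1 = #X := card_erase_add_one hx
    obtain ⟨e, he, he', heI⟩ := hI.aug h1 hBI (by omega)
    have h3 := hB he
    rw [mem_insert] at h3
    rcases h3 with rfl | h3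
    · exact hY heI
    · have h4 : e = x := by
        by_contra h
        exact he' (mem_erase.2 ⟨h, h3⟩)
      subst h4
      rw [insert_erase hx] at heI
      exact hX.2 heI
  · rintro (⟨-, h⟩ | ⟨-, h⟩)
    · exact ⟨hX.1, fun hY => h (hI.subset hY (subset_insert _ _))⟩
    · exact ⟨hX.1, fun hY => h ⟨_, insert_subset_insert _ (erase_subset _ _),
        (card_insert_erase hx hy).trans hX.1, hY⟩⟩

theorem exists_extend (hI : IsIndepFamily r I) (k : ℕ) : ∀ {A B : Finset (Fin n)}, I A → I B →
    #B = #A + k → ∃ J, A ⊆ J ∧ J ⊆ A ∪ B ∧ #J = #B ∧ I J := by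
  induction k with
  | zero => exact fun {A B} hA _ h => ⟨A, Subset.rfl, subset_union_left, by omega, hA⟩
  | succ k ih =>
    intro A B hA hB h
    obtain ⟨e, he, he', heI⟩ := hI.aug hA hB (by omega)
    obtain ⟨J, h1, h2, h3, h4⟩ := ih heI hB (by rw [card_insert_of_notMem he']; omega)
    refine ⟨J, (subset_insert _ _).trans h1, h2.trans ?_, h3, h4⟩
    exact union_subset (insert_subset (mem_union_right _ he) subset_union_left) subset_union_right

/-- The elements outside `fullRows` form a dependent set unless all rows are full. -/
theorem not_indep_sdiff_fullRows (hI : IsIndepFamily r I) {X : Finset (Fin n)} {x : Fin n}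
    (hX : ¬ I X) (hx : x ∈ X) (hxI : I (X.erase x)) : ¬ I (X \ fullRows I X) := by
  -- Were this set independent, it would extend inside X to an independent X - z. Then z is not a
  -- full row, so z belongs to the set that was extended: a contradiction.
  intro hC
  have hCX : X \ fullRows I X ⊆ X := sdiff_subset
  have hne : X \ fullRows I X ≠ X := fun h => hX (h ▸ hC)
  have hlt : #(X \ fullRows I X) < #X := card_lt_card (ssubset_of_subset_of_ne hCX hne)
  have h2 : #(X.erase x) + 1 = #X := card_erase_add_one hx
  obtain ⟨J, h1, h3, h4, h5⟩ := hI.exists_extend (#(X.erase x) - #(X \ fullRows I X)) hC hxI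
    (by omega)
  have hJX : J ⊆ X := h3.trans (union_subset hCX (erase_subset _ _))
  have h6 : #(X \ J) = 1 := by rw [card_sdiff_of_subset hJX]; omega
  obtain ⟨z, hz⟩ := card_eq_one.1 h6
  have hzX : z ∈ X \ J := by simp [hz]
  rw [mem_sdiff] at hzX
  have hJz : X.erase z = J := by
    rw [← sdiff_singleton_eq_erase, ← hz, Finset.sdiff_sdiff_eq_self hJX]
  apply hzX.2
  apply h1
  rw [mem_sdiff, mem_fullRows]
  exact ⟨hzX.1, fun h => h.2 (hJz ▸ h5)⟩

/-- The complement of the full rows is the unique circuit of a nonbasis of rank r - 1. Exchanging an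
x outside this circuit keeps the circuit, and it is still the unique one unless the rank has
dropped. -/
theorem fullRows_insert_erase (hI : IsIndepFamily r I) {X : Finset (Fin n)} {x y z : Fin n}
    (hX : ¬ I X) (hxr : x ∈ fullRows I X) (hy : y ∉ X)
    (hz : z ∈ X) (hzI : I (X.erase z))
    (hfr : fullRows I (insert y (X.erase x)) ≠ insert y (X.erase x)) :
    fullRows I (insert y (X.erase x)) = insert y ((fullRows I X).erase x) := by
  set Y := insert y (X.erase x) with hY
  have hx : x ∈ X := (mem_fullRows.1 hxr).1
  have hCX := hI.not_indep_sdiff_fullRows hX hz hzI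
  have hsub : X \ fullRows I X ⊆ Y := by
    intro c hc
    rw [mem_sdiff] at hc
    exact mem_insert_of_mem (mem_erase.2 ⟨fun h => hc.2 (h ▸ hxr), hc.1⟩)
  have hYd : ¬ I Y := fun h => hCX (hI.subset h hsub)
  obtain ⟨y0, hy0, hy0I⟩ : ∃ y0 ∈ Y, I (Y.erase y0) := by
    by_contra! h
    apply hfr
    classical
    apply filter_true_of_mem
    exact h
  have hCY := hI.not_indep_sdiff_fullRows hYd hy0 hy0I
  have hCYX : Y \ fullRows I Y ⊆ X \ fullRows I X := by
    intro c hc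
    by_contra hcX
    rw [mem_sdiff, mem_fullRows] at hc
    apply hc.2
    refine ⟨hc.1, fun h => hCX (hI.subset h ?_)⟩
    exact subset_erase.2 ⟨hsub, hcX⟩
  have hCXY : X \ fullRows I X ⊆ Y \ fullRows I Y := by
    intro c hc
    by_contra hcY
    have hc' := hc
    rw [mem_sdiff, mem_fullRows] at hc
    apply hc.2
    refine ⟨hc.1, fun h => hCY (hI.subset h ?_)⟩
    exact subset_erase.2 ⟨hCYX.trans sdiff_subset, hcY⟩
  have heq : Y \ fullRows I Y = X \ fullRows I X := Subset.antisymm hCYX hCXY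
  ext c
  have h1 : c ∈ Y \ fullRows I Y ↔ c ∈ X \ fullRows I X := by rw [heq]
  have h2 : c ∈ Y ↔ c = y ∨ (c ≠ x ∧ c ∈ X) := by rw [hY, mem_insert, mem_erase]
  have h3 : c ∈ fullRows I Y → c ∈ Y := fun h => (mem_fullRows.1 h).1
  have h4 : c ∈ fullRows I X → c ∈ X := fun h => (mem_fullRows.1 h).1
  rw [mem_sdiff, mem_sdiff] at h1
  rw [mem_insert, mem_erase]
  by_cases hcy : c = y
  · subst hcy
    tauto
  · by_cases hcx : c = x
    · subst hcx
      tauto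
    · tauto

/-- All rows full means that Y has rank at most r - 2, so one more element cannot make it spanning.
`fullRows_eq_self` is the converse. -/
theorem fullCols_eq_compl (hI : IsIndepFamily r I) {Y : Finset (Fin n)} (hY : Y ∈ nonBases r I)
    (h : fullRows I Y = Y) : fullCols r I Y = Yᶜ := by
  classical
  rw [mem_nonBases] at hY
  apply filter_true_of_mem
  rintro e he ⟨B, hB, hBr, hBI⟩
  rw [mem_compl] at he
  have h1 : #(insert e Y) = r + 1 := by rw [card_insert_of_notMem he, hY.1]
  have h6 : #(insert e Y \ B) = 1 := by rw [card_sdiff_of_subset hB]; omega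
  obtain ⟨z, hz⟩ := card_eq_one.1 h6
  have hzX : z ∈ insert e Y \ B := by simp [hz]
  rw [mem_sdiff, mem_insert] at hzX
  have hBz : (insert e Y).erase z = B := by
    rw [← sdiff_singleton_eq_erase, ← hz, Finset.sdiff_sdiff_eq_self hB]
  rcases hzX.1 with rfl | hzY
  · rw [erase_insert he] at hBz
    exact hY.2 (hBz ▸ hBI)
  · have h2 : z ∈ fullRows I Y := by rw [h]; exact hzY
    refine (mem_fullRows.1 h2).2 (hI.subset hBI ?_)
    rw [← hBz]
    exact erase_subset_erase _ (subset_insert _ _)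

theorem fullRows_eq_self (hI : IsIndepFamily r I) {Y : Finset (Fin n)} (hY : Y ∈ nonBases r I)
    (h : fullCols r I Y = Yᶜ) : fullRows I Y = Y := by
  classical
  rw [mem_nonBases] at hY
  apply filter_true_of_mem
  intro z hz hzI
  obtain ⟨B, hBr, hB⟩ := hI.exists_base
  have h2 : #(Y.erase z) + 1 = #Y := card_erase_add_one hz
  obtain ⟨f, hf, hf', hfI⟩ := hI.aug hzI hB (by omega)
  have hfY : f ∉ Y := by
    intro hfY
    have : f = z := by
      by_contra h
      exact hf' (mem_erase.2 ⟨h, hfY⟩)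
    subst this
    rw [insert_erase hz] at hfI
    exact hY.2 hfI
  have h3 : f ∈ fullCols r I Y := by rw [h]; exact mem_compl.2 hfY
  refine (mem_fullCols.1 h3).2 ⟨_, insert_subset_insert _ (erase_subset z Y), ?_, hfI⟩
  rw [card_insert_of_notMem hf']
  omega

/-- X lies in the nonspanning set V, whose hyperplane Y already spans. Augmenting Y - y0 from a base
of X + e, the new element is e, since an element of X would make V spanning. -/
theorem spans_insert_of_spans_insert (hI : IsIndepFamily r I) {V X Y : Finset (Fin n)}
    {y0 e : Fin n} (hYr : #Y = r) (hV : ¬ Spans r I V) (hXV : X ⊆ V) (hYV : Y ⊆ V)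
    (hy0 : y0 ∈ Y) (hy0I : I (Y.erase y0)) (hsp : Spans r I (insert e X)) :
    Spans r I (insert e Y) := by
  obtain ⟨B, hB, hBr, hBI⟩ := hsp
  have h2 : #(Y.erase y0) + 1 = #Y := card_erase_add_one hy0
  obtain ⟨f, hf, hf', hfI⟩ := hI.aug hy0I hBI (by omega)
  have hc : #(insert f (Y.erase y0)) = r := by
    rw [card_insert_of_notMem hf']
    omega
  have h3 := hB hf
  rw [mem_insert] at h3
  rcases h3 with rfl | h3
  · exact ⟨_, insert_subset_insert _ (erase_subset y0 Y), hc, hfI⟩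
  · exact absurd ⟨_, insert_subset (hXV h3) ((erase_subset y0 Y).trans hYV), hc, hfI⟩ hV

/-- X together with its full columns is a hyperplane. Exchanging within it keeps the hyperplane, and
x and y swap roles. -/
theorem fullCols_insert_erase (hI : IsIndepFamily r I) {X : Finset (Fin n)} {x y x0 y0 : Fin n}
    (hXr : #X = r) (hx : x ∈ X) (hyc : y ∈ fullCols r I X)
    (hx0 : x0 ∈ X) (hx0I : I (X.erase x0)) (hy0 : y0 ∈ insert y (X.erase x))
    (hy0I : I ((insert y (X.erase x)).erase y0)) :
    fullCols r I (insert y (X.erase x)) = insert x ((fullCols r I X).erase y) := by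
  obtain ⟨hy, hV⟩ := mem_fullCols.1 hyc
  set Y := insert y (X.erase x) with hY
  have hYr : #Y = r := (card_insert_erase hx hy).trans hXr
  have hXV : X ⊆ insert y X := subset_insert _ _
  have hYV : Y ⊆ insert y X := insert_subset_insert _ (erase_subset _ _)
  have hxy : x ≠ y := fun h => hy (h ▸ hx)
  have hxV : insert x Y = insert y X := insert_insert_erase hx
  have hsp : ∀ e, Spans r I (insert e X) ↔ Spans r I (insert e Y) := fun e =>
    ⟨hI.spans_insert_of_spans_insert hYr hV hXV hYV hy0 hy0I,
      hI.spans_insert_of_spans_insert hXr hV hYV hXV hx0 hx0I⟩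
  ext c
  have h2 : c ∈ Y ↔ c = y ∨ (c ≠ x ∧ c ∈ X) := by rw [hY, mem_insert, mem_erase]
  have h3 : c ∈ insert x ((fullCols r I X).erase y) ↔
      c = x ∨ (c ≠ y ∧ c ∉ X ∧ ¬ Spans r I (insert c X)) := by
    rw [mem_insert, mem_erase, mem_fullCols]
  rw [mem_fullCols, h3, ← hsp]
  by_cases hcx : c = x
  · subst hcx
    rw [hsp, hxV]
    simp [h2, hxy, hV]
  · by_cases hcy : c = y
    · subst hcy
      simp [h2, hcx]
    · simp [h2, hcx, hcy]

end IsIndepFamily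

end MatroidAsymptotics

/-! ### Recovering a matroid from a cover and a code -/

namespace MatroidAsymptotics
open Finset

variable {n r κ θ : ℕ} {I I' : Finset (Fin n) → Prop} {D : Finset (Finset (Fin n))}

/-- A set `D` of dependent `r`-sets that leaves few dependent `r`-sets uncovered, locally. -/
structure IsGoodCover (r κ θ : ℕ) (I : Finset (Fin n) → Prop) (D : Finset (Finset (Fin n))) :
    Prop where
  subset : D ⊆ nonBases r I
  small : ∀ X ∈ nonBases r I, X ∉ D → #(fullRows I X) ≤ κ ∧ #(fullCols r I X) ≤ κ
  row : ∀ Z, #Z + 1 = r → ¬ I Z → #(clique r Z \ D) < θ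
  col : ∀ V, #V = r + 1 → ¬ Spans r I V → #(clique r V \ D) < θ

/-- In a row full for I all but fewer than θ sets lie in D, hence are nonbases of I'. If the row
were not full for I', its nonbases would lie only in full columns, leaving at least θ sets outside
D. -/
theorem fullRows_subset_fullRows (hI' : IsIndepFamily r I') (hc : IsGoodCover r κ θ I D)
    (hD' : D ⊆ nonBases r I') {X : Finset (Fin n)} (hX' : X ∈ nonBases r I')
    (hsmall : #(fullCols r I' X) + θ + r ≤ n) : fullRows I X ⊆ fullRows I' X := by
  intro x hx
  by_contra hx'
  obtain ⟨hxX, hxI⟩ := mem_fullRows.1 hx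
  have hXr := (mem_nonBases.1 hX').1
  have h0 : #(X.erase x) + 1 = #X := card_erase_add_one hxX
  have h1 := hc.row (X.erase x) (by omega) hxI
  have h2 : (Xᶜ \ fullCols r I' X).image (fun y => insert y (X.erase x)) ⊆
      clique r (X.erase x) \ D := by
    intro Y hY
    obtain ⟨y, hy, rfl⟩ := mem_image.1 hY
    rw [mem_sdiff, mem_compl] at hy
    rw [mem_sdiff, mem_clique, card_insert_erase hxX hy.1]
    refine ⟨⟨hXr, Or.inr (subset_insert _ _)⟩, fun hYD => ?_⟩
    rcases (hI'.mem_nonBases_insert_erase hX' hxX hy.1).1 (hD' hYD) with h | h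
    · exact hx' h
    · exact hy.2 h
  have h3 := card_le_card h2
  rw [card_image_of_injOn, card_sdiff_of_subset (fun y hy => mem_compl.2 (mem_fullCols.1 hy).1),
    card_compl, Fintype.card_fin] at h3
  · omega
  · intro y hy y' hy' h
    simp only [coe_sdiff, Set.mem_sdiff, mem_coe, mem_compl] at hy hy'
    have h4 : y ∈ insert y' (X.erase x) := by
      have : y ∈ insert y (X.erase x) := mem_insert_self _ _
      simpa only [h] using this
    rcases mem_insert.1 h4 with h5 | h5
    · exact h5
    · exact absurd (mem_of_mem_erase h5) hy.1

theorem fullCols_subset_fullCols (hI' : IsIndepFamily r I') (hc : IsGoodCover r κ θ I D)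
    (hD' : D ⊆ nonBases r I') {X : Finset (Fin n)} (hX' : X ∈ nonBases r I')
    (hsmall : #(fullRows I' X) + θ ≤ r) : fullCols r I X ⊆ fullCols r I' X := by
  intro y hy
  by_contra hy'
  obtain ⟨hyX, hyI⟩ := mem_fullCols.1 hy
  have hXr := (mem_nonBases.1 hX').1
  have h1 := hc.col (insert y X) (by rw [card_insert_of_notMem hyX, hXr]) hyI
  have h2 : (X \ fullRows I' X).image (fun x => insert y (X.erase x)) ⊆
      clique r (insert y X) \ D := by
    intro Y hY
    obtain ⟨x, hx, rfl⟩ := mem_image.1 hY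
    rw [mem_sdiff] at hx
    rw [mem_sdiff, mem_clique, card_insert_erase hx.1 hyX]
    refine ⟨⟨hXr, Or.inl (insert_subset_insert _ (erase_subset _ _))⟩, fun hYD => ?_⟩
    rcases (hI'.mem_nonBases_insert_erase hX' hx.1 hyX).1 (hD' hYD) with h | h
    · exact hx.2 h
    · exact hy' h
  have h3 := card_le_card h2
  rw [card_image_of_injOn, card_sdiff_of_subset (fun x hx => (mem_fullRows.1 hx).1)] at h3
  · omega
  · intro x hx x' hx' h
    simp only [coe_sdiff, Set.mem_sdiff, mem_coe] at hx hx'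
    by_contra hne
    have h4 : x ∈ insert y (X.erase x') := mem_insert_of_mem (mem_erase.2 ⟨hne, hx.1⟩)
    have h5 : x ∈ insert y (X.erase x) := by simpa only [h] using h4
    rcases mem_insert.1 h5 with h6 | h6
    · exact hyX (h6 ▸ hx.1)
    · exact (mem_erase.1 h6).1 rfl

/-- Two matroids with a common good cover. -/
structure CommonCover (r κ θ : ℕ) (I I' : Finset (Fin n) → Prop) (D : Finset (Finset (Fin n))) :
    Prop where
  indep : IsIndepFamily r I
  indep' : IsIndepFamily r I'
  cover : IsGoodCover r κ θ I D
  cover' : IsGoodCover r κ θ I' D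
  le_r : κ + θ + 2 ≤ r
  le_n : κ + θ + r + 2 ≤ n

namespace CommonCover

theorem symm (h : CommonCover r κ θ I I' D) : CommonCover r κ θ I' I D :=
  ⟨h.indep', h.indep, h.cover', h.cover, h.le_r, h.le_n⟩

theorem fullRows_eq (h : CommonCover r κ θ I I' D) {X : Finset (Fin n)}
    (hX : X ∈ nonBases r I) (hX' : X ∈ nonBases r I') (hXD : X ∉ D) :
    fullRows I X = fullRows I' X := by
  have h1 := h.le_n
  apply Subset.antisymm
  · refine fullRows_subset_fullRows h.indep' h.cover h.cover'.subset hX' ?_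
    have := (h.cover'.small X hX' hXD).2
    omega
  · refine fullRows_subset_fullRows h.indep h.cover' h.cover.subset hX ?_
    have := (h.cover.small X hX hXD).2
    omega

theorem fullCols_eq (h : CommonCover r κ θ I I' D) {X : Finset (Fin n)}
    (hX : X ∈ nonBases r I) (hX' : X ∈ nonBases r I') (hXD : X ∉ D) :
    fullCols r I X = fullCols r I' X := by
  have h1 := h.le_r
  apply Subset.antisymm
  · refine fullCols_subset_fullCols h.indep' h.cover h.cover'.subset hX' ?_
    have := (h.cover'.small X hX' hXD).1
    omega
  · refine fullCols_subset_fullCols h.indep h.cover' h.cover.subset hX ?_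
    have := (h.cover.small X hX hXD).1
    omega

/-- The dependent neighbours of an uncovered dependent set are determined. -/
theorem mem_of_adj (h : CommonCover r κ θ I I' D) {X Y : Finset (Fin n)}
    (hX : X ∈ nonBases r I) (hX' : X ∈ nonBases r I') (hXD : X ∉ D) (hadj : JAdj X Y)
    (hY : Y ∈ nonBases r I) : Y ∈ nonBases r I' := by
  obtain ⟨x, hx, y, hy, rfl⟩ := hadj.exists_eq
  rw [h.indep.mem_nonBases_insert_erase hX hx hy] at hY
  rw [h.indep'.mem_nonBases_insert_erase hX' hx hy, ← h.fullRows_eq hX hX' hXD,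
    ← h.fullCols_eq hX hX' hXD]
  exact hY

/-- The dependent vertices at distance two, via `D`, of an uncovered dependent set are
determined. -/
theorem mem_of_adj_of_adj (h : CommonCover r κ θ I I' D) {X Y Z : Finset (Fin n)}
    (hX : X ∈ nonBases r I) (hX' : X ∈ nonBases r I') (hXD : X ∉ D) (hadj : JAdj X Y)
    (hYD : Y ∈ D) (hYZ : JAdj Y Z) (hZ : Z ∈ nonBases r I) : Z ∈ nonBases r I' := by
  have hY := h.cover.subset hYD
  have hY' := h.cover'.subset hYD
  have hrows := h.fullRows_eq hX hX' hXD
  have hcols := h.fullCols_eq hX hX' hXD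
  obtain ⟨hs1, hs2⟩ := h.cover.small X hX hXD
  obtain ⟨hs1', hs2'⟩ := h.cover'.small X hX' hXD
  have hXr := (mem_nonBases.1 hX).1
  have hYr := (mem_nonBases.1 hY).1
  have hle1 := h.le_r
  have hle2 := h.le_n
  obtain ⟨z, hz, e, he, rfl⟩ := hYZ.exists_eq
  rw [h.indep.mem_nonBases_insert_erase hY hz he] at hZ
  rw [h.indep'.mem_nonBases_insert_erase hY' hz he]
  have hex : ∀ {J : Finset (Fin n) → Prop}, #(fullRows J X) ≤ κ → ∃ x0 ∈ X, J (X.erase x0) := by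
    intro J hJ
    by_contra! hcon
    have : fullRows J X = X := by
      classical
      apply filter_true_of_mem
      exact hcon
    rw [this] at hJ
    omega
  obtain ⟨x0, hx0, hx0I⟩ := hex hs1
  obtain ⟨x1, hx1, hx1I⟩ := hex hs1'
  obtain ⟨x, hx, y, hy, rfl⟩ := hadj.exists_eq
  set Y := insert y (X.erase x) with hYdef
  have hXd := (mem_nonBases.1 hX).2
  have hXd' := (mem_nonBases.1 hX').2
  -- If Y has rank at most r - 2 for I', every neighbour of Y is a nonbasis of I'.
  by_cases hYfull' : fullRows I' Y = Y
  · left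
    rw [hYfull']
    exact hz
  have hYfullc' : fullCols r I' Y ≠ Yᶜ := fun hh => hYfull' (h.indep'.fullRows_eq_self hY' hh)
  have hexY : ∀ {J : Finset (Fin n) → Prop}, fullRows J Y ≠ Y → ∃ y0 ∈ Y, J (Y.erase y0) := by
    intro J hJ
    by_contra! hcon
    apply hJ
    classical
    apply filter_true_of_mem
    exact hcon
  -- Y comes from a full row or a full column of X. In the first case the full rows of Y are
  -- obtained from those of X, which both matroids share, so there are at most κ + 1 of them and the
  -- columns can be compared through D. The second case is dual.
  rcases (h.indep.mem_nonBases_insert_erase hX hx hy).1 hY with hxr | hyc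
  · have hR' := h.indep'.fullRows_insert_erase hXd' (hrows ▸ hxr) hy hx1 hx1I hYfull'
    have hcsub : fullCols r I Y ⊆ fullCols r I' Y := by
      refine fullCols_subset_fullCols h.indep' h.cover h.cover'.subset hY' ?_
      rw [hR']
      have h1 := card_insert_le y ((fullRows I' X).erase x)
      have h2 := card_erase_le (s := fullRows I' X) (a := x)
      omega
    rcases hZ with hzr | hec
    · by_cases hYfull : fullRows I Y = Y
      · right
        apply hcsub
        rw [h.indep.fullCols_eq_compl hY hYfull, mem_compl]
        exact he
      · left
        rw [h.indep.fullRows_insert_erase hXd hxr hy hx0 hx0I hYfull] at hzr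
        rw [hR', ← hrows]
        exact hzr
    · exact Or.inr (hcsub hec)
  · obtain ⟨y1, hy1, hy1I⟩ := hexY hYfull'
    have hC' := h.indep'.fullCols_insert_erase hXr hx (hcols ▸ hyc) hx1 hx1I hy1 hy1I
    have hrsub : fullRows I Y ⊆ fullRows I' Y := by
      refine fullRows_subset_fullRows h.indep' h.cover h.cover'.subset hY' ?_
      rw [hC']
      have h1 := card_insert_le x ((fullCols r I' X).erase y)
      have h2 := card_erase_le (s := fullCols r I' X) (a := y)
      omega
    rcases hZ with hzr | hec
    · exact Or.inl (hrsub hzr)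
    · by_cases hYfull : fullRows I Y = Y
      · left
        apply hrsub
        rw [hYfull]
        exact hz
      · right
        obtain ⟨y0, hy0, hy0I⟩ := hexY hYfull
        rw [h.indep.fullCols_insert_erase hXr hx hyc hx0 hx0I hy0 hy0I] at hec
        rw [hC', ← hcols]
        exact hec

end CommonCover

/-- `Q` indexes a clique of dependent sets. -/
def FullClique (r : ℕ) (I : Finset (Fin n) → Prop) (Q : Finset (Fin n)) : Prop :=
  (#Q + 1 = r ∧ ¬ I Q) ∨ (#Q = r + 1 ∧ ¬ Spans r I Q)

theorem FullClique.mem_cliqueIdx {Q : Finset (Fin n)} (hQ : FullClique r I Q) :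
    Q ∈ cliqueIdx n r := by
  rw [MatroidAsymptotics.mem_cliqueIdx]
  rcases hQ with h | h
  · exact Or.inl h.1
  · exact Or.inr h.1

theorem FullClique.subset (hI : IsIndepFamily r I) {Q : Finset (Fin n)} (hQ : FullClique r I Q) :
    clique r Q ⊆ nonBases r I := by
  intro Y hY
  rw [mem_clique] at hY
  rw [mem_nonBases]
  refine ⟨hY.1, fun hYI => ?_⟩
  rcases hQ with hQ | hQ
  · rcases hY.2 with h | h
    · have := card_le_card h
      omega
    · exact hQ.2 (hI.subset hYI h)
  · rcases hY.2 with h | h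
    · exact hQ.2 ⟨Y, h, hY.1, hYI⟩
    · have := card_le_card h
      omega

open Classical in
/-- A chosen member of the clique outside `D`. -/
noncomputable def rep (r : ℕ) (D : Finset (Finset (Fin n))) (Q : Finset (Fin n)) :
    Finset (Fin n) :=
  if h : (clique r Q \ D).Nonempty then h.choose else ∅

theorem rep_mem {Q : Finset (Fin n)} (h : (clique r Q \ D).Nonempty) :
    rep r D Q ∈ clique r Q ∧ rep r D Q ∉ D := by
  rw [rep, dif_pos h]
  exact mem_sdiff.1 h.choose_spec

/-- `U` together with `D` describes the dependent sets. -/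
structure Codes (r : ℕ) (I : Finset (Fin n) → Prop) (D U : Finset (Finset (Fin n))) : Prop where
  subset : U ⊆ nonBases r I
  notMem : ∀ X ∈ U, X ∉ D
  isolated : ∀ X ∈ nonBases r I, X ∉ D → (∀ Y ∈ nonBases r I, ¬ JAdj X Y) → X ∈ U
  dominated : ∀ Q, FullClique r I Q → (clique r Q \ D).Nonempty →
    ∃ X ∈ U, X = rep r D Q ∨ JAdj X (rep r D Q) ∨ ∃ Y ∈ D, JAdj X Y ∧ JAdj Y (rep r D Q)

/-- The adjacency is due to a full row or a full column, either of which is an entire clique of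
nonbases. -/
theorem exists_fullClique_of_adj (hI : IsIndepFamily r I) {X Y : Finset (Fin n)}
    (hX : X ∈ nonBases r I) (hY : Y ∈ nonBases r I) (hadj : JAdj X Y) :
    ∃ Q, FullClique r I Q ∧ X ∈ clique r Q := by
  obtain ⟨x, hx, y, hy, rfl⟩ := hadj.exists_eq
  have hXr := (mem_nonBases.1 hX).1
  rcases (hI.mem_nonBases_insert_erase hX hx hy).1 hY with h | h
  · refine ⟨X.erase x, Or.inl ⟨?_, (mem_fullRows.1 h).2⟩, mem_clique.2 ⟨hXr, ?_⟩⟩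
    · rw [card_erase_add_one hx, hXr]
    · exact Or.inr (erase_subset _ _)
  · refine ⟨insert y X, Or.inr ⟨?_, (mem_fullCols.1 h).2⟩, mem_clique.2 ⟨hXr, ?_⟩⟩
    · rw [card_insert_of_notMem hy, hXr]
    · exact Or.inl (subset_insert _ _)

/-- A nonbasis outside D is isolated, hence in U, or lies in a full clique whose representative is
equal to a member of U, adjacent to one, or at distance two from one through D. Membership passes
from that member to the representative and then along the clique. Applied both ways, it shows that D
and U determine the matroid. -/
theorem CommonCover.nonBases_subset (h : CommonCover r κ θ I I' D)
    {U : Finset (Finset (Fin n))} (hU : Codes r I D U) (hU' : U ⊆ nonBases r I') :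
    nonBases r I ⊆ nonBases r I' := by
  intro X hX
  by_cases hXD : X ∈ D
  · exact h.cover'.subset hXD
  by_cases hiso : ∀ Y ∈ nonBases r I, ¬ JAdj X Y
  · exact hU' (hU.isolated X hX hXD hiso)
  push Not at hiso
  obtain ⟨Y, hY, hadj⟩ := hiso
  obtain ⟨Q, hQ, hXQ⟩ := exists_fullClique_of_adj h.indep hX hY hadj
  have hne : (clique r Q \ D).Nonempty := ⟨X, mem_sdiff.2 ⟨hXQ, hXD⟩⟩
  obtain ⟨hrQ, hrD⟩ := rep_mem hne
  have hrep : rep r D Q ∈ nonBases r I := hQ.subset h.indep hrQ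
  have hrep' : rep r D Q ∈ nonBases r I' := by
    obtain ⟨W, hW, hcase⟩ := hU.dominated Q hQ hne
    have hWI := hU.subset hW
    have hWI' := hU' hW
    have hWD := hU.notMem W hW
    rcases hcase with heq | hadj' | ⟨Y', hY'D, hWY', hY'r⟩
    · rw [← heq]
      exact hWI'
    · exact h.mem_of_adj hWI hWI' hWD hadj' hrep
    · exact h.mem_of_adj_of_adj hWI hWI' hWD hWY' hY'D hY'r hrep
  by_cases hXr : X = rep r D Q
  · rw [hXr]
    exact hrep'
  · exact h.mem_of_adj hrep hrep' hrD
      (jAdj_of_mem_clique hQ.mem_cliqueIdx hrQ hXQ (Ne.symm hXr)) hX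

theorem card_clique_lower {Q : Finset (Fin n)} (hQ : #Q + 1 = r) : n + 1 ≤ #(clique r Q) + r := by
  have h : (Qᶜ).image (fun y => insert y Q) ⊆ clique r Q := by
    intro Y hY
    obtain ⟨y, hy, rfl⟩ := mem_image.1 hY
    rw [mem_compl] at hy
    rw [mem_clique, card_insert_of_notMem hy]
    exact ⟨hQ, Or.inr (subset_insert _ _)⟩
  have h2 := card_le_card h
  rw [card_image_of_injOn, card_compl, Fintype.card_fin] at h2
  · have := card_le_univ Q
    rw [Fintype.card_fin] at this
    omega
  · intro y hy y' hy' h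
    simp only [coe_compl, Set.mem_compl_iff, mem_coe] at hy hy'
    have h4 : y ∈ insert y' Q := by
      have : y ∈ insert y Q := mem_insert_self _ _
      simpa only [h] using this
    exact (mem_insert.1 h4).resolve_right hy

theorem card_clique_upper {Q : Finset (Fin n)} (hQ : #Q = r + 1) : r + 1 ≤ #(clique r Q) := by
  have h : Q.image (fun y => Q.erase y) ⊆ clique r Q := by
    intro Y hY
    obtain ⟨y, hy, rfl⟩ := mem_image.1 hY
    rw [mem_clique]
    have := card_erase_add_one hy
    exact ⟨by omega, Or.inl (erase_subset _ _)⟩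
  have h2 := card_le_card h
  rw [card_image_of_injOn] at h2
  · omega
  · intro y hy y' hy' h
    by_contra hne
    have h4 : y ∈ Q.erase y' := mem_erase.2 ⟨hne, hy⟩
    have h5 : y ∈ Q.erase y := by simpa only [h] using h4
    exact (mem_erase.1 h5).1 rfl

/-- A full clique has at least min(n - r, r) + 1 members, and all but fewer than θ of them lie in D.
-/
theorem FullClique.mem_heavyCliques (hc : IsGoodCover r κ θ I D) {Q : Finset (Fin n)}
    (hQ : FullClique r I Q) (h1 : n + 4 * θ ≤ 4 * (n - r)) (h2 : n + 4 * θ ≤ 4 * r) :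
    Q ∈ heavyCliques r D := by
  rw [MatroidAsymptotics.mem_heavyCliques]
  refine ⟨hQ.mem_cliqueIdx, ?_⟩
  have h3 := card_inter_add_card_sdiff (clique r Q) D
  rcases hQ with hQ | hQ
  · have h4 := hc.row Q hQ.1 hQ.2
    have h5 := card_clique_lower (n := n) hQ.1
    omega
  · have h4 := hc.col Q hQ.1 hQ.2
    have h5 := card_clique_upper (n := n) hQ.1
    omega

/-- U consists of the isolated uncovered nonbases and a largest set of representatives with no two
adjacent or sharing a neighbour in D. Independence gives stability and uniqueness of neighbours;
maximality gives domination. -/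
theorem exists_codes (hI : IsIndepFamily r I) (hc : IsGoodCover r κ θ I D)
    (h1 : n + 4 * θ ≤ 4 * (n - r)) (h2 : n + 4 * θ ≤ 4 * r) :
    ∃ U, Codes r I D U ∧ Admissible r D (rep r D) U := by
  classical
  set A : Finset (Finset (Fin n)) := (univ.filter fun Q : Finset (Fin n) =>
    FullClique r I Q ∧ (clique r Q \ D).Nonempty).image (rep r D) with hA
  set conf : Finset (Fin n) → Finset (Fin n) → Prop := fun X X' =>
    JAdj X X' ∨ ∃ Y ∈ D, JAdj X Y ∧ JAdj Y X' with hconf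
  have hAmem : ∀ X ∈ A, X ∈ nonBases r I ∧ X ∉ D ∧
      ∃ Q, FullClique r I Q ∧ X ∈ clique r Q ∧ X = rep r D Q := by
    intro X hX
    obtain ⟨Q, hQ, rfl⟩ := mem_image.1 hX
    rw [mem_filter] at hQ
    obtain ⟨h3, h4⟩ := rep_mem hQ.2.2
    exact ⟨hQ.2.1.subset hI h3, h4, Q, hQ.2.1, h3, rfl⟩
  have hconf_symm : ∀ X X', conf X X' → conf X' X := by
    rintro X X' (h | ⟨Y, hY, h3, h4⟩)
    · exact Or.inl h.symm
    · exact Or.inr ⟨Y, hY, h4.symm, h3.symm⟩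
  obtain ⟨U₁, hU₁, hmax⟩ := Finset.exists_max_image (indepSets conf A) card
    ⟨∅, mem_indepSets.2 ⟨empty_subset _, by intro a ha; simp at ha⟩⟩
  rw [mem_indepSets] at hU₁
  have hdom : ∀ X ∈ A, ∃ X' ∈ U₁, X' = X ∨ conf X' X := by
    intro X hX
    by_contra! hcon
    have hXU : X ∉ U₁ := fun h => (hcon X h).1 rfl
    have h3 : insert X U₁ ∈ indepSets conf A := by
      rw [mem_indepSets]
      refine ⟨insert_subset hX hU₁.1, ?_⟩
      intro a ha b hb hab hcab
      rw [mem_insert] at ha hb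
      rcases ha with rfl | ha <;> rcases hb with rfl | hb
      · exact hab rfl
      · exact (hcon b hb).2 (hconf_symm _ _ hcab)
      · exact (hcon a ha).2 hcab
      · exact hU₁.2 a ha b hb hab hcab
    have h4 := hmax _ h3
    rw [card_insert_of_notMem hXU] at h4
    omega
  set U₀ := (nonBases r I).filter fun X => X ∉ D ∧ ∀ Y ∈ nonBases r I, ¬ JAdj X Y with hU₀
  have hmem : ∀ X ∈ U₀ ∪ U₁, X ∈ nonBases r I ∧ X ∉ D := by
    intro X hX
    rw [mem_union] at hX
    rcases hX with hX | hX
    · rw [hU₀, mem_filter] at hX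
      exact ⟨hX.1, hX.2.1⟩
    · have := hAmem X (hU₁.1 hX)
      exact ⟨this.1, this.2.1⟩
  have hiso : ∀ X ∈ U₀, ∀ Y ∈ nonBases r I, ¬ JAdj X Y := by
    intro X hX
    exact (mem_filter.1 hX).2.2
  refine ⟨U₀ ∪ U₁, ⟨fun X hX => (hmem X hX).1, fun X hX => (hmem X hX).2, ?_, ?_⟩,
    ⟨fun X hX => nonBases_subset (hmem X hX).1, fun X hX => (hmem X hX).2, ?_, ?_, ?_⟩⟩
  · intro X hX hXD hXiso
    exact mem_union_left _ (mem_filter.2 ⟨hX, hXD, hXiso⟩)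
  · intro Q hQ hne
    have hQA : rep r D Q ∈ A := mem_image_of_mem _ (mem_filter.2 ⟨mem_univ _, hQ, hne⟩)
    obtain ⟨X', hX', hcase⟩ := hdom _ hQA
    exact ⟨X', mem_union_right _ hX', hcase⟩
  · intro X hX Y hY hadj
    rcases mem_union.1 hX with hX' | hX'
    · exact hiso X hX' Y (hmem Y hY).1 hadj
    rcases mem_union.1 hY with hY' | hY'
    · exact hiso Y hY' X (hmem X hX).1 hadj.symm
    · exact hU₁.2 X hX' Y hY' hadj.ne (Or.inl hadj)
  · intro Y hY X hX X' hX' hXY hX'Y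
    rcases mem_union.1 hX with h | h
    · exact absurd hXY (hiso X h Y (hc.subset hY))
    rcases mem_union.1 hX' with h' | h'
    · exact absurd hX'Y (hiso X' h' Y (hc.subset hY))
    by_contra hne
    exact hU₁.2 X h X' h' hne (Or.inr ⟨Y, hY, hXY, hX'Y.symm⟩)
  · rintro X hX ⟨Y, hY, hXY⟩
    rcases mem_union.1 hX with h | h
    · exact absurd hXY (hiso X h Y (hc.subset hY))
    · obtain ⟨-, -, Q, hQ, hXQ, hrep⟩ := hAmem X (hU₁.1 h)
      exact ⟨Q, hQ.mem_heavyCliques hc h1 h2, hXQ, hrep⟩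

end MatroidAsymptotics

/-! ### Covering the nonbases by sets of bounded rank -/

namespace MatroidAsymptotics
open Finset

variable {n r κ θ : ℕ} {I : Finset (Fin n) → Prop}

/-- Repeatedly add the member that takes a proportion β of what is left, until at most t remains. -/
theorem exists_greedy_cover {α ι : Type*} [DecidableEq α] [DecidableEq ι] (S : ι → Finset α)
    (G : ι → Prop) (B : Finset α) {β t : ℝ} (hβ1 : β ≤ 1)
    (h : ∀ A ⊆ B, t < #A → ∃ i, G i ∧ β * #A ≤ #(A ∩ S i)) (m : ℕ) :
    ∃ Z : Finset ι, #Z ≤ m ∧ (∀ i ∈ Z, G i) ∧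
      (#(B \ Z.biUnion S) : ℝ) ≤ max t ((1 - β) ^ m * #B) := by
  induction m with
  | zero => exact ⟨∅, by simp, by simp, by simp⟩
  | succ m ih =>
    obtain ⟨Z, hZm, hZG, hZ⟩ := ih
    by_cases ht : (#(B \ Z.biUnion S) : ℝ) ≤ t
    · exact ⟨Z, by omega, hZG, ht.trans (le_max_left _ _)⟩
    push Not at ht
    obtain ⟨i, hi, hiS⟩ := h _ sdiff_subset ht
    refine ⟨insert i Z, (card_insert_le _ _).trans (by omega), ?_, ?_⟩
    · intro j hj
      rcases mem_insert.1 hj with rfl | hj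
      · exact hi
      · exact hZG j hj
    · have h1 : B \ (insert i Z).biUnion S ⊆ (B \ Z.biUnion S) \ S i := by
        intro x hx
        simp only [mem_sdiff, mem_biUnion, mem_insert, not_exists, not_and] at hx ⊢
        exact ⟨⟨hx.1, fun j hj => hx.2 j (Or.inr hj)⟩, hx.2 i (Or.inl rfl)⟩
      have h2 : (#(B \ (insert i Z).biUnion S) : ℝ) ≤ #((B \ Z.biUnion S) \ S i) := by
        exact_mod_cast card_le_card h1
      have h3 : (#((B \ Z.biUnion S) ∩ S i) : ℝ) + #((B \ Z.biUnion S) \ S i) =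
          #(B \ Z.biUnion S) := by
        exact_mod_cast card_inter_add_card_sdiff _ _
      have h4 : (#(B \ Z.biUnion S) : ℝ) ≤ (1 - β) ^ m * #B := by
        rcases le_max_iff.1 hZ with h5 | h5
        · linarith
        · exact h5
      refine le_trans ?_ (le_max_right _ _)
      calc (#(B \ (insert i Z).biUnion S) : ℝ) ≤ (1 - β) * #(B \ Z.biUnion S) := by linarith
        _ ≤ (1 - β) * ((1 - β) ^ m * #B) := mul_le_mul_of_nonneg_left h4 (by linarith)
        _ = _ := by ring

/-- The set `p.1` has rank at most `p.2`. -/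
def IsFlatPair (I : Finset (Fin n) → Prop) (p : Finset (Fin n) × Fin (n + 1)) : Prop :=
  ∀ J ⊆ p.1, I J → #J ≤ p.2

/-- The `r`-sets whose dependence is witnessed by a set of rank at most `p.2`. -/
def coveredBy (r : ℕ) (p : Finset (Fin n) × Fin (n + 1)) : Finset (Finset (Fin n)) :=
  (layer n r).filter fun X => (p.2 : ℕ) < #(X ∩ p.1)

theorem mem_coveredBy {p : Finset (Fin n) × Fin (n + 1)} {X : Finset (Fin n)} :
    X ∈ coveredBy r p ↔ #X = r ∧ (p.2 : ℕ) < #(X ∩ p.1) := by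
  simp [coveredBy]

theorem IsFlatPair.coveredBy_subset (hI : IsIndepFamily r I) {p : Finset (Fin n) × Fin (n + 1)}
    (hp : IsFlatPair I p) : coveredBy r p ⊆ nonBases r I := by
  intro X hX
  rw [mem_coveredBy] at hX
  refine mem_nonBases.2 ⟨hX.1, fun h => ?_⟩
  have := hp _ inter_subset_right (hI.subset h (inter_subset_left (s₂ := p.1)))
  omega

/-- Z has rank at most r - 2, and r-sets containing it meet it in r - 1 elements. -/
theorem exists_flatPair_of_card {Z : Finset (Fin n)} (hr : 2 ≤ r)
    (hZ : #Z + 1 = r) (hZI : ¬ I Z) :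
    ∃ p, IsFlatPair I p ∧ clique r Z ⊆ coveredBy r p := by
  have hZn := card_le_univ Z
  rw [Fintype.card_fin] at hZn
  refine ⟨(Z, ⟨r - 2, by omega⟩), ?_, ?_⟩
  · intro J hJ hJI
    have hne : J ≠ Z := fun h => hZI (h ▸ hJI)
    have : #J < #Z := card_lt_card (ssubset_of_subset_of_ne hJ hne)
    simp only
    omega
  · intro Y hY
    rw [mem_clique] at hY
    rw [mem_coveredBy]
    refine ⟨hY.1, ?_⟩
    rcases hY.2 with h | h
    · have := card_le_card h
      omega
    · rw [inter_eq_right.2 h]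
      simp only
      omega

theorem exists_flatPair_of_not_spans (hI : IsIndepFamily r I) {V : Finset (Fin n)} (hr : 2 ≤ r)
    (hV : #V = r + 1) (hVI : ¬ Spans r I V) :
    ∃ p, IsFlatPair I p ∧ clique r V ⊆ coveredBy r p := by
  have hVn := card_le_univ V
  rw [Fintype.card_fin] at hVn
  refine ⟨(V, ⟨r - 1, by omega⟩), ?_, ?_⟩
  · intro J hJ hJI
    have h1 := hI.card_le hJI
    have h2 : #J ≠ r := fun h => hVI ⟨J, hJ, h, hJI⟩
    simp only
    omega
  · intro Y hY
    rw [mem_clique] at hY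
    rw [mem_coveredBy]
    refine ⟨hY.1, ?_⟩
    rcases hY.2 with h | h
    · rw [inter_eq_left.2 h]
      simp only
      omega
    · have := card_le_card h
      omega

/-- Two pairs cover all the dependent neighbours of a dependent set. -/
theorem exists_local_cover (hI : IsIndepFamily r I) (hr : 2 ≤ r) {X : Finset (Fin n)}
    (hX : X ∈ nonBases r I) :
    ∃ p₁ p₂, IsFlatPair I p₁ ∧ IsFlatPair I p₂ ∧ ∀ Y ∈ nonBases r I, Y = X ∨ JAdj X Y →
      Y ∈ coveredBy r p₁ ∨ Y ∈ coveredBy r p₂ := by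
  obtain ⟨hXr, hXI⟩ := mem_nonBases.1 hX
  have hXn := card_le_univ X
  rw [Fintype.card_fin] at hXn
  by_cases hex : ∃ x0 ∈ X, I (X.erase x0)
  · obtain ⟨x0, hx0, hx0I⟩ := hex
    have hC := hI.not_indep_sdiff_fullRows hXI hx0 hx0I
    have hCpos : 0 < #(X \ fullRows I X) := by
      rw [card_pos, nonempty_iff_ne_empty]
      intro h
      rw [h] at hC
      exact hC (hI.subset hx0I (empty_subset _))
    have hCle : #(X \ fullRows I X) ≤ #X := card_le_card sdiff_subset
    have h2 : #(X.erase x0) + 1 = #X := card_erase_add_one hx0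
    -- X has rank r - 1: its circuit witnesses the neighbours in full rows, and the hyperplane
    -- formed with the full columns witnesses those in full columns.
    refine ⟨(X \ fullRows I X, ⟨#(X \ fullRows I X) - 1, by omega⟩),
      (X ∪ fullCols r I X, ⟨r - 1, by omega⟩), ?_, ?_, ?_⟩
    · intro J hJ hJI
      have hne : J ≠ X \ fullRows I X := fun h => hC (h ▸ hJI)
      have : #J < #(X \ fullRows I X) := card_lt_card (ssubset_of_subset_of_ne hJ hne)
      simp only
      omega
    · intro J hJ hJI
      have h1 := hI.card_le hJI
      have h3 : #J ≠ r := by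
        intro hJr
        obtain ⟨e, he, he', heI⟩ := hI.aug hx0I hJI (by omega)
        rcases mem_union.1 (hJ he) with h | h
        · have h4 : e = x0 := by
            by_contra h5
            exact he' (mem_erase.2 ⟨h5, h⟩)
          subst h4
          rw [insert_erase hx0] at heI
          exact hXI heI
        · refine (mem_fullCols.1 h).2 ⟨_, insert_subset_insert _ (erase_subset x0 X), ?_, heI⟩
          rw [card_insert_of_notMem he']
          omega
      simp only
      omega
    · intro Y hY hYX
      have hYr := (mem_nonBases.1 hY).1
      have key1 : X \ fullRows I X ⊆ Y → Y ∈ coveredBy r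
          ((X \ fullRows I X, ⟨#(X \ fullRows I X) - 1, by omega⟩) :
            Finset (Fin n) × Fin (n + 1)) := by
        intro h
        rw [mem_coveredBy, inter_eq_right.2 h]
        exact ⟨hYr, by simp only; omega⟩
      have key2 : Y ⊆ X ∪ fullCols r I X → Y ∈ coveredBy r
          ((X ∪ fullCols r I X, ⟨r - 1, by omega⟩) : Finset (Fin n) × Fin (n + 1)) := by
        intro h
        rw [mem_coveredBy, inter_eq_left.2 h]
        exact ⟨hYr, by simp only; omega⟩
      rcases hYX with rfl | hadj
      · exact Or.inl (key1 sdiff_subset)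
      · obtain ⟨x, hx, y, hy, rfl⟩ := hadj.exists_eq
        rcases (hI.mem_nonBases_insert_erase hX hx hy).1 hY with h | h
        · left
          apply key1
          intro c hc
          rw [mem_sdiff] at hc
          exact mem_insert_of_mem (mem_erase.2 ⟨fun h' => hc.2 (h' ▸ h), hc.1⟩)
        · right
          apply key2
          intro c hc
          rcases mem_insert.1 hc with rfl | hc
          · exact mem_union_right _ h
          · exact mem_union_left _ (mem_of_mem_erase hc)
  -- Now X has rank at most r - 2, and X with this bound witnesses every neighbour, each meeting X
  -- in r - 1 elements.
  · push Not at hex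
    have hp : IsFlatPair I ((X, ⟨r - 2, by omega⟩) : Finset (Fin n) × Fin (n + 1)) := by
      intro J hJ hJI
      have hne : J ≠ X := fun h => hXI (h ▸ hJI)
      obtain ⟨x, hx, hxJ⟩ := exists_of_ssubset (ssubset_of_subset_of_ne hJ hne)
      have h1 : J ⊆ X.erase x := subset_erase.2 ⟨hJ, hxJ⟩
      have hne2 : J ≠ X.erase x := fun h => hex x hx (h ▸ hJI)
      have h3 := card_lt_card (ssubset_of_subset_of_ne h1 hne2)
      have h2 : #(X.erase x) + 1 = #X := card_erase_add_one hx
      simp only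
      omega
    refine ⟨_, _, hp, hp, fun Y hY hYX => Or.inl ?_⟩
    rw [mem_coveredBy]
    refine ⟨(mem_nonBases.1 hY).1, ?_⟩
    rcases hYX with rfl | hadj
    · rw [inter_self]
      simp only
      omega
    · have h1 := hadj.2
      have h2 := card_inter_add_card_sdiff X Y
      rw [inter_comm]
      simp only
      omega

/-- Of the two pairs that cover the nonbases at or next to X, the better one takes half of T. -/
theorem exists_half_cover (hI : IsIndepFamily r I) (hr : 2 ≤ r) {X : Finset (Fin n)}
    (hX : X ∈ nonBases r I) {A T : Finset (Finset (Fin n))} (hTA : T ⊆ A)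
    (hT : ∀ Y ∈ T, Y ∈ nonBases r I ∧ (Y = X ∨ JAdj X Y)) {c : ℝ} (hc : 2 * c ≤ #T) :
    ∃ p, IsFlatPair I p ∧ c ≤ #(A ∩ coveredBy r p) := by
  obtain ⟨p₁, p₂, hp₁, hp₂, h⟩ := exists_local_cover hI hr hX
  have h1 : T ⊆ (A ∩ coveredBy r p₁) ∪ (A ∩ coveredBy r p₂) := by
    intro Y hY
    obtain ⟨h2, h3⟩ := hT Y hY
    rw [mem_union, mem_inter, mem_inter]
    rcases h Y h2 h3 with h4 | h4
    · exact Or.inl ⟨hTA hY, h4⟩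
    · exact Or.inr ⟨hTA hY, h4⟩
  have h2 : (#T : ℝ) ≤ #(A ∩ coveredBy r p₁) + #(A ∩ coveredBy r p₂) := by
    exact_mod_cast (card_le_card h1).trans (card_union_le _ _)
  by_cases h3 : c ≤ #(A ∩ coveredBy r p₁)
  · exact ⟨p₁, hp₁, h3⟩
  · exact ⟨p₂, hp₂, by linarith⟩

theorem card_mul_card_le {X R C : Finset (Fin n)} {T : Finset (Finset (Fin n))} (hR : R ⊆ X)
    (hC : C ⊆ Xᶜ) (h : ∀ x ∈ R, ∀ y ∈ C, insert y (X.erase x) ∈ T) : #R * #C ≤ #T := by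
  rw [← card_product]
  apply card_le_card_of_injOn (fun p => insert p.2 (X.erase p.1))
  · intro p hp
    simp only [coe_product, Set.mem_prod, mem_coe] at hp
    exact h _ hp.1 _ hp.2
  · rintro ⟨x, y⟩ hp ⟨x', y'⟩ hp' heq
    simp only [coe_product, Set.mem_prod, mem_coe] at hp hp' heq
    have hx := hR hp.1
    have hx' := hR hp'.1
    have hy := mem_compl.1 (hC hp.2)
    have hy' := mem_compl.1 (hC hp'.2)
    have h1 : y ∈ insert y' (X.erase x') := by
      rw [← heq]
      exact mem_insert_self _ _
    have h2 : y = y' := (mem_insert.1 h1).resolve_right fun h => hy (mem_of_mem_erase h)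
    have h3 : x = x' := by
      by_contra hne
      have h4 : x ∈ insert y (X.erase x) := by
        rw [heq]
        exact mem_insert_of_mem (mem_erase.2 ⟨hne, hx⟩)
      rcases mem_insert.1 h4 with h5 | h5
      · exact hy (h5 ▸ hx)
      · exact (mem_erase.1 h5).1 rfl
    rw [h2, h3]

open Classical in
-- In middle rank a full row contributes n - r ≥ n/3 adjacent nonbases and a full column r ≥ n/3,
-- all distinct within either kind.
theorem card_nonBases_adj_lower (hI : IsIndepFamily r I) (hn1 : n ≤ 3 * r) (hn2 : 3 * r ≤ 2 * n)
    {X : Finset (Fin n)} (hX : X ∈ nonBases r I)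
    (hbig : κ < #(fullRows I X) ∨ κ < #(fullCols r I X)) :
    κ * n ≤ 3 * #((nonBases r I).filter fun Y => JAdj X Y) := by
  have hXr := (mem_nonBases.1 hX).1
  have hc : #Xᶜ = n - r := by rw [card_compl, Fintype.card_fin, hXr]
  rcases hbig with h | h
  · have h1 : #(fullRows I X) * #Xᶜ ≤ #((nonBases r I).filter fun Y => JAdj X Y) := by
      apply card_mul_card_le (X := X) (fun x hx => (mem_fullRows.1 hx).1) Subset.rfl
      intro x hx y hy
      have hx' := (mem_fullRows.1 hx).1
      rw [mem_compl] at hy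
      exact mem_filter.2 ⟨(hI.mem_nonBases_insert_erase hX hx' hy).2 (Or.inl hx),
        jAdj_insert_erase hx' hy⟩
    have h2 : κ * n ≤ #(fullRows I X) * (3 * #Xᶜ) := Nat.mul_le_mul h.le (by omega)
    nlinarith
  · have h1 : #X * #(fullCols r I X) ≤ #((nonBases r I).filter fun Y => JAdj X Y) := by
      apply card_mul_card_le (X := X) Subset.rfl (fun y hy => mem_compl.2 (mem_fullCols.1 hy).1)
      intro x hx y hy
      have hy' := (mem_fullCols.1 hy).1
      exact mem_filter.2 ⟨(hI.mem_nonBases_insert_erase hX hx hy').2 (Or.inr hy),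
        jAdj_insert_erase hx hy'⟩
    have h2 : κ * n ≤ #(fullCols r I X) * (3 * #X) := Nat.mul_le_mul h.le (by omega)
    nlinarith

open Classical in
/-- Half of a set with large degrees into the dependent sets is covered by averaging. -/
theorem exists_flatPair_of_degree (hI : IsIndepFamily r I) (hr : 2 ≤ r)
    {A : Finset (Finset (Fin n))} (hA : A ⊆ nonBases r I) (hne : A.Nonempty) {d : ℝ}
    (hd : ∀ X ∈ A, d ≤ #((nonBases r I).filter fun Y => JAdj X Y)) (hd0 : 0 ≤ d) :
    ∃ p, IsFlatPair I p ∧ d / (2 * n.choose r) * #A ≤ #(A ∩ coveredBy r p) := by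
  have hKN : (#(nonBases r I) : ℝ) ≤ n.choose r := by
    rw [← card_layer n r]
    exact_mod_cast card_le_card nonBases_subset
  have hKne : (nonBases r I).Nonempty := hne.mono hA
  have hK0 : (0 : ℝ) < #(nonBases r I) := by exact_mod_cast hKne.card_pos
  -- Averaging over the at most C(n,r) nonbases: some Y is adjacent to a proportion d/C(n,r) of A.
  obtain ⟨Y, hY, hYA⟩ : ∃ Y ∈ nonBases r I,
      d / n.choose r * #A ≤ #(A.filter fun X => JAdj X Y) := by
    by_contra! hcon
    have h1 := sum_lt_sum_of_nonempty hKne hcon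
    have h2 : ∑ X ∈ A, #((nonBases r I).filter fun Y => JAdj X Y) =
        ∑ Y ∈ nonBases r I, #(A.filter fun X => JAdj X Y) :=
      sum_card_bipartiteAbove_eq_sum_card_bipartiteBelow _
    have h3 : (∑ X ∈ A, (#((nonBases r I).filter fun Y => JAdj X Y) : ℝ)) =
        ∑ Y ∈ nonBases r I, (#(A.filter fun X => JAdj X Y) : ℝ) := by exact_mod_cast h2
    have h4 := sum_le_sum hd
    rw [sum_const, nsmul_eq_mul] at h1 h4
    have h5 : (#(nonBases r I) : ℝ) * (d / n.choose r * #A) ≤ #A * d := by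
      have h6 : (#(nonBases r I) : ℝ) / n.choose r ≤ 1 := by
        rw [div_le_one (by linarith)]
        exact hKN
      calc (#(nonBases r I) : ℝ) * (d / n.choose r * #A) =
          (#(nonBases r I) : ℝ) / n.choose r * (#A * d) := by ring
        _ ≤ 1 * (#A * d) := mul_le_mul_of_nonneg_right h6 (by positivity)
        _ = _ := one_mul _
    linarith
  refine exists_half_cover hI hr hY (filter_subset (fun X => JAdj X Y) A) ?_ ?_
  · intro X hX
    rw [mem_filter] at hX
    exact ⟨hA hX.1, Or.inr hX.2.symm⟩
  · calc 2 * (d / (2 * n.choose r) * #A) = d / n.choose r * #A := by ring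
      _ ≤ _ := hYA

open Classical in
-- Rewrite `exists_large_degree` by means of r · C(n,r) = (n - r + 1) · C(n,r-1) and r(n - r + 1) ≥
-- n²/9. Above size 6C(n,r)/n the diagonal term takes at most half, whence 18.
theorem exists_degree_ge (hn1 : n ≤ 3 * r) (hn2 : 3 * r ≤ 2 * n) (hr : 0 < r)
    {A : Finset (Finset (Fin n))} (hA : A ⊆ layer n r) (hbig : 6 * (n.choose r : ℝ) / n < #A) :
    ∃ X ∈ A, (n : ℝ) ^ 2 / (18 * n.choose r) * #A ≤ #(A.filter fun Y => JAdj X Y) := by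
  obtain ⟨s, rfl⟩ : ∃ s, r = s + 1 := ⟨r - 1, by omega⟩
  have hA0 : (0 : ℝ) < #A := lt_of_le_of_lt (by positivity) hbig
  have hne : A.Nonempty := card_pos.1 (by exact_mod_cast hA0)
  obtain ⟨X, hX, h⟩ := exists_large_degree A hA hne
  have hN : 0 < n.choose (s + 1) := Nat.choose_pos (by omega)
  have hN' : (0 : ℝ) < n.choose (s + 1) := by exact_mod_cast hN
  have hn0 : (0 : ℝ) < n := by exact_mod_cast (by omega : 0 < n)
  have hch : (n.choose (s + 1) : ℝ) * (s + 1) = n.choose s * (n - s) := by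
    have := Nat.choose_succ_right_eq n s
    have h2 : ((n - s : ℕ) : ℝ) = n - s := by rw [Nat.cast_sub (by omega)]
    rw [← h2]
    exact_mod_cast this
  have hs3 : (n : ℝ) ≤ 3 * (s + 1) := by exact_mod_cast hn1
  have hns : (n : ℝ) ≤ 3 * (n - s) := by
    have : (3 * (s + 1) : ℝ) ≤ 2 * n := by exact_mod_cast hn2
    linarith
  set d : ℝ := ((#(A.filter fun Y => JAdj X Y) : ℕ) : ℝ) with hd
  have h1 : (#A : ℝ) * ((s + 1) * (n - s)) ≤ n.choose (s + 1) * ((s + 1) + d) := by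
    have h2 := mul_le_mul_of_nonneg_right h (by linarith : (0 : ℝ) ≤ n - s)
    have h3 : (s + 1 : ℝ) * (#A * ((s + 1) * (n - s))) ≤
        (s + 1) * (n.choose (s + 1) * ((s + 1) + d)) := by
      calc _ = (#A : ℝ) * (s + 1) ^ 2 * (n - s) := by ring
        _ ≤ n.choose s * ((s + 1) + d) * (n - s) := h2
        _ = (n.choose s * (n - s)) * ((s + 1) + d) := by ring
        _ = _ := by rw [← hch]; ring
    exact le_of_mul_le_mul_left h3 (by positivity)
  have h4 : 2 * (n.choose (s + 1) : ℝ) * (s + 1) ≤ #A * ((s + 1) * (n - s)) := by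
    rw [div_lt_iff₀ hn0] at hbig
    have h5 : (2 : ℝ) * n.choose (s + 1) ≤ #A * (n - s) := by
      have := mul_le_mul_of_nonneg_left hns hA0.le
      linarith
    calc _ ≤ (#A : ℝ) * (n - s) * (s + 1) := mul_le_mul_of_nonneg_right h5 (by positivity)
      _ = _ := by ring
  have h6 : (n : ℝ) ^ 2 / 9 ≤ (s + 1) * (n - s) := by
    have := mul_le_mul hs3 hns hn0.le (by positivity)
    linarith
  have h7 : (#A : ℝ) * (n ^ 2 / 9) ≤ #A * ((s + 1) * (n - s)) :=
    mul_le_mul_of_nonneg_left h6 hA0.le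
  have h8 : (#A : ℝ) * (n ^ 2 / 9) ≤ 2 * n.choose (s + 1) * d := by linarith
  refine ⟨X, hX, ?_⟩
  rw [← hd]
  have h9 : (n : ℝ) ^ 2 / (18 * n.choose (s + 1)) * #A =
      #A * (n ^ 2 / 9) / (2 * n.choose (s + 1)) := by
    field_simp; norm_num
  rw [h9, div_le_iff₀ (by positivity)]
  linarith

theorem exists_flatPair_of_card_gt (hI : IsIndepFamily r I) (hr : 2 ≤ r) (hn1 : n ≤ 3 * r)
    (hn2 : 3 * r ≤ 2 * n) {A : Finset (Finset (Fin n))} (hA : A ⊆ nonBases r I)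
    (hbig : 6 * (n.choose r : ℝ) / n < #A) :
    ∃ p, IsFlatPair I p ∧ (n : ℝ) ^ 2 / (36 * n.choose r) * #A ≤ #(A ∩ coveredBy r p) := by
  classical
  obtain ⟨X, hX, h⟩ := exists_degree_ge hn1 hn2 (by omega) (hA.trans nonBases_subset) hbig
  refine exists_half_cover hI hr (hA hX) (filter_subset (fun Y => JAdj X Y) A) ?_ ?_
  · intro Y hY
    rw [mem_filter] at hY
    exact ⟨hA hY.1, Or.inr hY.2⟩
  · refine le_trans (le_of_eq ?_) h
    rw [show (36 : ℝ) * n.choose r = 2 * (18 * n.choose r) by ring, ← div_div,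
      div_right_comm]
    ring

/-- The sets covered by a family of pairs. -/
def coveredByAll (r : ℕ) (P : Finset (Finset (Fin n) × Fin (n + 1))) :
    Finset (Finset (Fin n)) :=
  P.biUnion (coveredBy r)

theorem coveredByAll_mono {P P' : Finset (Finset (Fin n) × Fin (n + 1))} (h : P ⊆ P') :
    coveredByAll r P ⊆ coveredByAll r P' := biUnion_subset_biUnion_of_subset_left _ h

theorem exists_isolated_pairs (hI : IsIndepFamily r I) (hr : 2 ≤ r)
    {A : Finset (Finset (Fin n))} (hA : A ⊆ nonBases r I) :
    ∃ P : Finset (Finset (Fin n) × Fin (n + 1)), #P ≤ #A ∧ (∀ p ∈ P, IsFlatPair I p) ∧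
      A ⊆ coveredByAll r P := by
  classical
  have h : ∀ X : A, ∃ p, IsFlatPair I p ∧ (X : Finset (Fin n)) ∈ coveredBy r p := by
    intro X
    obtain ⟨p₁, p₂, hp₁, hp₂, h⟩ := exists_local_cover hI hr (hA X.2)
    rcases h X (hA X.2) (Or.inl rfl) with h | h
    · exact ⟨p₁, hp₁, h⟩
    · exact ⟨p₂, hp₂, h⟩
  choose f hf hfX using h
  refine ⟨univ.image f, card_image_le.trans (by simp), ?_, ?_⟩
  · intro p hp
    obtain ⟨X, -, rfl⟩ := mem_image.1 hp
    exact hf X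
  · intro X hX
    exact mem_biUnion.2 ⟨f ⟨X, hX⟩, mem_image_of_mem _ (mem_univ _), hfX ⟨X, hX⟩⟩

/-- Take the largest P with room for θ newly covered sets per pair. A further pair covering θ
uncovered sets could be added to it. -/
theorem exists_saturated_pairs (I : Finset (Fin n) → Prop) (K : Finset (Finset (Fin n)))
    (hθ : 0 < θ) :
    ∃ P : Finset (Finset (Fin n) × Fin (n + 1)), θ * #P ≤ #K ∧ (∀ p ∈ P, IsFlatPair I p) ∧
      ∀ p, IsFlatPair I p → #((K \ coveredByAll r P) ∩ coveredBy r p) < θ := by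
  classical
  obtain ⟨P, hP, hmax⟩ := exists_max_image (univ.filter fun P :
    Finset (Finset (Fin n) × Fin (n + 1)) => (∀ p ∈ P, IsFlatPair I p) ∧
      θ * #P + #(K \ coveredByAll r P) ≤ #K) card ⟨∅, by simp [coveredByAll]⟩
  rw [mem_filter] at hP
  refine ⟨P, by omega, hP.2.1, fun p hp => ?_⟩
  by_contra! hcon
  have hpP : p ∉ P := by
    intro h
    have : (K \ coveredByAll r P) ∩ coveredBy r p = ∅ := by
      ext X
      simp only [mem_inter, mem_sdiff, coveredByAll, mem_biUnion, notMem_empty, iff_false]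
      rintro ⟨⟨-, h1⟩, h2⟩
      exact h1 ⟨p, h, h2⟩
    rw [this, card_empty] at hcon
    omega
  have h1 := hmax (insert p P) (by
    rw [mem_filter]
    refine ⟨mem_univ _, ?_, ?_⟩
    · intro j hj
      rcases mem_insert.1 hj with rfl | hj
      · exact hp
      · exact hP.2.1 j hj
    · have h2 : K \ coveredByAll r (insert p P) = (K \ coveredByAll r P) \ coveredBy r p := by
        ext X
        simp only [mem_sdiff, coveredByAll, biUnion_insert, mem_union]
        tauto
      have h3 := card_inter_add_card_sdiff (K \ coveredByAll r P) (coveredBy r p)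
      rw [h2, card_insert_of_notMem hpP, Nat.mul_add]
      omega)
  rw [card_insert_of_notMem hpP] at h1
  omega

theorem coveredByAll_subset (hI : IsIndepFamily r I)
    {P : Finset (Finset (Fin n) × Fin (n + 1))} (hP : ∀ p ∈ P, IsFlatPair I p) :
    coveredByAll r P ⊆ nonBases r I :=
  biUnion_subset.2 fun p hp => (hP p hp).coveredBy_subset hI

/-- The dependent sets have a good cover with few pairs. -/
theorem exists_goodCover (hI : IsIndepFamily r I) (hr : 2 ≤ r) (hn1 : n ≤ 3 * r)
    (hn2 : 3 * r ≤ 2 * n) (hθ : 0 < θ) {m₀ m₁ : ℕ}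
    (hβ₀ : κ * (n : ℝ) ≤ 6 * n.choose r) (hβ₁ : (n : ℝ) ^ 2 ≤ 36 * n.choose r)
    (hm₀ : (1 - κ * (n : ℝ) / (6 * n.choose r)) ^ m₀ ≤ 1 / (n : ℝ) ^ 2)
    (hm₁ : (1 - (n : ℝ) ^ 2 / (36 * n.choose r)) ^ m₁ ≤ 6 / n) :
    ∃ P : Finset (Finset (Fin n) × Fin (n + 1)), (∀ p ∈ P, IsFlatPair I p) ∧
      IsGoodCover r κ θ I (coveredByAll r P) ∧
      (#(nonBases r I \ coveredByAll r P) : ℝ) ≤ 6 * n.choose r / n ∧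
      (#P : ℝ) ≤ m₀ + m₁ + n.choose r / (n : ℝ) ^ 2 + 6 * n.choose r / (n * θ) := by
  classical
  have hN : 0 < n.choose r := Nat.choose_pos (by omega)
  have hN' : (0 : ℝ) < n.choose r := by exact_mod_cast hN
  have hn0 : (0 : ℝ) < n := by exact_mod_cast (by omega : 0 < n)
  have hKN : (#(nonBases r I) : ℝ) ≤ n.choose r := by
    rw [← card_layer n r]
    exact_mod_cast card_le_card nonBases_subset
  set B := (nonBases r I).filter fun X => κ < #(fullRows I X) ∨ κ < #(fullCols r I X) with hB
  have hBK : B ⊆ nonBases r I := filter_subset _ _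
  -- Four families with different tasks: P₀ greedily covers nearly all of B, the nonbases with many
  -- full rows or columns, and P₂ covers the rest of B one by one; P₁ covers all nonbases but
  -- 6C(n,r)/n; P₃ saturates what P₁ leaves, so that no full clique keeps θ uncovered members.
  obtain ⟨P₀, hP₀c, hP₀, hP₀r⟩ := exists_greedy_cover (coveredBy r) (IsFlatPair I) B
    (β := κ * (n : ℝ) / (6 * n.choose r)) (t := 0) (by rw [div_le_one (by positivity)]; exact hβ₀)
    (by
      intro A hA hA0
      obtain ⟨p, hp, hpc⟩ := exists_flatPair_of_degree (d := κ * (n : ℝ) / 3) hI hr (hA.trans hBK)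
        (card_pos.1 (by exact_mod_cast hA0))
        (by
          intro X hX
          obtain ⟨hXK, hXb⟩ := mem_filter.1 (hA hX)
          have := card_nonBases_adj_lower hI hn1 hn2 hXK hXb
          rw [div_le_iff₀ (by norm_num), mul_comm _ (3 : ℝ)]
          exact_mod_cast this) (by positivity)
      refine ⟨p, hp, le_trans (le_of_eq ?_) hpc⟩
      rw [div_div, ← mul_assoc]
      norm_num) m₀
  obtain ⟨P₁, hP₁c, hP₁, hP₁r⟩ := exists_greedy_cover (coveredBy r) (IsFlatPair I)
    (nonBases r I) (β := (n : ℝ) ^ 2 / (36 * n.choose r)) (t := 6 * n.choose r / n)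
    (by rw [div_le_one (by positivity)]; exact hβ₁)
    (fun A hA hAb => exists_flatPair_of_card_gt hI hr hn1 hn2 hA hAb) m₁
  obtain ⟨P₂, hP₂c, hP₂, hP₂r⟩ := exists_isolated_pairs hI hr
    (A := B \ coveredByAll r P₀) (sdiff_subset.trans hBK)
  obtain ⟨P₃, hP₃c, hP₃, hP₃r⟩ := exists_saturated_pairs (r := r) I
    (nonBases r I \ coveredByAll r P₁) hθ
  have hr0 : (#(B \ coveredByAll r P₀) : ℝ) ≤ n.choose r / (n : ℝ) ^ 2 := by
    have hpos : 0 ≤ (1 - κ * (n : ℝ) / (6 * n.choose r)) := by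
      rw [sub_nonneg, div_le_one (by positivity)]
      exact hβ₀
    rw [max_eq_right (by positivity)] at hP₀r
    calc _ ≤ _ := hP₀r
      _ ≤ 1 / (n : ℝ) ^ 2 * n.choose r := by
        refine mul_le_mul hm₀ (le_trans ?_ hKN) (by positivity) (by positivity)
        exact_mod_cast card_le_card hBK
      _ = _ := by ring
  have hr1 : (#(nonBases r I \ coveredByAll r P₁) : ℝ) ≤ 6 * n.choose r / n := by
    refine hP₁r.trans (max_le le_rfl ?_)
    calc _ ≤ 6 / (n : ℝ) * n.choose r :=
          mul_le_mul hm₁ hKN (by positivity) (by positivity)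
      _ = _ := by ring
  set P := P₀ ∪ P₁ ∪ P₂ ∪ P₃ with hP
  have hs0 : P₀ ⊆ P := subset_union_left.trans (subset_union_left.trans subset_union_left)
  have hs1 : P₁ ⊆ P := subset_union_right.trans (subset_union_left.trans subset_union_left)
  have hs2 : P₂ ⊆ P := subset_union_right.trans subset_union_left
  have hs3 : P₃ ⊆ P := subset_union_right
  have hPI : ∀ p ∈ P, IsFlatPair I p := by
    intro p hp
    simp only [hP, mem_union] at hp
    rcases hp with ((h | h) | h) | h
    · exact hP₀ p h
    · exact hP₁ p h
    · exact hP₂ p h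
    · exact hP₃ p h
  have hsat : ∀ Q, FullClique r I Q → (∃ p, IsFlatPair I p ∧ clique r Q ⊆ coveredBy r p) →
      #(clique r Q \ coveredByAll r P) < θ := by
    rintro Q hQ ⟨p, hp, hQp⟩
    refine lt_of_le_of_lt (card_le_card ?_) (hP₃r p hp)
    intro X hX
    rw [mem_sdiff] at hX
    rw [mem_inter, mem_sdiff, mem_sdiff]
    exact ⟨⟨⟨hQ.subset hI hX.1, fun h => hX.2 (coveredByAll_mono hs1 h)⟩,
      fun h => hX.2 (coveredByAll_mono hs3 h)⟩, hQp hX.1⟩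
  refine ⟨P, hPI, ⟨coveredByAll_subset hI hPI, ?_, ?_, ?_⟩, ?_, ?_⟩
  · intro X hX hXD
    by_contra hcon
    have hXB : X ∈ B := mem_filter.2 ⟨hX, by omega⟩
    by_cases h0 : X ∈ coveredByAll r P₀
    · exact hXD (coveredByAll_mono hs0 h0)
    · exact hXD (coveredByAll_mono hs2 (hP₂r (mem_sdiff.2 ⟨hXB, h0⟩)))
  · intro Z hZ hZI
    exact hsat Z (Or.inl ⟨hZ, hZI⟩) (exists_flatPair_of_card hr hZ hZI)
  · intro V hV hVI
    exact hsat V (Or.inr ⟨hV, hVI⟩) (exists_flatPair_of_not_spans hI hr hV hVI)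
  · refine le_trans ?_ hr1
    exact_mod_cast card_le_card (sdiff_subset_sdiff Subset.rfl (coveredByAll_mono hs1))
  · have h1 : #P ≤ #P₀ + #P₁ + #P₂ + #P₃ := by
      refine (card_union_le _ _).trans (Nat.add_le_add_right ?_ _)
      refine (card_union_le _ _).trans (Nat.add_le_add_right ?_ _)
      exact card_union_le _ _
    have h2 : (#P : ℝ) ≤ #P₀ + #P₁ + #P₂ + #P₃ := by exact_mod_cast h1
    have h3 : (#P₀ : ℝ) ≤ m₀ := by exact_mod_cast hP₀c
    have h4 : (#P₁ : ℝ) ≤ m₁ := by exact_mod_cast hP₁c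
    have h5 : (#P₂ : ℝ) ≤ n.choose r / (n : ℝ) ^ 2 :=
      le_trans (by exact_mod_cast hP₂c) hr0
    have hθ' : (0 : ℝ) < θ := by exact_mod_cast hθ
    have h6 : (#P₃ : ℝ) ≤ 6 * n.choose r / (n * θ) := by
      have h7 : (θ : ℝ) * #P₃ ≤ 6 * n.choose r / n :=
        le_trans (by exact_mod_cast hP₃c) hr1
      rw [le_div_iff₀ hn0] at h7
      rw [le_div_iff₀ (by positivity)]
      linarith
    linarith

end MatroidAsymptotics

/-! ### Counting matroids with many nonbases -/

namespace MatroidAsymptotics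
open Finset

theorem log_le_logb_two {x : ℝ} (hx : 1 ≤ x) : Real.log x ≤ Real.logb 2 x := by
  rw [Real.logb, le_div_iff₀ (Real.log_pos (by norm_num))]
  have h1 := Real.log_nonneg hx
  have h2 := Real.log_two_lt_d9
  nlinarith

theorem exp_le_two_rpow {y : ℝ} (hy : 0 ≤ y) : Real.exp y ≤ (2 : ℝ) ^ (2 * y) := by
  rw [Real.rpow_def_of_pos (by norm_num)]
  apply Real.exp_le_exp.2
  have := Real.log_two_gt_d9
  nlinarith

/-- From (1 - β)^m ≤ exp(-βm) and log₂ n ≥ ln n. It fixes the lengths of all the shrinking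
processes. -/
theorem one_sub_pow_le {n : ℕ} (hn : 0 < n) {β : ℝ} (hβ1 : β ≤ 1) {m c : ℕ}
    (h : c * Real.logb 2 n ≤ β * m) : (1 - β) ^ m ≤ 1 / (n : ℝ) ^ c := by
  have hn1 : (1 : ℝ) ≤ n := by exact_mod_cast hn
  have h1 : (1 - β) ^ m ≤ Real.exp (-β) ^ m :=
    pow_le_pow_left₀ (by linarith) (Real.one_sub_le_exp_neg β) m
  refine h1.trans ?_
  rw [← Real.exp_nat_mul]
  have h2 : 1 / (n : ℝ) ^ c = Real.exp (-(c * Real.log n)) := by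
    rw [Real.exp_neg, one_div, mul_comm, Real.exp_mul, Real.exp_log (by linarith),
      Real.rpow_natCast]
  rw [h2]
  apply Real.exp_le_exp.2
  have h3 := mul_le_mul_of_nonneg_left (log_le_logb_two hn1) (Nat.cast_nonneg (α := ℝ) c)
  linarith

/-- A bound for `chooseSum` with base-two exponent. -/
theorem chooseSum_le_two_rpow {n : ℕ} (hn : 0 < n) (m q c : ℕ) :
    (chooseSum m q : ℝ) ≤ (2 : ℝ) ^ (c * Real.logb 2 n * q + 2 * (m / (n : ℝ) ^ c)) := by
  have hn0 : (0 : ℝ) < n := by exact_mod_cast hn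
  have hn1 : (1 : ℝ) ≤ n := by exact_mod_cast hn
  -- The Chernoff parameter is n^(-c).
  have h1 := chooseSum_le m q (x := ((n : ℝ) ^ c)⁻¹) (by positivity)
    (inv_le_one_of_one_le₀ (one_le_pow₀ hn1))
  rw [inv_inv] at h1
  have h2 : ((n : ℝ) ^ c) ^ q = (2 : ℝ) ^ (c * Real.logb 2 n * q) := by
    rw [mul_comm (c : ℝ), mul_assoc, Real.rpow_mul (by norm_num),
      Real.rpow_logb (by norm_num) (by norm_num) hn0, ← Nat.cast_mul, Real.rpow_natCast, pow_mul]
  rw [Real.rpow_add (by norm_num), ← h2]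
  refine h1.trans (mul_le_mul_of_nonneg_left ?_ (by positivity))
  rw [inv_mul_eq_div]
  exact exp_le_two_rpow (by positivity)

theorem card_filter_card_le {α : Type*} [Fintype α] (m : ℕ) :
    #((univ : Finset (Finset α)).filter fun P => #P ≤ m) ≤ chooseSum (Fintype.card α) m := by
  classical
  have h : ((univ : Finset (Finset α)).filter fun P => #P ≤ m) ⊆
      (range (m + 1)).biUnion fun i => powersetCard i univ := by
    intro P hP
    rw [mem_filter] at hP
    simp only [mem_biUnion, mem_range, mem_powersetCard]
    exact ⟨#P, by omega, subset_univ _, rfl⟩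
  refine (card_le_card h).trans (card_biUnion_le.trans (le_of_eq ?_))
  simp [chooseSum, card_univ]

variable {n r κ θ : ℕ}

/-- The number of families of dependent sets with a common good cover. -/
theorem card_le_of_common_goodCover (hn : 0 < n) (D : Finset (Finset (Fin n)))
    (𝒦 : Finset (Finset (Finset (Fin n))))
    (h𝒦 : ∀ K ∈ 𝒦, ∃ I, IsIndepFamily r I ∧ K = nonBases r I ∧ IsGoodCover r κ θ I D)
    (h1 : κ + θ + 2 ≤ r) (h2 : κ + θ + r + 2 ≤ n)
    (h3 : n + 4 * θ ≤ 4 * (n - r)) (h4 : n + 4 * θ ≤ 4 * r) {q : ℕ}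
    (hβ : n ^ 2 ≤ 64 * n.choose r)
    (hq : (1 - (n : ℝ) ^ 2 / (64 * n.choose r)) ^ q ≤ 8 / n) :
    (#𝒦 : ℝ) ≤ 2 * (chooseSum (4 * n.choose r) q * #(stableSubsets (layer n r))) *
      (2 : ℝ) ^ (-((#D : ℝ) / (1792 * n))) := by
  classical
  by_cases hne : 𝒦.Nonempty
  swap
  · rw [not_nonempty_iff_eq_empty.1 hne, card_empty, Nat.cast_zero]
    positivity
  obtain ⟨K₀, hK₀⟩ := hne
  obtain ⟨I₀, -, -, hc₀⟩ := h𝒦 K₀ hK₀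
  have hDl : D ⊆ layer n r := hc₀.subset.trans nonBases_subset
  have hex : ∀ K : 𝒦, ∃ I U, IsIndepFamily r I ∧ (K : Finset (Finset (Fin n))) = nonBases r I ∧
      IsGoodCover r κ θ I D ∧ Codes r I D U ∧ Admissible r D (rep r D) U := by
    intro K
    obtain ⟨I, hI, hK, hc⟩ := h𝒦 K K.2
    obtain ⟨U, hU, hU'⟩ := exists_codes hI hc h3 h4
    exact ⟨I, U, hI, hK, hc, hU, hU'⟩
  choose I U hI hK hc hU hU' using hex
  -- Two families with the same D and the same code contain each other.
  have hinj : Function.Injective U := by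
    intro K K' hKK
    apply Subtype.ext
    have hcc : CommonCover r κ θ (I K) (I K') D := ⟨hI K, hI K', hc K, hc K', h1, h2⟩
    rw [hK K, hK K']
    apply Subset.antisymm
    · exact hcc.nonBases_subset (hU K) (hKK ▸ (hU K').subset)
    · exact hcc.symm.nonBases_subset (hU K') (hKK ▸ (hU K).subset)
  have h5 := card_admissible_le hn hDl (univ.image U) (sel := rep r D) (by
    intro V hV
    obtain ⟨K, -, rfl⟩ := mem_image.1 hV
    exact hU' K) hβ hq
  rw [card_image_of_injective _ hinj] at h5
  simpa using h5

set_option maxHeartbeats 1000000 in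
/-- Few families of dependent sets are large. -/
theorem card_large_nonBases_le (hn : 200 ≤ n) (hn1 : n ≤ 3 * r) (hn2 : 3 * r ≤ 2 * n)
    (hN : n ^ 2 ≤ n.choose r) (hN2 : 2 ^ n ≤ (n + 1) * n ^ 3 * n.choose r) {b : ℝ}
    (𝒦 : Finset (Finset (Finset (Fin n))))
    (h𝒦 : ∀ K ∈ 𝒦, (∃ I, IsIndepFamily r I ∧ K = nonBases r I) ∧ b ≤ #K) :
    (#𝒦 : ℝ) ≤ #(stableSubsets (layer n r)) *
      (2 : ℝ) ^ (17000 * n.choose r * Real.logb 2 n ^ 2 / (n : ℝ) ^ 2 -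
        (b - 6 * n.choose r / n) / (1792 * n)) := by
  classical
  set N : ℝ := ((n.choose r : ℕ) : ℝ) with hNdef
  set L : ℝ := Real.logb 2 n with hL
  have hn0 : (0 : ℝ) < n := by exact_mod_cast (by omega : 0 < n)
  have hn4 : (200 : ℝ) ≤ n := by exact_mod_cast hn
  have hNn : (n : ℝ) ^ 2 ≤ N := by rw [hNdef]; exact_mod_cast hN
  have hN0 : 0 < N := lt_of_lt_of_le (by positivity) hNn
  have hL1 : 1 ≤ L := by
    rw [hL, Real.le_logb_iff_rpow_le (by norm_num) hn0]
    norm_num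
    linarith
  have hw1 : 1 ≤ N / (n : ℝ) ^ 2 := by
    rw [le_div_iff₀ (by positivity)]
    linarith
  set w : ℝ := N / (n : ℝ) ^ 2 with hw
  have hwL : w ≤ w * L := by nlinarith
  have hwLL : w * L ≤ w * L ^ 2 := by nlinarith
  -- The value of both κ and θ: linear in n, so that few pairs suffice, yet below n/12, as heaviness
  -- of full cliques requires for n/3 ≤ r ≤ 2n/3.
  set t : ℕ := n / 100 + 1 with ht
  have ht1 : n ≤ 100 * t := by omega
  have ht1' : (n : ℝ) ≤ 100 * t := by exact_mod_cast ht1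
  have ht2 : t ≤ n := by omega
  have ht2' : (t : ℝ) ≤ n := by exact_mod_cast ht2
  have htn : (t : ℝ) * n ≤ n ^ 2 := by nlinarith
  -- Each length is the required number of logarithms over the shrinking rate: 2L over tn/(6N) ≥
  -- n²/(600N), then L over n²/(36N) and over n²/(64N).
  set m₀ : ℕ := ⌈1200 * (w * L)⌉₊ with hm₀
  set m₁ : ℕ := ⌈36 * (w * L)⌉₊ with hm₁
  set q : ℕ := ⌈64 * (w * L)⌉₊ with hq
  have hm₀' : (m₀ : ℝ) ≤ 1200 * (w * L) + 1 := (Nat.ceil_lt_add_one (by positivity)).le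
  have hm₁' : (m₁ : ℝ) ≤ 36 * (w * L) + 1 := (Nat.ceil_lt_add_one (by positivity)).le
  have hq' : (q : ℝ) ≤ 64 * (w * L) + 1 := (Nat.ceil_lt_add_one (by positivity)).le
  have hb₀ : (t : ℝ) * n ≤ 6 * N := by linarith
  have hc₀ : (1 - t * (n : ℝ) / (6 * N)) ^ m₀ ≤ 1 / (n : ℝ) ^ 2 := by
    apply one_sub_pow_le (n := n) (by omega)
    · rw [div_le_one (by positivity)]
      exact hb₀
    · calc ((2 : ℕ) : ℝ) * L = n * n / (600 * N) * (1200 * (w * L)) := by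
            rw [hw]; field_simp; norm_num
        _ ≤ t * n / (6 * N) * m₀ := by
            apply mul_le_mul _ (Nat.le_ceil _) (by positivity) (by positivity)
            rw [div_le_div_iff₀ (by positivity) (by positivity)]
            have := mul_le_mul_of_nonneg_right ht1' (by positivity : 0 ≤ n * (6 * N))
            linarith
  have hc₁ : (1 - (n : ℝ) ^ 2 / (36 * N)) ^ m₁ ≤ 6 / n := by
    refine (one_sub_pow_le (n := n) (c := 1) (by omega) ?_ ?_).trans ?_
    · rw [div_le_one (by positivity)]
      linarith
    · calc ((1 : ℕ) : ℝ) * L = n ^ 2 / (36 * N) * (36 * (w * L)) := by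
            rw [hw]; field_simp; norm_num
        _ ≤ n ^ 2 / (36 * N) * m₁ := by
            apply mul_le_mul_of_nonneg_left (Nat.le_ceil _) (by positivity)
    · rw [pow_one]
      exact div_le_div_of_nonneg_right (by norm_num) hn0.le
  have hcq : (1 - (n : ℝ) ^ 2 / (64 * N)) ^ q ≤ 8 / n := by
    refine (one_sub_pow_le (n := n) (c := 1) (by omega) ?_ ?_).trans ?_
    · rw [div_le_one (by positivity)]
      linarith
    · calc ((1 : ℕ) : ℝ) * L = n ^ 2 / (64 * N) * (64 * (w * L)) := by
            rw [hw]; field_simp; norm_num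
        _ ≤ n ^ 2 / (64 * N) * q := by
            apply mul_le_mul_of_nonneg_left (Nat.le_ceil _) (by positivity)
    · rw [pow_one]
      exact div_le_div_of_nonneg_right (by norm_num) hn0.le
  -- Room for m₀ + m₁ + w + 600w, which is at most 1839wL.
  set m : ℕ := ⌊2000 * (w * L)⌋₊ with hm
  have hm' : (m : ℝ) ≤ 2000 * (w * L) := Nat.floor_le (by positivity)
  have hex : ∀ K : 𝒦, ∃ P : Finset (Finset (Fin n) × Fin (n + 1)), #P ≤ m ∧
      b - 6 * N / n ≤ #(coveredByAll r P) ∧ ∃ I, IsIndepFamily r I ∧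
        (K : Finset (Finset (Fin n))) = nonBases r I ∧ IsGoodCover r t t I (coveredByAll r P) := by
    intro K
    obtain ⟨⟨I, hI, hK⟩, hb⟩ := h𝒦 K K.2
    obtain ⟨P, hP, hPc, hPr, hPm⟩ := exists_goodCover (κ := t) (θ := t) hI (by omega) hn1 hn2
      (by omega) hb₀ (by linarith) hc₀ hc₁
    refine ⟨P, ?_, ?_, I, hI, hK, hPc⟩
    · rw [hm, Nat.le_floor_iff (by positivity)]
      have h1 : 6 * N / (n * t) ≤ 600 * w := by
        rw [hw, mul_div_assoc', div_le_div_iff₀ (by positivity) (by positivity)]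
        have := mul_le_mul_of_nonneg_right ht1' (by positivity : 0 ≤ n * (6 * N))
        linarith
      linarith
    · have h1 := card_inter_add_card_sdiff (nonBases r I) (coveredByAll r P)
      have h2 := card_le_card (inter_subset_right (s₁ := nonBases r I) (s₂ := coveredByAll r P))
      have h3 : (#K.1 : ℝ) ≤ #(coveredByAll r P) + #(nonBases r I \ coveredByAll r P) := by
        rw [hK]
        exact_mod_cast (by omega)
      linarith
  choose f hfm hfb hf using hex
  set bd : ℝ := 2 * (chooseSum (4 * n.choose r) q * #(stableSubsets (layer n r))) *
      (2 : ℝ) ^ (-((b - 6 * N / n) / (1792 * n))) with hbd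
  set Ps := (univ : Finset (Finset (Finset (Fin n) × Fin (n + 1)))).filter fun P => #P ≤ m
    with hPs_def
  -- Matroids with the same P share the good cover D, and D has at least b - 6N/n members.
  have hfib : ∀ P ∈ Ps, (#(𝒦.attach.filter fun K => f K = P) : ℝ) ≤ bd := by
    intro P hP
    by_cases hne : (𝒦.attach.filter fun K => f K = P).Nonempty
    swap
    · rw [not_nonempty_iff_eq_empty.1 hne, card_empty, Nat.cast_zero]
      positivity
    obtain ⟨K₀, hK₀⟩ := hne
    have hb := hfb K₀
    rw [(mem_filter.1 hK₀).2] at hb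
    have h1 := card_le_of_common_goodCover (r := r) (κ := t) (θ := t) (by omega)
      (coveredByAll r P) ((𝒦.attach.filter fun K => f K = P).image Subtype.val) (by
        intro K hK
        obtain ⟨K', hK', rfl⟩ := mem_image.1 hK
        have := hf K'
        rwa [(mem_filter.1 hK').2] at this) (by omega) (by omega) (by omega) (by omega)
      (q := q) (by omega) hcq
    rw [card_image_of_injective _ Subtype.val_injective] at h1
    refine h1.trans (mul_le_mul_of_nonneg_left ?_ (by positivity))
    apply Real.rpow_le_rpow_of_exponent_le (by norm_num)
    apply neg_le_neg
    exact div_le_div_of_nonneg_right hb (by positivity)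
  have hcard : (#𝒦 : ℝ) ≤ #Ps * bd := by
    have h1 := card_eq_sum_card_fiberwise (f := f) (s := 𝒦.attach) (t := Ps) (by
      intro K _
      exact mem_coe.2 (mem_filter.2 ⟨mem_univ _, hfm K⟩))
    rw [card_attach] at h1
    rw [h1]
    push_cast
    refine (sum_le_sum hfib).trans ?_
    rw [sum_const, nsmul_eq_mul]
  have hPs : (#Ps : ℝ) ≤ (2 : ℝ) ^ (16002 * (w * L ^ 2)) := by
    have h1 := card_filter_card_le (α := Finset (Fin n) × Fin (n + 1)) m
    rw [Fintype.card_prod, Fintype.card_finset, Fintype.card_fin, Fintype.card_fin] at h1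
    -- There are 2^n(n+1) possible pairs; c = 8 brings 2^n(n+1)/n^8 below w, so each chosen pair
    -- costs 8L bits.
    have h2 := chooseSum_le_two_rpow (n := n) (by omega) (2 ^ n * (n + 1)) m 8
    rw [← hL] at h2
    refine (le_trans (by exact_mod_cast h1) h2).trans ?_
    apply Real.rpow_le_rpow_of_exponent_le (by norm_num)
    have h3 : ((8 : ℕ) : ℝ) * L * m ≤ 16000 * (w * L ^ 2) := by
      have := mul_le_mul_of_nonneg_left hm' (by linarith : 0 ≤ 8 * L)
      push_cast
      linarith
    have h4 : ((2 ^ n * (n + 1) : ℕ) : ℝ) / (n : ℝ) ^ 8 ≤ w := by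
      rw [hw, div_le_div_iff₀ (by positivity) (by positivity)]
      have h5 : (2 : ℝ) ^ n ≤ (n + 1) * n ^ 3 * N := by rw [hNdef]; exact_mod_cast hN2
      have h6 : ((n : ℝ) + 1) ^ 2 ≤ n ^ 3 := by nlinarith
      push_cast
      calc (2 : ℝ) ^ n * (n + 1) * n ^ 2 ≤ ((n + 1) * n ^ 3 * N) * (n + 1) * n ^ 2 := by gcongr
        _ = ((n : ℝ) + 1) ^ 2 * (n ^ 5 * N) := by ring
        _ ≤ n ^ 3 * (n ^ 5 * N) := by gcongr
        _ = _ := by ring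
    refine (add_le_add h3 (mul_le_mul_of_nonneg_left h4 zero_le_two)).trans ?_
    linarith
  have hS : (chooseSum (4 * n.choose r) q : ℝ) ≤ (2 : ℝ) ^ (140 * (w * L ^ 2)) := by
    refine (chooseSum_le_two_rpow (n := n) (by omega) (4 * n.choose r) q 2).trans ?_
    rw [← hL]
    apply Real.rpow_le_rpow_of_exponent_le (by norm_num)
    have h3 : ((2 : ℕ) : ℝ) * L * q ≤ 130 * (w * L ^ 2) := by
      have h5 := mul_le_mul_of_nonneg_left hq' (by linarith : 0 ≤ 2 * L)
      have h6 : L ≤ w * L ^ 2 := by nlinarith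
      push_cast
      linarith
    have h4 : ((4 * n.choose r : ℕ) : ℝ) / (n : ℝ) ^ 2 = 4 * w := by
      push_cast
      rw [hw]
      ring
    rw [h4]
    linarith
  have h2 : (2 : ℝ) ≤ 2 ^ (w * L ^ 2) := by
    calc (2 : ℝ) = 2 ^ (1 : ℝ) := by norm_num
      _ ≤ _ := Real.rpow_le_rpow_of_exponent_le (by norm_num) (by linarith)
  set s : ℝ := ((#(stableSubsets (layer n r)) : ℕ) : ℝ) with hs
  have hs0 : 0 ≤ s := by positivity
  set g : ℝ := (b - 6 * N / n) / (1792 * n) with hg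
  calc (#𝒦 : ℝ) ≤ _ := hcard
    _ ≤ (2 : ℝ) ^ (16002 * (w * L ^ 2)) * (2 ^ (w * L ^ 2) * (2 ^ (140 * (w * L ^ 2)) * s) *
        2 ^ (-g)) := by
        rw [hbd]
        gcongr
    _ = s * (2 ^ (16002 * (w * L ^ 2)) * 2 ^ (w * L ^ 2) * 2 ^ (140 * (w * L ^ 2)) *
        2 ^ (-g)) := by ring
    _ = s * 2 ^ (16143 * (w * L ^ 2) - g) := by
        rw [← Real.rpow_add (by norm_num), ← Real.rpow_add (by norm_num),
          ← Real.rpow_add (by norm_num)]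
        ring_nf
    _ ≤ _ := by
        apply mul_le_mul_of_nonneg_left _ hs0
        apply Real.rpow_le_rpow_of_exponent_le (by norm_num)
        have : 17000 * N * L ^ 2 / (n : ℝ) ^ 2 = 17000 * (w * L ^ 2) := by rw [hw]; ring
        rw [this]
        linarith

end MatroidAsymptotics

/-! ### Matroids on `Fin n` and their nonbases -/

namespace MatroidAsymptotics
open Finset

variable {n r : ℕ}

theorem card_eq_rk {M : Matroid (Fin n)} {B : Finset (Fin n)} (hB : M.IsBase (B : Set (Fin n))) :
    #B = rk M := by
  rw [rk, ← hB.encard_eq_eRank, Set.encard_coe_eq_coe_finsetCard, ENat.toNat_natCast]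

theorem exists_finset_isBase_superset {M : Matroid (Fin n)} {X : Finset (Fin n)}
    (hX : M.Indep (X : Set (Fin n))) :
    ∃ B : Finset (Fin n), M.IsBase (B : Set (Fin n)) ∧ X ⊆ B ∧ #B = rk M := by
  classical
  obtain ⟨B, hB, hXB⟩ := hX.exists_isBase_superset
  have hB' : M.IsBase ((B.toFinset : Finset (Fin n)) : Set (Fin n)) := by
    rwa [Set.coe_toFinset]
  exact ⟨B.toFinset, hB', Set.subset_toFinset.2 hXB, card_eq_rk hB'⟩

theorem isBase_coe_iff {M : Matroid (Fin n)} {B : Finset (Fin n)} :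
    M.IsBase (B : Set (Fin n)) ↔ #B = rk M ∧ M.Indep (B : Set (Fin n)) := by
  refine ⟨fun h => ⟨card_eq_rk h, h.indep⟩, fun ⟨h1, h2⟩ => ?_⟩
  obtain ⟨B', hB', hBB', hc⟩ := exists_finset_isBase_superset h2
  rwa [eq_of_subset_of_card_le hBB' (by omega)]

theorem isIndepFamily_indep (M : Matroid (Fin n)) :
    IsIndepFamily (rk M) fun X : Finset (Fin n) => M.Indep (X : Set (Fin n)) where
  subset X Y hY hXY := hY.subset (by exact_mod_cast hXY)
  aug X Y hX hY h := by
    obtain ⟨e, he, he', heI⟩ := hX.augment_finset hY h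
    exact ⟨e, he, he', by rwa [coe_insert]⟩
  card_le X hX := by
    obtain ⟨B, -, h, hc⟩ := exists_finset_isBase_superset hX
    exact hc ▸ card_le_card h
  exists_base := by
    obtain ⟨B, hB, -, hc⟩ := exists_finset_isBase_superset
      (show M.Indep ((∅ : Finset (Fin n)) : Set (Fin n)) by simp)
    exact ⟨B, hc, hB.indep⟩

theorem rk_le (M : Matroid (Fin n)) : rk M ≤ n := by
  obtain ⟨B, hB, -⟩ := (isIndepFamily_indep M).exists_base
  rw [← hB]
  exact (card_le_univ B).trans_eq (Fintype.card_fin n)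

/-- The dependent sets of `M` whose size is the rank. -/
noncomputable def matroidNonBases (M : Matroid (Fin n)) : Finset (Finset (Fin n)) :=
  nonBases (rk M) fun X : Finset (Fin n) => M.Indep (X : Set (Fin n))

theorem mem_matroidNonBases {M : Matroid (Fin n)} {X : Finset (Fin n)} :
    X ∈ matroidNonBases M ↔ #X = rk M ∧ ¬ M.Indep (X : Set (Fin n)) := mem_nonBases

theorem eq_of_matroidNonBases_eq {M M' : Matroid (Fin n)} (hM : M ∈ matroidsOn n)
    (hM' : M' ∈ matroidsOn n) (hr : rk M = rk M') (h : matroidNonBases M = matroidNonBases M') :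
    M = M' := by
  classical
  refine Matroid.ext_isBase (hM.trans hM'.symm) fun B _ => ?_
  have hB : B = ((B.toFinset : Finset (Fin n)) : Set (Fin n)) := (Set.coe_toFinset B).symm
  rw [hB, isBase_coe_iff, isBase_coe_iff]
  have h1 := Finset.ext_iff.1 h B.toFinset
  rw [mem_matroidNonBases, mem_matroidNonBases] at h1
  rw [hr] at h1 ⊢
  tauto

theorem depFraction_eq {M : Matroid (Fin n)} (hM : M ∈ matroidsOn n) :
    depFraction M = (#(matroidNonBases M) : ℝ) / n.choose (rk M) := by
  classical
  have h : {X : Set (Fin n) | X.ncard = rk M ∧ M.Dep X} =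
      ((matroidNonBases M).image fun X : Finset (Fin n) => (X : Set (Fin n)) :
        Finset (Set (Fin n))) := by
    ext X
    have hE : M.E = Set.univ := hM
    simp only [Set.mem_ofPred_eq, coe_image, Set.mem_image, mem_coe, mem_matroidNonBases,
      Matroid.dep_iff, hE]
    constructor
    · rintro ⟨h1, h2, -⟩
      refine ⟨X.toFinset, ⟨?_, by rwa [Set.coe_toFinset]⟩, Set.coe_toFinset X⟩
      rw [← h1, Set.ncard_eq_toFinset_card']
    · rintro ⟨Y, ⟨h1, h2⟩, rfl⟩
      exact ⟨by rw [Set.ncard_coe_finset, h1], h2, Set.subset_univ _⟩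
  rw [depFraction, h, Set.ncard_coe_finset, card_image_of_injective _ coe_injective]

theorem one_sub_baseFraction_eq {M : Matroid (Fin n)} (hM : M ∈ matroidsOn n) :
    1 - baseFraction M = depFraction M := by
  classical
  have h : {X : Set (Fin n) | M.IsBase X} =
      ((layer n (rk M) \ matroidNonBases M).image fun X : Finset (Fin n) => (X : Set (Fin n)) :
        Finset (Set (Fin n))) := by
    ext X
    simp only [Set.mem_ofPred_eq, coe_image, Set.mem_image, mem_coe, mem_sdiff, mem_layer,
      mem_matroidNonBases]
    constructor
    · intro hX
      refine ⟨X.toFinset, ?_, Set.coe_toFinset X⟩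
      rw [← Set.coe_toFinset X, isBase_coe_iff] at hX
      tauto
    · rintro ⟨Y, h1, rfl⟩
      rw [isBase_coe_iff]
      tauto
  have hN : (0 : ℝ) < n.choose (rk M) := by exact_mod_cast Nat.choose_pos (rk_le M)
  have hsub : matroidNonBases M ⊆ layer n (rk M) := nonBases_subset
  rw [baseFraction, h, Set.ncard_coe_finset, card_image_of_injective _ coe_injective,
    depFraction_eq hM, card_sdiff_of_subset hsub, card_layer,
    Nat.cast_sub (card_layer n (rk M) ▸ card_le_card hsub)]
  field_simp
  ring

theorem matroidsOn_finite (n : ℕ) : (matroidsOn n).Finite := by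
  classical
  refine Set.Finite.of_finite_image (f := fun M : Matroid (Fin n) => (rk M, matroidNonBases M))
    ?_ ?_
  · refine Set.Finite.subset (s := ((range (n + 1)) ×ˢ (univ : Finset (Finset (Finset (Fin n)))) :
      Finset _)) (finite_toSet _) ?_
    rintro _ ⟨M, -, rfl⟩
    simp only [coe_product, Set.mem_prod, mem_coe, mem_range, mem_univ, and_true]
    exact Nat.lt_succ_of_le (rk_le M)
  · intro M hM M' hM' h
    simp only [Prod.mk.injEq] at h
    exact eq_of_matroidNonBases_eq hM hM' h.1 h.2

theorem exists_image_matroidNonBases {𝓜 : Set (Matroid (Fin n))} (h𝓜 : 𝓜 ⊆ matroidsOn n)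
    (hr : ∀ M ∈ 𝓜, rk M = r) :
    ∃ 𝒦 : Finset (Finset (Finset (Fin n))), #𝒦 = 𝓜.ncard ∧
      ∀ K ∈ 𝒦, ∃ M ∈ 𝓜, matroidNonBases M = K := by
  classical
  have hfin := (matroidsOn_finite n).subset h𝓜
  refine ⟨hfin.toFinset.image matroidNonBases, ?_, ?_⟩
  · rw [card_image_of_injOn, Set.ncard_eq_toFinset_card _ hfin]
    intro M hM M' hM' h
    rw [mem_coe, Set.Finite.mem_toFinset] at hM hM'
    exact eq_of_matroidNonBases_eq (h𝓜 hM) (h𝓜 hM') ((hr M hM).trans (hr M' hM').symm) h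
  · intro K hK
    obtain ⟨M, hM, rfl⟩ := mem_image.1 hK
    exact ⟨M, hfin.mem_toFinset.1 hM, rfl⟩

theorem ncard_le_two_pow {𝓜 : Set (Matroid (Fin n))} (h𝓜 : 𝓜 ⊆ matroidsOn n)
    (hr : ∀ M ∈ 𝓜, rk M = r) : 𝓜.ncard ≤ 2 ^ n.choose r := by
  obtain ⟨𝒦, hc, h𝒦⟩ := exists_image_matroidNonBases h𝓜 hr
  rw [← hc, ← card_layer n r, ← card_powerset]
  apply card_le_card
  intro K hK
  obtain ⟨M, hM, rfl⟩ := h𝒦 K hK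
  rw [mem_powerset, ← hr M hM]
  exact nonBases_subset

/-! ### Sparse paving matroids as stable sets -/

theorem isPaving_of_indep {M : Matroid (Fin n)}
    (h : ∀ X : Finset (Fin n), #X < rk M → M.Indep (X : Set (Fin n))) : IsPaving M := by
  classical
  intro C hC
  by_contra! hcon
  rw [Set.ncard_eq_toFinset_card'] at hcon
  have := h _ hcon
  rw [Set.coe_toFinset] at this
  exact hC.dep.not_indep this

theorem IsPaving.indep {M : Matroid (Fin n)} (hM : M.E = Set.univ) (h : IsPaving M)
    {X : Finset (Fin n)} (hX : #X < rk M) : M.Indep (X : Set (Fin n)) := by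
  by_contra hcon
  have hd : M.Dep (X : Set (Fin n)) := ⟨hcon, hM ▸ Set.subset_univ _⟩
  obtain ⟨C, hCX, hC⟩ := hd.exists_isCircuit_subset
  have h1 := h C hC
  have h2 := Set.ncard_le_ncard hCX
  rw [Set.ncard_coe_finset] at h2
  omega

theorem rk_dual {M : Matroid (Fin n)} (hM : M.E = Set.univ) : rk M✶ + rk M = n := by
  obtain ⟨B, hB, hBI⟩ := (isIndepFamily_indep M).exists_base
  have hBb : M.IsBase (B : Set (Fin n)) := isBase_coe_iff.2 ⟨hB, hBI⟩
  have h1 : M✶.IsBase ((Bᶜ : Finset (Fin n)) : Set (Fin n)) := by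
    rw [Matroid.dual_isBase_iff (by rw [hM]; exact Set.subset_univ _), hM, coe_compl,
      ← Set.compl_eq_univ_sdiff, compl_compl]
    exact hBb
  rw [← card_eq_rk h1, ← hB, add_comm, card_add_card_compl, Fintype.card_fin]

theorem dual_indep_compl_iff {M : Matroid (Fin n)} (hM : M.E = Set.univ) {V : Finset (Fin n)} :
    M✶.Indep ((Vᶜ : Finset (Fin n)) : Set (Fin n)) ↔
      Spans (rk M) (fun X : Finset (Fin n) => M.Indep (X : Set (Fin n))) V := by
  classical
  rw [Matroid.dual_indep_iff_exists (by rw [hM]; exact Set.subset_univ _)]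
  constructor
  · rintro ⟨B, hB, hdis⟩
    rw [← Set.coe_toFinset B] at hB hdis
    refine ⟨B.toFinset, ?_, card_eq_rk hB, hB.indep⟩
    rw [disjoint_coe, disjoint_compl_left_iff] at hdis
    exact hdis
  · rintro ⟨B, hBV, hBr, hBI⟩
    refine ⟨B, isBase_coe_iff.2 ⟨hBr, hBI⟩, ?_⟩
    rw [disjoint_coe, disjoint_compl_left_iff]
    exact hBV

/-- Adjacent nonbases force a full row, which is a dependent (r-1)-set, or a full column, whose
complement is dual-dependent of size one below the dual rank. Paving of M or of its dual excludes
these. -/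
theorem IsSparsePaving.isStable {M : Matroid (Fin n)} (hM : M.E = Set.univ)
    (h : IsSparsePaving M) : IsStable (matroidNonBases M) := by
  intro X hX Y hY hadj
  obtain ⟨x, hx, y, hy, rfl⟩ := hadj.exists_eq
  have hXr := (mem_matroidNonBases.1 hX).1
  rcases ((isIndepFamily_indep M).mem_nonBases_insert_erase hX hx hy).1 hY with h1 | h1
  · apply (mem_fullRows.1 h1).2
    apply h.1.indep hM
    have := card_erase_add_one hx
    omega
  · apply (mem_fullCols.1 h1).2
    rw [← dual_indep_compl_iff hM]
    apply IsPaving.indep (M := M✶) hM h.2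
    have h2 := rk_dual hM
    have h3 := card_add_card_compl (insert y X)
    rw [card_insert_of_notMem hy, Fintype.card_fin] at h3
    omega

theorem numSparsePaving_le (n : ℕ) :
    numSparsePaving n ≤ ∑ r ∈ range (n + 1), #(stableSubsets (layer n r)) := by
  classical
  have hfin : {M ∈ matroidsOn n | IsSparsePaving M}.Finite :=
    (matroidsOn_finite n).subset fun M hM => hM.1
  rw [numSparsePaving, Set.ncard_eq_toFinset_card _ hfin, card_eq_sum_card_fiberwise (f := rk)
    (t := range (n + 1)) (fun M _ => by
      rw [mem_coe, mem_range]
      exact Nat.lt_succ_of_le (rk_le M))]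
  apply sum_le_sum
  intro r _
  apply card_le_card_of_injOn matroidNonBases
  · intro M hM
    rw [mem_coe, mem_filter, Set.Finite.mem_toFinset] at hM
    rw [mem_coe, mem_stableSubsets, ← hM.2]
    exact ⟨nonBases_subset, hM.1.2.isStable hM.1.1⟩
  · intro M hM M' hM' heq
    rw [mem_coe, mem_filter, Set.Finite.mem_toFinset] at hM hM'
    exact eq_of_matroidNonBases_eq hM.1.1 hM'.1.1 (hM.2.trans hM'.2.symm) heq

/-- Of two `r`-sets containing a given `(r - 1)`-set, one is not in a stable set. -/
theorem IsStable.exists_superset {S : Finset (Finset (Fin n))} (hS : IsStable S)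
    {X : Finset (Fin n)} (hX : #X < r) (hr : r < n) : ∃ B, X ⊆ B ∧ #B = r ∧ B ∉ S := by
  obtain ⟨V, hXV, hV⟩ := exists_superset_card_eq (s := X) (n := r + 1) (by omega)
    (by rw [Fintype.card_fin]; omega)
  have h1 : 1 < #(V \ X) := by
    rw [card_sdiff_of_subset hXV]
    omega
  obtain ⟨a, ha, b, hb, hab⟩ := one_lt_card.1 h1
  rw [mem_sdiff] at ha hb
  have hca := card_erase_add_one ha.1
  have hcb := card_erase_add_one hb.1
  by_contra! hcon
  have h2 := hcon (V.erase a) (subset_erase.2 ⟨hXV, ha.2⟩) (by omega)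
  have h3 := hcon (V.erase b) (subset_erase.2 ⟨hXV, hb.2⟩) (by omega)
  refine hS _ h2 _ h3 ⟨by omega, card_eq_one.2 ⟨b, ?_⟩⟩
  ext c
  simp only [mem_sdiff, mem_erase, mem_singleton]
  constructor
  · rintro ⟨⟨h4, h5⟩, h6⟩
    by_contra h7
    exact h6 ⟨h7, h5⟩
  · rintro rfl
    exact ⟨⟨hab.symm, hb.1⟩, fun h => h.1 rfl⟩

theorem IsStable.exists_subset {S : Finset (Finset (Fin n))} (hS : IsStable S)
    {V : Finset (Fin n)} (hV : r < #V) (hr : 0 < r) : ∃ B ⊆ V, #B = r ∧ B ∉ S := by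
  obtain ⟨W, hWV, hW⟩ := exists_subset_card_eq (s := V) (n := r + 1) (by omega)
  obtain ⟨a, ha, b, hb, hab⟩ := one_lt_card.1 (by omega : 1 < #W)
  have hca := card_erase_add_one ha
  have hcb := card_erase_add_one hb
  by_contra! hcon
  have h2 := hcon (W.erase a) ((erase_subset _ _).trans hWV) (by omega)
  have h3 := hcon (W.erase b) ((erase_subset _ _).trans hWV) (by omega)
  refine hS _ h2 _ h3 ⟨by omega, card_eq_one.2 ⟨b, ?_⟩⟩
  ext c
  simp only [mem_sdiff, mem_erase, mem_singleton]
  constructor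
  · rintro ⟨⟨h4, h5⟩, h6⟩
    by_contra h7
    exact h6 ⟨h7, h5⟩
  · rintro rfl
    exact ⟨⟨hab.symm, hb⟩, fun h => h.1 rfl⟩

/-- The sets X - a + b for b in Y \ X are pairwise adjacent, so at most one is in S. If there is
only one candidate, it is Y, which is not in S. -/
theorem IsStable.exchange {S : Finset (Finset (Fin n))} (hS : IsStable S) {X Y : Finset (Fin n)}
    (hX : #X = r) (hY : #Y = r) (hYS : Y ∉ S) {a : Fin n} (ha : a ∈ X) (haY : a ∉ Y) :
    ∃ b ∈ Y, b ∉ X ∧ insert b (X.erase a) ∉ S := by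
  have hXY : #X = #Y := hX.trans hY.symm
  have hpos : 0 < #(Y \ X) := by
    rw [← card_sdiff_comm hXY]
    exact card_pos.2 ⟨a, mem_sdiff.2 ⟨ha, haY⟩⟩
  obtain ⟨b, hb⟩ := card_pos.1 hpos
  rw [mem_sdiff] at hb
  by_contra! hcon
  have hbS := hcon b hb.1 hb.2
  by_cases h1 : ∃ c ∈ Y, c ∉ X ∧ c ≠ b
  · obtain ⟨c, hc, hcX, hcb⟩ := h1
    have hcS := hcon c hc hcX
    refine hS _ hbS _ hcS ⟨?_, card_eq_one.2 ⟨b, ?_⟩⟩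
    · rw [card_insert_erase ha hb.2, card_insert_erase ha hcX]
    · ext d
      simp only [mem_sdiff, mem_insert, mem_erase, mem_singleton]
      constructor
      · rintro ⟨h2 | h2, h3⟩
        · exact h2
        · exact absurd (Or.inr h2) h3
      · rintro rfl
        refine ⟨Or.inl rfl, ?_⟩
        rintro (h2 | h2)
        · exact hcb h2.symm
        · exact hb.2 h2.2
  · push Not at h1
    have h2 : Y ⊆ insert b (X.erase a) := by
      intro d hd
      by_cases hdX : d ∈ X
      · exact mem_insert_of_mem (mem_erase.2 ⟨fun h => haY (h ▸ hd), hdX⟩)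
      · rw [h1 d hd hdX]
        exact mem_insert_self _ _
    have h3 := eq_of_subset_of_card_le h2 (by rw [card_insert_erase ha hb.2]; omega)
    exact hYS (h3 ▸ hbS)

/-- The r-sets outside S satisfy base exchange. Paving and dual paving hold because S cannot contain
all r-sets above a smaller set or below a larger one. For r = 0 or r = n the single r-set could be
in S, leaving no base. -/
theorem exists_matroid_of_isStable (hr : 0 < r) (hrn : r < n) {S : Finset (Finset (Fin n))}
    (hS : IsStable S) : ∃ M ∈ matroidsOn n, IsSparsePaving M ∧ rk M = r ∧
      ∀ B : Finset (Fin n), M.IsBase (B : Set (Fin n)) ↔ #B = r ∧ B ∉ S := by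
  classical
  set P : Set (Fin n) → Prop := fun B => ∃ F : Finset (Fin n), (F : Set (Fin n)) = B ∧
    #F = r ∧ F ∉ S with hP
  obtain ⟨B₀, -, hB₀r, hB₀S⟩ := hS.exists_superset (X := ∅) (by simpa using hr) hrn
  have hex : ∃ B, P B := ⟨B₀, B₀, rfl, hB₀r, hB₀S⟩
  have hexch : Matroid.ExchangeProperty P := by
    rintro _ _ ⟨X, rfl, hX, -⟩ ⟨Y, rfl, hY, hYS⟩ a ha
    obtain ⟨b, hb, hbX, hbS⟩ := hS.exchange hX hY hYS (a := a) ha.1 ha.2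
    refine ⟨b, ⟨hb, hbX⟩, insert b (X.erase a), ?_, ?_, hbS⟩
    · rw [coe_insert, coe_erase]
    · exact (card_insert_erase ha.1 hbX).trans hX
  set M := Matroid.ofIsBaseOfFinite (E := Set.univ) Set.finite_univ P hex hexch
    (fun B _ => Set.subset_univ B) with hM
  have hbase : ∀ B : Finset (Fin n), M.IsBase (B : Set (Fin n)) ↔ #B = r ∧ B ∉ S := by
    intro B
    rw [hM, Matroid.ofIsBaseOfFinite_isBase]
    simp [hP]
  have hE : M.E = Set.univ := rfl
  have hrk : rk M = r := by
    rw [← card_eq_rk ((hbase B₀).2 ⟨hB₀r, hB₀S⟩), hB₀r]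
  refine ⟨M, hE, ⟨isPaving_of_indep ?_, isPaving_of_indep ?_⟩, hrk, hbase⟩
  · intro X hX
    obtain ⟨B, hXB, hB⟩ := hS.exists_superset (hrk ▸ hX) hrn
    exact ((hbase B).2 hB).indep.subset (by exact_mod_cast hXB)
  · intro X hX
    have h1 := rk_dual hE
    have h2 := card_add_card_compl X
    rw [Fintype.card_fin] at h2
    obtain ⟨B, hBX, hB⟩ := hS.exists_subset (r := r) (V := Xᶜ) (by omega) hr
    have h3 := (dual_indep_compl_iff hE (V := Xᶜ)).2
      ⟨B, hBX, hB.1.trans hrk.symm, ((hbase B).2 hB).indep⟩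
    rwa [compl_compl] at h3

theorem card_stableSubsets_le_numSparsePaving (hr : 0 < r) (hrn : r < n) :
    #(stableSubsets (layer n r)) ≤ numSparsePaving n := by
  classical
  have hfin : {M ∈ matroidsOn n | IsSparsePaving M}.Finite :=
    (matroidsOn_finite n).subset fun M hM => hM.1
  have h : ∀ S : stableSubsets (layer n r), ∃ M ∈ matroidsOn n, IsSparsePaving M ∧ rk M = r ∧
      ∀ B : Finset (Fin n), M.IsBase (B : Set (Fin n)) ↔ #B = r ∧ B ∉ (S : Finset _) :=
    fun S => exists_matroid_of_isStable hr hrn (mem_stableSubsets.1 S.2).2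
  choose f hf hfs _ hfb using h
  rw [numSparsePaving, Set.ncard_eq_toFinset_card _ hfin, ← card_attach]
  apply card_le_card_of_injOn f
  · intro S _
    rw [mem_coe, Set.Finite.mem_toFinset]
    exact ⟨hf S, hfs S⟩
  · intro S _ S' _ heq
    apply Subtype.ext
    ext B
    have h1 := (mem_stableSubsets.1 S.2).1
    have h2 := (mem_stableSubsets.1 S'.2).1
    have h3 := hfb S B
    rw [heq, hfb S' B] at h3
    constructor
    · intro hB
      by_contra hB'
      exact (h3.1 ⟨mem_layer.1 (h1 hB), hB'⟩).2 hB
    · intro hB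
      by_contra hB'
      exact (h3.2 ⟨mem_layer.1 (h2 hB), hB'⟩).2 hB

end MatroidAsymptotics

/-! ### Binomial estimates, bounds on s(n), and the limit -/

namespace MatroidAsymptotics
open Finset Filter Topology

variable {n r : ℕ}

/-- Below level 2n/5 consecutive binomial coefficients grow by a factor of at least 3/2. -/
theorem three_pow_mul_choose_le {n a : ℕ} : ∀ k, 5 * (a + k) ≤ 2 * n →
    3 ^ k * n.choose a ≤ 2 ^ k * n.choose (a + k) := by
  intro k
  induction k with
  | zero => intro _; simp
  | succ k ih =>
    intro h
    have h1 := ih (by omega)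
    have h2 := Nat.choose_succ_right_eq n (a + k)
    have h3 : 3 * n.choose (a + k) ≤ 2 * n.choose (a + k + 1) := by
      have h4 : 3 * (a + k + 1) ≤ 2 * (n - (a + k)) := by omega
      have h5 := Nat.mul_le_mul_left (n.choose (a + k)) h4
      have h6 : 3 * n.choose (a + k) * (a + k + 1) ≤ 2 * n.choose (a + k + 1) * (a + k + 1) := by
        calc _ = n.choose (a + k) * (3 * (a + k + 1)) := by ring
          _ ≤ n.choose (a + k) * (2 * (n - (a + k))) := h5
          _ = 2 * (n.choose (a + k) * (n - (a + k))) := by ring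
          _ = _ := by rw [← h2]; ring
      exact Nat.le_of_mul_le_mul_right h6 (by omega)
    calc 3 ^ (k + 1) * n.choose a = 3 * (3 ^ k * n.choose a) := by ring
      _ ≤ 3 * (2 ^ k * n.choose (a + k)) := Nat.mul_le_mul_left _ h1
      _ = 2 ^ k * (3 * n.choose (a + k)) := by ring
      _ ≤ 2 ^ k * (2 * n.choose (a + k + 1)) := Nat.mul_le_mul_left _ h3
      _ = _ := by rw [← add_assoc a k 1]; ring

theorem two_pow_le_mul_choose (n : ℕ) : 2 ^ n ≤ (n + 1) * n.choose (n / 2) := by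
  rw [← Nat.sum_range_choose]
  refine (sum_le_sum fun r _ => Nat.choose_le_middle r n).trans ?_
  simp

/-- The conditions on the size of the ground set under which the counting argument works. -/
structure IsLarge (n : ℕ) : Prop where
  le : 200 ≤ n
  pow_le_choose : n ^ 10 ≤ n.choose (n / 2)
  dichotomy : ∀ r, n ^ 3 * n.choose r ≤ n.choose (n / 2) ∨ (n ≤ 3 * r ∧ 3 * r ≤ 2 * n)
  le_logb : 10 ^ 6 ≤ Real.logb 2 n
  logb_sq_le : 40 * Real.logb 2 n ^ 2 ≤ n

/-- From a level below n/3, climbing n/15 levels stays within 2n/5 and gains (3/2)^(n/15) ≥ n³.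
Symmetry handles levels above 2n/3. -/
theorem choose_mul_le_of_pow_le (h : n ^ 3 * 2 ^ (n / 15) ≤ 3 ^ (n / 15)) (r : ℕ) :
    n ^ 3 * n.choose r ≤ n.choose (n / 2) ∨ (n ≤ 3 * r ∧ 3 * r ≤ 2 * n) := by
  have key : ∀ a, 3 * a < n → n ^ 3 * n.choose a ≤ n.choose (n / 2) := by
    intro a ha
    have h1 := three_pow_mul_choose_le (n := n) (a := a) (n / 15) (by omega)
    have h2 := Nat.choose_le_middle (a + n / 15) n
    have h3 : 2 ^ (n / 15) * (n ^ 3 * n.choose a) ≤ 2 ^ (n / 15) * n.choose (n / 2) := by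
      calc _ = n ^ 3 * 2 ^ (n / 15) * n.choose a := by ring
        _ ≤ 3 ^ (n / 15) * n.choose a := Nat.mul_le_mul_right _ h
        _ ≤ 2 ^ (n / 15) * n.choose (a + n / 15) := h1
        _ ≤ _ := Nat.mul_le_mul_left _ h2
    exact Nat.le_of_mul_le_mul_left h3 (by positivity)
  by_cases h1 : 3 * r < n
  · exact Or.inl (key r h1)
  by_cases h2 : 3 * r ≤ 2 * n
  · exact Or.inr ⟨by omega, h2⟩
  left
  by_cases h3 : r ≤ n
  · rw [← Nat.choose_symm h3]
    exact key _ (by omega)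
  · rw [Nat.choose_eq_zero_of_lt (by omega)]
    simp

theorem eventually_isLarge : ∀ᶠ n : ℕ in atTop, IsLarge n := by
  have hlog : Tendsto (fun n : ℕ => Real.logb 2 (n : ℝ)) atTop atTop :=
    (Real.tendsto_logb_atTop (by norm_num)).comp tendsto_natCast_atTop_atTop
  have h1 : ∀ᶠ n : ℕ in atTop, n ^ 10 ≤ n.choose (n / 2) := by
    have h := (tendsto_pow_const_div_const_pow_of_one_lt 11 (by norm_num : (1 : ℝ) < 2)).eventually
      (eventually_le_nhds (by norm_num : (0 : ℝ) < 1 / 2))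
    filter_upwards [h, eventually_ge_atTop 1] with n hn hn1
    rw [div_le_div_iff₀ (by positivity) (by norm_num)] at hn
    have h2 : n ^ 11 * 2 ≤ 2 ^ n := by
      have : (n : ℝ) ^ 11 * 2 ≤ 2 ^ n := by linarith
      exact_mod_cast this
    have h3 := two_pow_le_mul_choose n
    have h4 : (n + 1) * n ^ 10 ≤ (n + 1) * n.choose (n / 2) := by
      calc (n + 1) * n ^ 10 ≤ (n * 2) * n ^ 10 := Nat.mul_le_mul_right _ (by omega)
        _ = n ^ 11 * 2 := by ring
        _ ≤ _ := h2.trans h3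
    exact Nat.le_of_mul_le_mul_left h4 (by omega)
  have h2 : ∀ᶠ n : ℕ in atTop, n ^ 3 * 2 ^ (n / 15) ≤ 3 ^ (n / 15) := by
    have h := (tendsto_pow_const_div_const_pow_of_one_lt 3
      (by norm_num : (1 : ℝ) < 3 / 2)).eventually
      -- 4096 = 16³, to be used with n ≤ 16 · ⌊n/15⌋.
      (eventually_le_nhds (by norm_num : (0 : ℝ) < 1 / 4096))
    have h' := (Nat.tendsto_div_const_atTop (n := 15) (by norm_num)).eventually
      (h.and (eventually_ge_atTop 14))
    filter_upwards [h'] with n hn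
    obtain ⟨hn, hk⟩ := hn
    set k := n / 15 with hk_def
    have hnk : n ≤ 16 * k := by omega
    rw [div_pow, div_le_div_iff₀ (by positivity) (by norm_num)] at hn
    have h3 : (k : ℝ) ^ 3 * 4096 * 2 ^ k ≤ 3 ^ k := by
      have h5 := mul_le_mul_of_nonneg_right hn (by positivity : (0 : ℝ) ≤ 2 ^ k)
      have h6 : (1 : ℝ) * (3 ^ k / 2 ^ k) * 2 ^ k = 3 ^ k := by field_simp
      linarith
    have h4 : k ^ 3 * 4096 * 2 ^ k ≤ 3 ^ k := by exact_mod_cast h3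
    calc n ^ 3 * 2 ^ k ≤ (16 * k) ^ 3 * 2 ^ k :=
          Nat.mul_le_mul_right _ (Nat.pow_le_pow_left hnk 3)
      _ = k ^ 3 * 4096 * 2 ^ k := by ring
      _ ≤ _ := h4
  have h3 : ∀ᶠ n : ℕ in atTop, 40 * Real.logb 2 (n : ℝ) ^ 2 ≤ n := by
    have h := (Real.isLittleO_pow_log_id_atTop (n := 2)).comp_tendsto
      tendsto_natCast_atTop_atTop
    have h4 := h.bound (by positivity : (0 : ℝ) < Real.log 2 ^ 2 / 40)
    filter_upwards [h4] with n hn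
    simp only [Function.comp_apply, id_eq, Real.norm_eq_abs, abs_pow, sq_abs, Nat.abs_cast] at hn
    have hl : 0 < Real.log 2 := Real.log_pos (by norm_num)
    rw [Real.logb, div_pow, mul_div_assoc', div_le_iff₀ (by positivity)]
    linarith
  filter_upwards [h1, h2, h3, eventually_ge_atTop 200, hlog.eventually_ge_atTop (10 ^ 6)] with
    n a1 a2 a3 a4 a5
  exact ⟨a4, a1, choose_mul_le_of_pow_le a2, a5, a3⟩

namespace IsLarge

theorem cast_pos (h : IsLarge n) : (0 : ℝ) < n := by
  have := h.le
  exact_mod_cast (by omega : 0 < n)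

theorem le_cast (h : IsLarge n) : (200 : ℝ) ≤ n := by exact_mod_cast h.le

theorem pow_le (h : IsLarge n) : (n : ℝ) ^ 10 ≤ n.choose (n / 2) := by
  exact_mod_cast h.pow_le_choose

theorem choose_pos (h : IsLarge n) : (0 : ℝ) < n.choose (n / 2) :=
  lt_of_lt_of_le (pow_pos h.cast_pos 10) h.pow_le

theorem logb_succ_le (n : ℕ) : Real.logb 2 ((n : ℝ) + 1) ≤ n := by
  rw [Real.logb_le_iff_le_rpow (by norm_num) (by positivity), Real.rpow_natCast]
  exact_mod_cast Nat.lt_two_pow_self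

theorem logb_succ_nonneg (n : ℕ) : 0 ≤ Real.logb 2 ((n : ℝ) + 1) :=
  Real.logb_nonneg (by norm_num) (by linarith [Nat.cast_nonneg (α := ℝ) n])

theorem pow_seven_lt (h : IsLarge n) {r : ℕ} (hr : n.choose (n / 2) < n ^ 3 * n.choose r) :
    n ^ 7 < n.choose r := by
  have h1 : n ^ 3 * n ^ 7 < n ^ 3 * n.choose r := by
    calc n ^ 3 * n ^ 7 = n ^ 10 := by ring
      _ ≤ _ := h.pow_le_choose
      _ < _ := hr
  exact lt_of_mul_lt_mul_left h1 (Nat.zero_le _)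

theorem two_rpow_le_numSparsePaving (h : IsLarge n) :
    (2 : ℝ) ^ ((n.choose (n / 2) : ℝ) / n) ≤ numSparsePaving n := by
  have hn := h.le
  have h1 := two_rpow_le_card_stableSubsets (by omega : 0 < n) (layer n (n / 2))
  rw [card_layer] at h1
  refine h1.trans ?_
  exact_mod_cast card_stableSubsets_le_numSparsePaving (by omega) (by omega)

theorem le_logb_numSparsePaving (h : IsLarge n) :
    (n.choose (n / 2) : ℝ) / n ≤ Real.logb 2 (numSparsePaving n) := by
  have h1 := h.two_rpow_le_numSparsePaving
  rwa [Real.le_logb_iff_rpow_le (by norm_num)]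
  exact lt_of_lt_of_le (by positivity) h1

/-- Kleitman–Winston in the Johnson graph itself, at t = 1 with B = 6N/n. The `chooseSum` factor
costs at most 40wL² bits, and this is at most N/n because 40L² ≤ n. -/
theorem card_stableSubsets_le_of_mid (h : IsLarge n) (hn1 : n ≤ 3 * r) (hn2 : 3 * r ≤ 2 * n)
    (hN : n ^ 7 ≤ n.choose r) :
    (#(stableSubsets (layer n r)) : ℝ) ≤ (2 : ℝ) ^ (7 * (n.choose r : ℝ) / n) := by
  classical
  have hn := h.le
  have hn0 := h.cast_pos
  have hn200 := h.le_cast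
  set N : ℝ := ((n.choose r : ℕ) : ℝ) with hNdef
  have hNn : (n : ℝ) ^ 7 ≤ N := by rw [hNdef]; exact_mod_cast hN
  have hN0 : 0 < N := lt_of_lt_of_le (by positivity) hNn
  have hL1 := h.le_logb
  have hL2 := h.logb_sq_le
  set L := Real.logb 2 (n : ℝ) with hL
  have hN2 : (n : ℝ) ^ 2 ≤ N := le_trans (pow_le_pow_right₀ (by linarith) (by norm_num)) hNn
  set w : ℝ := N / (n : ℝ) ^ 2 with hw
  have hw1 : 1 ≤ w := by
    rw [le_div_iff₀ (by positivity)]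
    linarith
  set q : ℕ := ⌈18 * (w * L)⌉₊ with hq
  have hL0 : 0 ≤ L := by linarith
  have hq' : (q : ℝ) ≤ 18 * (w * L) + 1 := (Nat.ceil_lt_add_one (by positivity)).le
  have hβ : (n : ℝ) ^ 2 / (18 * N) ≤ 1 := by
    rw [div_le_one (by positivity)]
    linarith
  have hpow : (1 - (n : ℝ) ^ 2 / (18 * N)) ^ q ≤ 1 / (n : ℝ) ^ 1 := by
    refine one_sub_pow_le (n := n) (c := 1) (by omega) hβ ?_
    calc ((1 : ℕ) : ℝ) * L = n ^ 2 / (18 * N) * (18 * (w * L)) := by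
          rw [hw]; field_simp; norm_num
      _ ≤ n ^ 2 / (18 * N) * q := by
          apply mul_le_mul_of_nonneg_left (Nat.le_ceil _) (by positivity)
  have h1 := indepPoly_le (JAdj (n := n)) (layer n r) (t := 1) (β := (n : ℝ) ^ 2 / (18 * N))
    (B := 6 * N / n) zero_le_one le_rfl hβ (by
      intro C hC hCb
      obtain ⟨X, hX, hd⟩ := exists_degree_ge hn1 hn2 (by omega) hC hCb
      refine ⟨X, hX, hd.trans (le_of_eq ?_)⟩
      congr 2
      ext Y
      simp only [mem_filter]
      exact ⟨fun h => ⟨h.1, h.2.ne.symm, h.2⟩, fun h => ⟨h.1, h.2.2⟩⟩)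
      (n.choose r) q (layer n r) Subset.rfl (card_layer n r).le (by
        rw [card_layer, ← hNdef]
        calc N * (1 - (n : ℝ) ^ 2 / (18 * N)) ^ q ≤ N * (1 / (n : ℝ) ^ 1) :=
              mul_le_mul_of_nonneg_left hpow hN0.le
          _ = N / n := by rw [pow_one]; ring
          _ ≤ _ := div_le_div_of_nonneg_right (by linarith) hn0.le)
  have h2 : (#(stableSubsets (layer n r)) : ℝ) ≤ indepPoly (JAdj (n := n)) (layer n r) 1 := by
    unfold indepPoly
    simp only [one_pow, sum_const, nsmul_eq_mul, mul_one]
    have : stableSubsets (layer n r) ⊆ indepSets JAdj (layer n r) := by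
      intro S hS
      rw [mem_stableSubsets] at hS
      rw [mem_indepSets]
      exact ⟨hS.1, fun a ha b hb _ => hS.2 a ha b hb⟩
    exact_mod_cast card_le_card this
  have h3 := chooseSum_le_two_rpow (n := n) (by omega) (n.choose r) q 2
  rw [← hNdef, ← hw, ← hL] at h3
  refine h2.trans (h1.trans ?_)
  rw [one_add_one_eq_two]
  calc (2 : ℝ) ^ (6 * N / n) * chooseSum (n.choose r) q
      ≤ 2 ^ (6 * N / n) * 2 ^ (((2 : ℕ) : ℝ) * L * q + 2 * w) :=
        mul_le_mul_of_nonneg_left h3 (by positivity)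
    _ = 2 ^ (6 * N / n + (((2 : ℕ) : ℝ) * L * q + 2 * w)) := by
        rw [← Real.rpow_add (by norm_num)]
    _ ≤ _ := by
        apply Real.rpow_le_rpow_of_exponent_le (by norm_num)
        have h4 : N / n = w * n := by rw [hw]; field_simp
        have h5 : 7 * N / n = 6 * N / n + w * n := by rw [← h4]; ring
        rw [h5]
        apply add_le_add le_rfl
        have h6 : ((2 : ℕ) : ℝ) * L * q ≤ 36 * (w * L ^ 2) + 2 * L := by
          have := mul_le_mul_of_nonneg_left hq' (by linarith : 0 ≤ 2 * L)
          push_cast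
          linarith
        have h7 : L ≤ w * L ^ 2 := by nlinarith
        have h8 : w ≤ w * L ^ 2 := by nlinarith
        have h9 := mul_le_mul_of_nonneg_left hL2 (by linarith : 0 ≤ w)
        linarith

/-- Middle ranks cost 7N/n bits by Kleitman–Winston and outer ranks fewer trivially; the sum over n
+ 1 ranks costs at most one more N/n. -/
theorem logb_numSparsePaving_le (h : IsLarge n) :
    Real.logb 2 (numSparsePaving n) ≤ 8 * (n.choose (n / 2) : ℝ) / n := by
  have hn := h.le
  have hn0 := h.cast_pos
  have hn200 := h.le_cast
  have hpow := h.pow_le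
  have hNpos := h.choose_pos
  set N : ℝ := ((n.choose (n / 2) : ℕ) : ℝ) with hN
  have h1 : ∀ r ∈ range (n + 1), (#(stableSubsets (layer n r)) : ℝ) ≤ (2 : ℝ) ^ (7 * N / n) := by
    intro r _
    by_cases hr : n ^ 3 * n.choose r ≤ n.choose (n / 2)
    · have h2 : #(stableSubsets (layer n r)) ≤ 2 ^ n.choose r := by
        rw [← card_layer n r, ← card_powerset]
        apply card_le_card
        intro S hS
        exact mem_powerset.2 (mem_stableSubsets.1 hS).1
      have h3 : (#(stableSubsets (layer n r)) : ℝ) ≤ 2 ^ (n.choose r : ℝ) := by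
        rw [Real.rpow_natCast]
        exact_mod_cast h2
      refine h3.trans (Real.rpow_le_rpow_of_exponent_le (by norm_num) ?_)
      rw [le_div_iff₀ hn0]
      have h4 : (n : ℝ) ^ 3 * n.choose r ≤ N := by rw [hN]; exact_mod_cast hr
      have h5 : (n.choose r : ℝ) * n ≤ n ^ 3 * n.choose r := by
        have h6 : (n : ℝ) ≤ n ^ 3 := le_self_pow₀ (by linarith) (by norm_num)
        have := mul_le_mul_of_nonneg_right h6 (Nat.cast_nonneg (α := ℝ) (n.choose r))
        linarith
      linarith
    · obtain ⟨h2, h3⟩ := (h.dichotomy r).resolve_left hr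
      push Not at hr
      refine (h.card_stableSubsets_le_of_mid h2 h3 (h.pow_seven_lt hr).le).trans ?_
      apply Real.rpow_le_rpow_of_exponent_le (by norm_num)
      apply div_le_div_of_nonneg_right _ hn0.le
      have : (n.choose r : ℝ) ≤ N := by rw [hN]; exact_mod_cast Nat.choose_le_middle r n
      linarith
  have h2 : (numSparsePaving n : ℝ) ≤ (n + 1) * (2 : ℝ) ^ (7 * N / n) := by
    have h3 : (numSparsePaving n : ℝ) ≤ ∑ r ∈ range (n + 1), (#(stableSubsets (layer n r)) : ℝ) := by
      exact_mod_cast numSparsePaving_le n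
    refine h3.trans ((sum_le_sum h1).trans ?_)
    simp
  have hs : (0 : ℝ) < numSparsePaving n :=
    lt_of_lt_of_le (by positivity) h.two_rpow_le_numSparsePaving
  rw [Real.logb_le_iff_le_rpow (by norm_num) hs]
  refine h2.trans ?_
  have h4 : ((n : ℝ) + 1) ≤ 2 ^ (n : ℝ) := by
    rw [Real.rpow_natCast]
    exact_mod_cast Nat.lt_two_pow_self
  calc ((n : ℝ) + 1) * 2 ^ (7 * N / n) ≤ 2 ^ (n : ℝ) * 2 ^ (7 * N / n) :=
        mul_le_mul_of_nonneg_right h4 (by positivity)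
    _ = 2 ^ (n + 7 * N / n) := by rw [← Real.rpow_add (by norm_num)]
    _ ≤ _ := by
        apply Real.rpow_le_rpow_of_exponent_le (by norm_num)
        have h5 : (n : ℝ) ≤ N / n := by
          rw [le_div_iff₀ hn0]
          have : (n : ℝ) ^ 2 ≤ n ^ 10 := pow_le_pow_right₀ (by linarith) (by norm_num)
          nlinarith
        have h6 : 8 * N / n = N / n + 7 * N / n := by ring
        rw [h6]
        linarith

theorem bigUpsilon_eq (n : ℕ) : bigUpsilon n =
    285 * Real.logb 2 n ^ 3 / (n : ℝ) ^ 2 * n.choose (n / 2) := by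
  rw [bigUpsilon, zetaBound]
  ring

/-- Υ(n) = 285 L³/n² · C(n,⌊n/2⌋), and 285/8 > 35. -/
theorem le_upsilon (h : IsLarge n) : 35 * Real.logb 2 n ^ 3 / n ≤ upsilon n := by
  have hn0 := h.cast_pos
  have hN0 := h.choose_pos
  have h1 := h.logb_numSparsePaving_le
  have h2 := h.le_logb_numSparsePaving
  have h3 : 0 < Real.logb 2 (numSparsePaving n : ℝ) := lt_of_lt_of_le (by positivity) h2
  have hL : 0 ≤ Real.logb 2 (n : ℝ) := by linarith [h.le_logb]
  have h4 := logb_succ_nonneg n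
  rw [upsilon, bigUpsilon_eq, le_div_iff₀ h3]
  calc 35 * Real.logb 2 n ^ 3 / n * Real.logb 2 (numSparsePaving n : ℝ)
      ≤ 35 * Real.logb 2 n ^ 3 / n * (8 * (n.choose (n / 2) : ℝ) / n) :=
        mul_le_mul_of_nonneg_left h1 (by positivity)
    _ = 280 * Real.logb 2 n ^ 3 / (n : ℝ) ^ 2 * n.choose (n / 2) := by ring
    _ ≤ 285 * Real.logb 2 n ^ 3 / (n : ℝ) ^ 2 * n.choose (n / 2) := by
        gcongr
        norm_num
    _ ≤ _ := by linarith

theorem upsilon_le (h : IsLarge n) : upsilon n + 2 / n ≤ 288 * (Real.logb 2 n ^ 3 / n) := by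
  have hn0 := h.cast_pos
  have hN0 := h.choose_pos
  have hn200 := h.le_cast
  have h2 := h.le_logb_numSparsePaving
  have h3 : 0 < Real.logb 2 (numSparsePaving n : ℝ) := lt_of_lt_of_le (by positivity) h2
  have hL : 1 ≤ Real.logb 2 (n : ℝ) := by linarith [h.le_logb]
  have hL3 : 1 ≤ Real.logb 2 (n : ℝ) ^ 3 := one_le_pow₀ hL
  have h4 := logb_succ_le n
  have h5 : upsilon n ≤ 286 * (Real.logb 2 n ^ 3 / n) := by
    rw [upsilon, bigUpsilon_eq, div_le_iff₀ h3]
    calc 285 * Real.logb 2 n ^ 3 / (n : ℝ) ^ 2 * n.choose (n / 2) +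
          2 * Real.logb 2 ((n : ℝ) + 1)
        ≤ 285 * Real.logb 2 n ^ 3 / (n : ℝ) ^ 2 * n.choose (n / 2) +
          Real.logb 2 n ^ 3 / (n : ℝ) ^ 2 * n.choose (n / 2) := by
          have h6 : 2 * (n : ℝ) ≤ 1 / (n : ℝ) ^ 2 * n.choose (n / 2) := by
            rw [div_mul_eq_mul_div, one_mul, le_div_iff₀ (by positivity)]
            have h7 : (n : ℝ) ^ 4 ≤ n ^ 10 := pow_le_pow_right₀ (by linarith) (by norm_num)
            have h8 : 2 * (n : ℝ) * n ^ 2 ≤ n ^ 4 := by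
              have := mul_le_mul_of_nonneg_right hn200 (by positivity : (0 : ℝ) ≤ n ^ 3)
              nlinarith
            linarith [h.pow_le]
          have h9 : 1 / (n : ℝ) ^ 2 * n.choose (n / 2) ≤
              Real.logb 2 n ^ 3 / (n : ℝ) ^ 2 * n.choose (n / 2) := by gcongr
          linarith
      _ = 286 * (Real.logb 2 n ^ 3 / n) * ((n.choose (n / 2) : ℝ) / n) := by
          field_simp; norm_num
      _ ≤ _ := mul_le_mul_of_nonneg_left h2 (by positivity)
  have h6 : 2 / (n : ℝ) ≤ 2 * (Real.logb 2 n ^ 3 / n) := by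
    rw [mul_div_assoc']
    exact div_le_div_of_nonneg_right (by linarith) hn0.le
  linarith

/-- Few matroids of a given rank have many dependent sets. -/
theorem ncard_bad_le (h : IsLarge n) (r : ℕ) :
    ((n : ℝ) + 1) ^ 2 * ({M ∈ matroidsOn n | upsilon n + 2 / (n : ℝ) < depFraction M ∧
      rk M = r}.ncard : ℝ) ≤ numSparsePaving n := by
  have hn := h.le
  have hn0 := h.cast_pos
  have hn200 := h.le_cast
  have hpow := h.pow_le
  set 𝓜 := {M ∈ matroidsOn n | upsilon n + 2 / (n : ℝ) < depFraction M ∧ rk M = r} with h𝓜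
  have hsub : 𝓜 ⊆ matroidsOn n := fun M hM => hM.1
  have hrk : ∀ M ∈ 𝓜, rk M = r := fun M hM => hM.2.2
  have hsq : ((n : ℝ) + 1) ^ 2 ≤ 2 ^ (2 * (n : ℝ)) := by
    have h4 : ((n : ℝ) + 1) ≤ 2 ^ (n : ℝ) := by
      rw [Real.rpow_natCast]
      exact_mod_cast Nat.lt_two_pow_self
    calc ((n : ℝ) + 1) ^ 2 ≤ (2 ^ (n : ℝ)) ^ 2 := pow_le_pow_left₀ (by positivity) h4 2
      _ = _ := by
        rw [← Real.rpow_natCast, ← Real.rpow_mul (by norm_num), mul_comm]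
        norm_num
  -- Outer ranks: even all 2^C(n,r) families of r-sets are few compared with s(n).
  by_cases hr : n ^ 3 * n.choose r ≤ n.choose (n / 2)
  · set N : ℝ := ((n.choose (n / 2) : ℕ) : ℝ) with hN
    have h1 : (𝓜.ncard : ℝ) ≤ 2 ^ (n.choose r : ℝ) := by
      rw [Real.rpow_natCast]
      exact_mod_cast ncard_le_two_pow hsub hrk
    refine le_trans ?_ h.two_rpow_le_numSparsePaving
    calc ((n : ℝ) + 1) ^ 2 * 𝓜.ncard ≤ 2 ^ (2 * (n : ℝ)) * 2 ^ (n.choose r : ℝ) :=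
          mul_le_mul hsq h1 (by positivity) (by positivity)
      _ = 2 ^ (2 * (n : ℝ) + n.choose r) := by rw [← Real.rpow_add (by norm_num)]
      _ ≤ _ := by
          apply Real.rpow_le_rpow_of_exponent_le (by norm_num)
          rw [le_div_iff₀ hn0]
          have h4 : (n : ℝ) ^ 3 * n.choose r ≤ N := by rw [hN]; exact_mod_cast hr
          have h6 : 2 * (n : ℝ) ≤ n ^ 3 := by nlinarith
          have h5 : 2 * ((n.choose r : ℝ) * n) ≤ n ^ 3 * n.choose r := by
            have := mul_le_mul_of_nonneg_right h6 (Nat.cast_nonneg (α := ℝ) (n.choose r))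
            linarith
          have h7 : (n : ℝ) ^ 3 ≤ n ^ 10 := pow_le_pow_right₀ (by linarith) (by norm_num)
          have h8 : 4 * ((n : ℝ) * n) ≤ n ^ 3 := by nlinarith
          linarith
  · obtain ⟨hn1, hn2⟩ := (h.dichotomy r).resolve_left hr
    push Not at hr
    have h7 := h.pow_seven_lt hr
    obtain ⟨𝒦, hc, h𝒦⟩ := exists_image_matroidNonBases hsub hrk
    -- The summand 2/n of the threshold is dropped; υ(n) alone suffices.
    have h1 := card_large_nonBases_le h.le hn1 hn2 (b := upsilon n * n.choose r)
      (le_trans (Nat.pow_le_pow_right (by omega) (by norm_num)) h7.le)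
      (by
        refine (two_pow_le_mul_choose n).trans ?_
        rw [mul_assoc]
        exact Nat.mul_le_mul_left _ hr.le) 𝒦 (by
        intro K hK
        obtain ⟨M, hM, rfl⟩ := h𝒦 K hK
        have hMr := hM.2.2
        refine ⟨⟨fun X => M.Indep (X : Set (Fin n)), hMr ▸ isIndepFamily_indep M, ?_⟩, ?_⟩
        · rw [← hMr]
          rfl
        · have h2 := hM.2.1
          rw [depFraction_eq hM.1, hMr, lt_div_iff₀ (by
            exact_mod_cast lt_of_le_of_lt (Nat.zero_le _) h7)] at h2
          have h3 : 0 ≤ 2 / (n : ℝ) * n.choose r := by positivity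
          linarith)
    rw [← hc]
    have h2 : (#(stableSubsets (layer n r)) : ℝ) ≤ numSparsePaving n := by
      exact_mod_cast card_stableSubsets_le_numSparsePaving (by omega) (by omega)
    have hup := h.le_upsilon
    have hL := h.le_logb
    set L := Real.logb 2 (n : ℝ) with hLdef
    set N : ℝ := ((n.choose r : ℕ) : ℝ) with hN
    have hN7 : (n : ℝ) ^ 7 ≤ N := by rw [hN]; exact_mod_cast h7.le
    have hN0 : 0 < N := lt_of_lt_of_le (by positivity) hN7
    set e : ℝ := 17000 * N * L ^ 2 / (n : ℝ) ^ 2 - (upsilon n * N - 6 * N / n) / (1792 * n)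
      with he
    have hexp : e ≤ -(2 * (n : ℝ)) := by
      have h3 : 35 * L ^ 3 / n * N ≤ upsilon n * N := mul_le_mul_of_nonneg_right hup hN0.le
      have h4 : e ≤ N / n ^ 2 * (17000 * L ^ 2 - (35 * L ^ 3 - 6) / 1792) := by
        have h5 : (35 * L ^ 3 / n * N - 6 * N / n) / (1792 * n) ≤
            (upsilon n * N - 6 * N / n) / (1792 * n) :=
          div_le_div_of_nonneg_right (by linarith) (by positivity)
        have h6 : (35 * L ^ 3 / n * N - 6 * N / n) / (1792 * n) =
            N / n ^ 2 * ((35 * L ^ 3 - 6) / 1792) := by field_simp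
        have h8 : 17000 * N * L ^ 2 / (n : ℝ) ^ 2 = N / n ^ 2 * (17000 * L ^ 2) := by ring
        rw [he, h8, mul_sub]
        linarith
      -- This is where L ≥ 10^6 enters: 35 · 10^6 / 1792 > 19000 exceeds 17000.
      have h9 : 17000 * L ^ 2 - (35 * L ^ 3 - 6) / 1792 ≤ -1 := by
        have h10 := mul_le_mul_of_nonneg_right hL (sq_nonneg L)
        have h11 : 1 ≤ L ^ 2 := one_le_pow₀ (by linarith)
        linarith
      have h12 : 2 * (n : ℝ) ≤ N / n ^ 2 := by
        rw [le_div_iff₀ (by positivity)]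
        have h13 : (n : ℝ) ^ 4 ≤ n ^ 7 := pow_le_pow_right₀ (by linarith) (by norm_num)
        have h14 := mul_le_mul_of_nonneg_right hn200 (by positivity : (0 : ℝ) ≤ n ^ 3)
        nlinarith
      have h15 := mul_le_mul_of_nonneg_left h9 (by positivity : 0 ≤ N / (n : ℝ) ^ 2)
      linarith
    calc ((n : ℝ) + 1) ^ 2 * #𝒦 ≤ 2 ^ (2 * (n : ℝ)) * (numSparsePaving n * 2 ^ e) := by
          refine mul_le_mul hsq (h1.trans ?_) (by positivity) (by positivity)
          exact mul_le_mul_of_nonneg_right h2 (by positivity)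
      _ = numSparsePaving n * 2 ^ (2 * (n : ℝ) + e) := by
          rw [Real.rpow_add (by norm_num)]
          ring
      _ ≤ numSparsePaving n * 2 ^ (0 : ℝ) := by
          apply mul_le_mul_of_nonneg_left _ (by positivity)
          exact Real.rpow_le_rpow_of_exponent_le (by norm_num) (by linarith)
      _ = _ := by rw [Real.rpow_zero, mul_one]

/-- Each of the n + 1 ranks contributes at most s(n)/(n+1)², and s(n) is at most the number of all
matroids. -/
theorem mul_ncard_bad_le (h : IsLarge n) :
    ((n : ℝ) + 1) * ({M ∈ matroidsOn n | ¬ depFraction M ≤ upsilon n + 2 / (n : ℝ)}.ncard : ℝ) ≤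
      (matroidsOn n).ncard := by
  classical
  set 𝓜 := {M ∈ matroidsOn n | ¬ depFraction M ≤ upsilon n + 2 / (n : ℝ)} with h𝓜
  have hfin : 𝓜.Finite := (matroidsOn_finite n).subset fun M hM => hM.1
  have h1 : 𝓜.ncard = ∑ r ∈ range (n + 1), {M ∈ matroidsOn n |
      upsilon n + 2 / (n : ℝ) < depFraction M ∧ rk M = r}.ncard := by
    rw [Set.ncard_eq_toFinset_card _ hfin, card_eq_sum_card_fiberwise (f := rk)
      (t := range (n + 1)) (fun M _ => by
        rw [mem_coe, mem_range]
        exact Nat.lt_succ_of_le (rk_le M))]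
    apply sum_congr rfl
    intro r _
    rw [← Set.ncard_coe_finset]
    congr 1
    ext M
    simp [h𝓜, and_assoc]
  have h2 : ((n : ℝ) + 1) * (((n : ℝ) + 1) * (𝓜.ncard : ℝ)) ≤
      ((n : ℝ) + 1) * (numSparsePaving n : ℝ) := by
    rw [h1]
    push_cast
    calc _ = ∑ r ∈ range (n + 1), ((n : ℝ) + 1) ^ 2 * ({M ∈ matroidsOn n |
          upsilon n + 2 / (n : ℝ) < depFraction M ∧ rk M = r}.ncard : ℝ) := by
          rw [← mul_sum]; ring
      _ ≤ ∑ r ∈ range (n + 1), (numSparsePaving n : ℝ) := sum_le_sum fun r _ => h.ncard_bad_le r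
      _ = _ := by simp
  have h3 := le_of_mul_le_mul_left h2 (by positivity)
  refine h3.trans ?_
  exact Nat.cast_le.2 (Set.ncard_le_ncard (fun M hM => hM.1) (matroidsOn_finite n))

end IsLarge

theorem ncard_matroidsOn_pos (n : ℕ) : 0 < (matroidsOn n).ncard := by
  rw [Set.ncard_pos (matroidsOn_finite n)]
  exact ⟨Matroid.loopyOn Set.univ, rfl⟩

theorem almostAllMatroids_of_eventually {P : ∀ n : ℕ, Matroid (Fin n) → Prop}
    (h : ∀ᶠ n : ℕ in atTop, ((n : ℝ) + 1) * ({M ∈ matroidsOn n | ¬ P n M}.ncard : ℝ) ≤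
      (matroidsOn n).ncard) : AlmostAllMatroids P := by
  have h1 : Tendsto (fun n : ℕ => 1 - 1 / ((n : ℝ) + 1)) atTop (𝓝 1) := by
    simpa using (tendsto_const_nhds (x := (1 : ℝ))).sub
      (tendsto_one_div_add_atTop_nhds_zero_nat (𝕜 := ℝ))
  refine tendsto_of_tendsto_of_tendsto_of_le_of_le' h1 tendsto_const_nhds ?_ ?_
  · filter_upwards [h] with n hn
    have hpos : (0 : ℝ) < (matroidsOn n).ncard := by exact_mod_cast ncard_matroidsOn_pos n
    have h2 : {M ∈ matroidsOn n | P n M}.ncard + {M ∈ matroidsOn n | ¬ P n M}.ncard =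
        (matroidsOn n).ncard := by
      rw [← Set.ncard_union_eq _ ((matroidsOn_finite n).subset fun M hM => hM.1)
        ((matroidsOn_finite n).subset fun M hM => hM.1)]
      · congr 1
        ext M
        simp only [Set.mem_union, Set.mem_ofPred_eq]
        tauto
      · rw [Set.disjoint_left]
        exact fun M hM hM' => hM'.2 hM.2
    have h3 : ({M ∈ matroidsOn n | P n M}.ncard : ℝ) +
        ({M ∈ matroidsOn n | ¬ P n M}.ncard : ℝ) = (matroidsOn n).ncard := by exact_mod_cast h2
    have h4 : ({M ∈ matroidsOn n | ¬ P n M}.ncard : ℝ) ≤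
        (matroidsOn n).ncard / ((n : ℝ) + 1) := by
      rw [le_div_iff₀ (by positivity)]
      linarith
    rw [le_div_iff₀ hpos, sub_mul, one_mul, div_mul_eq_mul_div, one_mul]
    linarith
  · filter_upwards with n
    have hpos : (0 : ℝ) < (matroidsOn n).ncard := by exact_mod_cast ncard_matroidsOn_pos n
    rw [div_le_one hpos]
    exact Nat.cast_le.2 (Set.ncard_le_ncard (fun M hM => hM.1) (matroidsOn_finite n))

theorem almostAllMatroids_mono {P Q : ∀ n : ℕ, Matroid (Fin n) → Prop} (hP : AlmostAllMatroids P)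
    (h : ∀ᶠ n : ℕ in atTop, ∀ M ∈ matroidsOn n, P n M → Q n M) : AlmostAllMatroids Q := by
  refine tendsto_of_tendsto_of_tendsto_of_le_of_le' hP tendsto_const_nhds ?_ ?_
  · filter_upwards [h] with n hn
    apply div_le_div_of_nonneg_right _ (Nat.cast_nonneg _)
    exact Nat.cast_le.2 (Set.ncard_le_ncard (fun M hM => ⟨hM.1, hn M hM.1 hM.2⟩)
      ((matroidsOn_finite n).subset fun M hM => hM.1))
  · filter_upwards with n
    have hpos : (0 : ℝ) < (matroidsOn n).ncard := by exact_mod_cast ncard_matroidsOn_pos n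
    rw [div_le_one hpos]
    exact Nat.cast_le.2 (Set.ncard_le_ncard (fun M hM => hM.1) (matroidsOn_finite n))

end MatroidAsymptotics

theorem theorem4p6 :
    MatroidAsymptotics.AlmostAllMatroids (fun n M =>
      MatroidAsymptotics.depFraction M ≤ MatroidAsymptotics.upsilon n + 2 / (n : ℝ)) ∧
    Asymptotics.IsBigO Filter.atTop
      (fun n : ℕ => MatroidAsymptotics.upsilon n + 2 / (n : ℝ))
      (fun n : ℕ => Real.logb 2 (n : ℝ) ^ 3 / (n : ℝ)) ∧
    ∃ C : ℝ, 0 < C ∧ MatroidAsymptotics.AlmostAllMatroids (fun n M =>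
      1 - MatroidAsymptotics.baseFraction M ≤ C * (Real.logb 2 (n : ℝ) ^ 3 / (n : ℝ))) := by
  have hlarge := MatroidAsymptotics.eventually_isLarge
  have h1 : MatroidAsymptotics.AlmostAllMatroids (fun n M =>
      MatroidAsymptotics.depFraction M ≤ MatroidAsymptotics.upsilon n + 2 / (n : ℝ)) :=
    MatroidAsymptotics.almostAllMatroids_of_eventually (hlarge.mono fun n h => h.mul_ncard_bad_le)
  refine ⟨h1, ?_, 288, by norm_num, ?_⟩
  · refine Asymptotics.IsBigO.of_bound 288 (hlarge.mono fun n h => ?_)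
    have hn0 := h.cast_pos
    have hL : 0 ≤ Real.logb 2 (n : ℝ) := by linarith [h.le_logb]
    have h2 : 0 ≤ MatroidAsymptotics.upsilon n :=
      le_trans (by positivity) h.le_upsilon
    rw [Real.norm_of_nonneg (by positivity), Real.norm_of_nonneg (by positivity)]
    exact h.upsilon_le
  · refine MatroidAsymptotics.almostAllMatroids_mono h1 (hlarge.mono fun n h M hM hd => ?_)
    rw [MatroidAsymptotics.one_sub_baseFraction_eq hM]
    exact hd.trans h.upsilon_le
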